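/- Let $\Omega\subset\mathbb R^2=\mathbb C$ be a bounded open set, let $\mu$ be a (signed, real) Radon measure on $\Omega$, and let $h\in H^1(\Omega)$ be real valued with $\Delta h=\mu$ in the sense of distributions in $\Omega$. Suppose that $h$ is stationary harmonic, i.e. that both rows of the stress-energy tensor $$T_h=\begin{pmatrix}\tfrac12\left[(\partial_yh)^2-(\partial_xh)^2\right]&-\partial_xh\,\partial_yh\\-\partial_xh\,\partial_yh&\tfrac12\left[(\partial_xh)^2-(\partial_yh)^2\right]\end{pmatrix}$$ are divergence free in the sense of distributions in $\Omega$. Then $\omega_h:=(\partial_xh)^2-(\partial_yh)^2-2i\,\partial_xh\,\partial_yh$ agrees almost everywhere with a holomorphic function on $\Omega$, and $h$ agrees almost everywhere with a continuous function on $\Omega$; from now on $\omega_h$ and $h$ denote these representatives. Let $z_0\in\operatorname{supp}\mu$ be a zero of odd order of $\omega_h$, with $h(z_0)=0$. Then there exist an open neighborhood $V\subset\Omega$ of $z_0$, a multivalued harmonic function $H_1$ in $V$ which is single valued up to a sign (near each point of $V\setminus\{z_0\}$ its values are $\pm u$ with $u$ harmonic), so that $H:=|H_1|$ is single valued, and a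 function $\theta:V\to\{\pm1\}$, such that: 1. $h=\theta H$ in $V$, the function $\theta H$ is continuous in $V$, and $H$ is differentiable at $z_0$ with $\nabla H(z_0)=0$; 2. the support of $\mu_{\lfloor V}$ (relative to $V$) is a finite union of smooth simple curves contained in $\{z\in V: H(z)=0\}$, each of which ends at $z_0$; 3. there is a unique integer $n\ge1$ for which there exist $r>0$ and a biholomorphism $\Phi:B(0,r)\to V$ with $\Phi(0)=z_0$ and $$H_1\circ\Phi(z)=\operatorname{Re}\bigl(z^{n+\frac12}\bigr)\quad\text{for all }z\in B(0,r),$$ as an equality of multivalued functions (both determinations $\pm$ of $z^{n+1/2}$ being taken). -/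

import Mathlib

open MeasureTheory Set Filter Topology InnerProductSpace
open scoped Distributions

noncomputable section

/-- The partial derivative `∂ₓ φ` of a function on the plane `ℂ = ℝ²`. -/
def partialX (φ : ℂ → ℝ) (z : ℂ) : ℝ := fderiv ℝ φ z 1

/-- The partial derivative `∂_y φ` of a function on the plane `ℂ = ℝ²`. -/
def partialY (φ : ℂ → ℝ) (z : ℂ) : ℝ := fderiv ℝ φ z Complex.I

/-- A (signed, real) Radon measure on the open set `Ω`, given by its Jordan decomposition: the
positive and the negative part are mutually singular Borel measures carried by `Ω` and finite on
the compact subsets of `Ω`. The total mass may be infinite. -/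
structure SignedRadonMeasure (Ω : TopologicalSpace.Opens ℂ) where
  pos : Measure ℂ
  neg : Measure ℂ
  pos_compl : pos (Ω : Set ℂ)ᶜ = 0
  neg_compl : neg (Ω : Set ℂ)ᶜ = 0
  pos_lt_top : ∀ K : Set ℂ, IsCompact K → K ⊆ Ω → pos K < ⊤
  neg_lt_top : ∀ K : Set ℂ, IsCompact K → K ⊆ Ω → neg K < ⊤
  mutuallySingular : pos ⟂ₘ neg

namespace SignedRadonMeasure

variable {Ω : TopologicalSpace.Opens ℂ}

/-- The total variation measure `|μ|`. -/
def totalVariation (μ : SignedRadonMeasure Ω) : Measure ℂ := μ.pos + μ.neg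

/-- The support of `μ` in `Ω`: the complement in `Ω` of the largest open `|μ|`-null set. -/
def support (μ : SignedRadonMeasure Ω) : Set ℂ := Ω ∩ μ.totalVariation.support

/-- The pairing `∫ φ dμ` with a test function. -/
def pairing (μ : SignedRadonMeasure Ω) (φ : 𝓓(Ω, ℝ)) : ℝ :=
  ∫ z, φ z ∂μ.pos - ∫ z, φ z ∂μ.neg

end SignedRadonMeasure

/-- `h ∈ H¹(Ω)`, with weak partial derivatives `hx` and `hy`. -/
structure IsH1WithGradient (Ω : TopologicalSpace.Opens ℂ) (h hx hy : ℂ → ℝ) : Prop where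
  memLp : MemLp h 2 (volume.restrict Ω)
  memLp_x : MemLp hx 2 (volume.restrict Ω)
  memLp_y : MemLp hy 2 (volume.restrict Ω)
  weak_x : ∀ φ : 𝓓(Ω, ℝ), ∫ z in Ω, h z * partialX φ z = -∫ z in Ω, hx z * φ z
  weak_y : ∀ φ : 𝓓(Ω, ℝ), ∫ z in Ω, h z * partialY φ z = -∫ z in Ω, hy z * φ z

/-- `Δ h = μ` in `Ω` in the sense of distributions. -/
def HasDistribLaplacian (Ω : TopologicalSpace.Opens ℂ) (h : ℂ → ℝ) (μ : SignedRadonMeasure Ω) :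
    Prop :=
  ∀ φ : 𝓓(Ω, ℝ), ∫ z in Ω, h z * Laplacian.laplacian (φ : ℂ → ℝ) z = μ.pairing φ

/-- The function with gradient `(hx, hy)` is stationary harmonic in `Ω`: both rows of its
stress-energy tensor `T = (T₁₁, T₁₂; T₂₁, T₂₂)`, where `T₁₁ = (hy² - hx²) / 2 = - T₂₂` and
`T₁₂ = T₂₁ = - hx hy`, are divergence free in the sense of distributions. -/
def IsStationaryHarmonic (Ω : TopologicalSpace.Opens ℂ) (hx hy : ℂ → ℝ) : Prop :=
  (∀ φ : 𝓓(Ω, ℝ), ∫ z in Ω,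
    (((hy z ^ 2 - hx z ^ 2) / 2) * partialX φ z + (-(hx z * hy z)) * partialY φ z) = 0) ∧
  (∀ φ : 𝓓(Ω, ℝ), ∫ z in Ω,
    ((-(hx z * hy z)) * partialX φ z + ((hx z ^ 2 - hy z ^ 2) / 2) * partialY φ z) = 0)

/-- The function `ω_h = (∂ₓh)² - (∂_y h)² - 2 i ∂ₓh ∂_y h`. -/
def hopfDifferential (hx hy : ℂ → ℝ) (z : ℂ) : ℂ :=
  (hx z : ℂ) ^ 2 - (hy z : ℂ) ^ 2 - 2 * Complex.I * (hx z : ℂ) * (hy z : ℂ)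

/-- `F` is a multivalued harmonic function in `V`, single valued up to a sign, with no branch
point other than `b`: it has values everywhere in `V`, and near each point of `V \ {b}` its
values are those of the two branches `u` and `-u`, with `u` harmonic. -/
def IsMultivaluedHarmonicOn (F : ℂ → Set ℝ) (V : Set ℂ) (b : ℂ) : Prop :=
  (∀ z ∈ V, (F z).Nonempty) ∧
  ∀ p ∈ V \ {b}, ∃ U : Set ℂ, IsOpen U ∧ p ∈ U ∧ U ⊆ V \ {b} ∧
    ∃ u : ℂ → ℝ, HarmonicOnNhd u U ∧ ∀ z ∈ U, F z = {u z, -u z}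

/-- The set of values at `z` of the multivalued function `Re (z ^ (n + 1/2))`: the values of
`z ^ (n + 1/2)` are the two square roots of `z ^ (2 n + 1)`. -/
def reHalfPow (n : ℕ) (z : ℂ) : Set ℝ :=
  {t | ∃ w : ℂ, w ^ 2 = z ^ (2 * n + 1) ∧ t = w.re}

/-- `Φ` is a biholomorphism from `U` onto `V`. -/
def IsBiholomorphism (Φ : ℂ → ℂ) (U V : Set ℂ) : Prop :=
  DifferentiableOn ℂ Φ U ∧ BijOn Φ U V ∧
    ∃ Ψ : ℂ → ℂ, DifferentiableOn ℂ Ψ V ∧ InvOn Ψ Φ U V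

/-- `γ`, on the interval `[0, 1)`, is a smooth simple regular curve which ends at `z₀ = γ 0`
(smoothly up to this end point). -/
def IsSmoothCurveEndingAt (γ : ℝ → ℂ) (z₀ : ℂ) : Prop :=
  γ 0 = z₀ ∧ ContDiffOn ℝ ((⊤ : ℕ∞) : WithTop ℕ∞) γ (Ico 0 1) ∧ InjOn γ (Ico 0 1) ∧
    ∀ t ∈ Ico (0 : ℝ) 1, derivWithin γ (Ico 0 1) t ≠ 0

end

/-! Stationarity is the weak Cauchy-Riemann equation for `ω_h`, so Weyl's lemma
(`exists_holomorphic_representative`) makes `ω_h` holomorphic. Since `|ω_h| = |∇h|²`, the gradient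
is locally bounded, and `h` has a locally Lipschitz representative whose complex gradient `∂ₓh - i
∂_y h` is almost everywhere a square root of `ω` (`exists_regular_representatives`). The only
freedom left in `∇h` is a measurable choice of sign, and `μ` records where it changes.

In a coordinate `w` with `dw² = ω dz²` the gradient of `h` is `(±1, 0)`. Hence `h` depends on `Re w`
only, through a function `f` with `f' = ±1` (`eq_of_re_eq`), and `μ` becomes `f'' ⊗ dy`. A change of
sign of `f'` costs the mass 2 per unit of length of the vertical line, over the whole height of the
rectangle; so if `|μ|` is small on one slab of a rectangle, `h` is affine on all of it
(`exists_eq_affine`).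

At a zero of order `2k + 1` there is a coordinate `ζ` in which `ω dz²` is the square of `d(ζ^(k +
3/2))` (`exists_normalForm`). The branches of `w = ζ^(k + 3/2)` with `Re w > 0` cut the disc into
`2k + 3` sectors. Thin strips `0 < Re w < x`, at a height bounded away from the vertex, have mass
tending to zero with `x`, as `μ` is finite on compact sets; so near the vertex `h = ε_j Re w` in the
sector `j`, with `ε_j = ±1`, the constant being fixed by `h(z₀) = 0` (`exists_sign`). Therefore `|h|
= |Re ζ^(k + 3/2)|`, that is `n = k + 1`.

Crossing the ray between two adjacent sectors replaces `w` by `-w`. Opposite signs make `h` affine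
across the ray and `μ` vanishes there; equal signs give `h = ε |Re w|`, and the ray is in the
support. The number of sectors being odd, the signs cannot alternate all the way round, so at least
one such ray exists. The number `n` is unique because a holomorphic transition map fixing the origin
cannot change the order of vanishing (`le_of_reHalfPow_comp_eq`). -/

/-! ### Test functions and the first order weak form of `Δh = μ`. -/

/-- The directional derivative of a test function, as a test function. -/
noncomputable def directionalTest {Ω : TopologicalSpace.Opens ℂ} (φ : 𝓓(Ω, ℝ)) (v : ℂ) :
    𝓓(Ω, ℝ) where
  toFun z := fderiv ℝ φ z v
  contDiff' := (φ.contDiff.fderiv_right (m := ((⊤ : ℕ∞) : WithTop ℕ∞)) (by simp)).clm_apply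
    contDiff_const
  hasCompactSupport' := φ.hasCompactSupport.fderiv_apply ℝ v
  tsupport_subset' := (tsupport_fderiv_apply_subset ℝ v).trans φ.tsupport_subset

lemma directionalTest_apply {Ω : TopologicalSpace.Opens ℂ} (φ : 𝓓(Ω, ℝ)) (v z : ℂ) :
    directionalTest φ v z = fderiv ℝ φ z v := rfl

lemma laplacian_test {Ω : TopologicalSpace.Opens ℂ} (φ : 𝓓(Ω, ℝ)) (z : ℂ) :
    Laplacian.laplacian (φ : ℂ → ℝ) z =
      partialX (directionalTest φ 1) z + partialY (directionalTest φ Complex.I) z := by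
  have hd : DifferentiableAt ℝ (fderiv ℝ φ) z :=
    ((φ.contDiff.fderiv_right (m := ((⊤ : ℕ∞) : WithTop ℕ∞)) (by simp)).differentiable (by simp)) z
  have key : ∀ v : ℂ, fderiv ℝ (directionalTest φ v) z v = fderiv ℝ (fderiv ℝ φ) z v v := by
    intro v
    have : (directionalTest φ v : ℂ → ℝ) = fun z => fderiv ℝ φ z v := rfl
    rw [this, fderiv_clm_apply hd (differentiableAt_const v)]
    simp
  rw [InnerProductSpace.laplacian_eq_iteratedFDeriv_complexPlane]
  simp only [partialX, partialY, key]
  simp [iteratedFDeriv_two_apply]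

/-- A test function times a square integrable function is integrable. -/
lemma integrable_mul_test {Ω : TopologicalSpace.Opens ℂ} {f : ℂ → ℝ}
    (hf : MemLp f 2 (volume.restrict Ω)) (φ : 𝓓(Ω, ℝ)) :
    Integrable (fun z => f z * φ z) (volume.restrict (Ω : Set ℂ)) := by
  have h2 : MemLp φ 2 (volume.restrict (Ω : Set ℂ)) :=
    (φ.continuous.memLp_of_hasCompactSupport φ.hasCompactSupport).restrict _
  exact hf.integrable_mul h2

/-- The weak form of `Δ h = μ` that involves first derivatives only. -/
lemma pairing_eq_neg_integral_gradient {Ω : TopologicalSpace.Opens ℂ}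
    {μ : SignedRadonMeasure Ω} {h hx hy : ℂ → ℝ} (hH1 : IsH1WithGradient Ω h hx hy)
    (hlap : HasDistribLaplacian Ω h μ) (φ : 𝓓(Ω, ℝ)) :
    μ.pairing φ = -∫ z in Ω, (hx z * partialX φ z + hy z * partialY φ z) := by
  rw [← hlap φ]
  have h1 := hH1.weak_x (directionalTest φ 1)
  have h2 := hH1.weak_y (directionalTest φ Complex.I)
  have i1 := integrable_mul_test hH1.memLp (directionalTest (directionalTest φ 1) 1)
  have i2 := integrable_mul_test hH1.memLp
    (directionalTest (directionalTest φ Complex.I) Complex.I)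
  have i3 := integrable_mul_test hH1.memLp_x (directionalTest φ 1)
  have i4 := integrable_mul_test hH1.memLp_y (directionalTest φ Complex.I)
  simp only [laplacian_test, mul_add]
  have e1 := integral_add i1 i2
  have e2 := integral_add i3 i4
  simp only [directionalTest_apply] at e1 e2
  simp only [partialX, partialY] at *
  rw [e1, h1, h2]
  simp only [directionalTest_apply] at *
  rw [e2]; ring

/-! ### Total variation and support of a signed Radon measure. -/

namespace SignedRadonMeasure

variable {Ω : TopologicalSpace.Opens ℂ} (μ : SignedRadonMeasure Ω)

lemma totalVariation_lt_top {K : Set ℂ} (hK : IsCompact K) (hKΩ : K ⊆ Ω) :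
    μ.totalVariation K < ⊤ := by
  simp only [totalVariation, Measure.add_apply]
  exact ENNReal.add_lt_top.2 ⟨μ.pos_lt_top K hK hKΩ, μ.neg_lt_top K hK hKΩ⟩

lemma abs_integral_le_of_support {ν : Measure ℂ} {f : ℂ → ℝ} {A : Set ℂ}
    (hf : ∀ z, z ∉ A → f z = 0) (hb : ∀ z, |f z| ≤ 1) (hfin : ν A ≠ ⊤) :
    |∫ z, f z ∂ν| ≤ (ν A).toReal := by
  have h1 : ∫ z, f z ∂ν = ∫ z in A, f z ∂ν :=
    (setIntegral_eq_integral_of_forall_compl_eq_zero hf).symm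
  rw [h1]
  have := norm_setIntegral_le_of_norm_le_const (μ := ν) (s := A) (C := 1) (f := f)
    hfin.lt_top (fun z _ => by simpa using hb z)
  simpa [Measure.real] using this

/-- A test function bounded by `1` pairs with `μ` to at most the total variation of a set that
contains its support. -/
lemma abs_pairing_le (φ : 𝓓(Ω, ℝ)) {A : Set ℂ}
    (hφ : ∀ z, z ∉ A → φ z = 0) (hb : ∀ z, |φ z| ≤ 1) (hfin : μ.totalVariation A ≠ ⊤) :
    |μ.pairing φ| ≤ (μ.totalVariation A).toReal := by
  have hfin' := hfin
  simp only [totalVariation, Measure.add_apply] at hfin' ⊢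
  rw [ENNReal.add_ne_top] at hfin'
  rw [ENNReal.toReal_add hfin'.1 hfin'.2]
  exact (abs_sub _ _).trans (add_le_add (abs_integral_le_of_support hφ hb hfin'.1)
    (abs_integral_le_of_support hφ hb hfin'.2))

lemma integrable_pos (φ : 𝓓(Ω, ℝ)) : Integrable φ μ.pos := by
  have hi : IntegrableOn φ (tsupport φ) μ.pos := by
    refine φ.continuous.continuousOn.integrableOn_of_subset_isCompact φ.hasCompactSupport
      (isClosed_tsupport _).measurableSet subset_rfl
      (μ.pos_lt_top _ φ.hasCompactSupport φ.tsupport_subset).ne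
  exact (integrableOn_iff_integrable_of_support_subset (subset_tsupport _)).1 hi

lemma integrable_neg (φ : 𝓓(Ω, ℝ)) : Integrable φ μ.neg := by
  have hi : IntegrableOn φ (tsupport φ) μ.neg := by
    refine φ.continuous.continuousOn.integrableOn_of_subset_isCompact φ.hasCompactSupport
      (isClosed_tsupport _).measurableSet subset_rfl
      (μ.neg_lt_top _ φ.hasCompactSupport φ.tsupport_subset).ne
  exact (integrableOn_iff_integrable_of_support_subset (subset_tsupport _)).1 hi

/-- If `μ` vanishes on the test functions supported in the open set `U`, then `U` is null. -/
lemma totalVariation_eq_zero_of_pairing {U : Set ℂ} (hU : IsOpen U) (hUΩ : U ⊆ Ω)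
    (hp : ∀ φ : 𝓓(Ω, ℝ), tsupport φ ⊆ U → μ.pairing φ = 0) : μ.totalVariation U = 0 := by
  obtain ⟨S, hS, hpS, hnS⟩ := μ.mutuallySingular
  -- `g` is the density of `μ` with respect to `|μ|`: `-1` on the set carrying the negative part,
  -- `1` off it. The pairing with `ψ` is thus `∫ ψ g d|μ|`, and its vanishing forces `g = 0` almost
  -- everywhere on `U`, impossible for values `±1` unless `U` is null.
  set g : ℂ → ℝ := S.indicator (fun _ => -2) + fun _ => 1 with hg
  have hgS : ∀ z ∈ S, g z = -1 := fun z hz => by simp [hg, hz]; norm_num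
  have hgS' : ∀ z ∉ S, g z = 1 := fun z hz => by simp [hg, hz]
  have hpos : ∀ᵐ z ∂μ.pos, g z = 1 := by
    filter_upwards [compl_mem_ae_iff.2 hpS] with z hz using hgS' z hz
  have hneg : ∀ᵐ z ∂μ.neg, g z = -1 := by
    have : S ∈ ae μ.neg := by rw [mem_ae_iff]; exact hnS
    filter_upwards [this] with z hz using hgS z hz
  have hgm : Measurable g := (measurable_const.indicator hS).add measurable_const
  have hli : LocallyIntegrableOn g U μ.totalVariation := by
    rw [locallyIntegrableOn_iff hU.isLocallyClosed]
    intro K hKU hK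
    have hlt := μ.totalVariation_lt_top hK (hKU.trans hUΩ)
    refine Measure.integrableOn_of_bounded (M := 1) hlt.ne hgm.aestronglyMeasurable ?_
    refine Filter.Eventually.of_forall fun z => ?_
    by_cases hz : z ∈ S
    · simp [hgS z hz]
    · simp [hgS' z hz]
  have hae := hU.ae_eq_zero_of_integral_contDiff_smul_eq_zero hli (fun ψ hψ hc hs => by
    let φ : 𝓓(Ω, ℝ) := ⟨ψ, hψ, hc, hs.trans hUΩ⟩
    have h1 : ∀ᵐ z ∂μ.pos, ψ z • g z = φ z := by
      filter_upwards [hpos] with z hz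
      simp [hz, φ]
    have h2 : ∀ᵐ z ∂μ.neg, ψ z • g z = -φ z := by
      filter_upwards [hneg] with z hz
      simp [hz, φ]
    rw [totalVariation, integral_add_measure ((integrable_congr h1).2 (μ.integrable_pos φ))
      ((integrable_congr h2).2 (μ.integrable_neg φ).neg), integral_congr_ae h1,
      integral_congr_ae h2, integral_neg]
    exact hp φ hs)
  refine measure_mono_null ?_ hae
  intro z hz hz'
  have := hz' hz
  by_cases hzS : z ∈ S
  · rw [hgS z hzS] at this; norm_num at this
  · rw [hgS' z hzS] at this; norm_num at this

lemma notMem_support_of_null {U : Set ℂ} (hU : IsOpen U) (h0 : μ.totalVariation U = 0)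
    {z : ℂ} (hz : z ∈ U) : z ∉ μ.support := fun h =>
  (Measure.subset_compl_support_of_isOpen hU h0 hz) h.2

end SignedRadonMeasure

/-! ### Smoothing of weak solutions. -/

section Mollification

open ContinuousLinearMap
open scoped Convolution

/-- The derivative falls on the kernel, so no regularity of `g` is needed. The integrand has the
form in which the derivatives of `reflectedTest` appear in the weak equations. -/
lemma fderiv_smoothing_apply {E : Type*} [NormedAddCommGroup E] [NormedSpace ℝ E] [CompleteSpace E]
    {κ : ℂ → ℝ} (hκ : ContDiff ℝ ((⊤ : ℕ∞) : WithTop ℕ∞) κ) (hc : HasCompactSupport κ)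
    {g : ℂ → E} (hg : LocallyIntegrable g volume) (x v : ℂ) :
    fderiv ℝ (κ ⋆[lsmul ℝ ℝ, volume] g) x v = ∫ t, fderiv ℝ κ (x - t) v • g t := by
  have hκ1 : ContDiff ℝ 1 κ := hκ.of_le (by exact_mod_cast le_top)
  rw [(hc.hasFDerivAt_convolution_left (lsmul ℝ ℝ) hκ1 hg x).fderiv, convolution_eq_swap]
  have hex : ConvolutionExists (fderiv ℝ κ) g ((lsmul ℝ ℝ : ℝ →L[ℝ] E →L[ℝ] E).precompL ℂ)
      volume :=
    (hc.fderiv ℝ).convolutionExists_left _ (hκ1.continuous_fderiv (by simp)) hg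
  have hi := (hex x).integrable_swap
  rw [ContinuousLinearMap.integral_apply hi]
  simp [ContinuousLinearMap.precompL]

lemma contDiff_smoothing {E : Type*} [NormedAddCommGroup E] [NormedSpace ℝ E]
    {κ : ℂ → ℝ} (hκ : ContDiff ℝ ((⊤ : ℕ∞) : WithTop ℕ∞) κ) (hc : HasCompactSupport κ)
    {g : ℂ → E} (hg : LocallyIntegrable g volume) :
    ContDiff ℝ ((⊤ : ℕ∞) : WithTop ℕ∞) (κ ⋆[lsmul ℝ ℝ, volume] g) :=
  hc.contDiff_convolution_left _ hκ hg

/-- The reflected and translated kernel `u ↦ κ (x - u)` as a test function. -/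
noncomputable def reflectedTest {Ω : TopologicalSpace.Opens ℂ} {κ : ℂ → ℝ}
    (hκ : ContDiff ℝ ((⊤ : ℕ∞) : WithTop ℕ∞) κ) {ε : ℝ}
    (hs : tsupport κ ⊆ Metric.closedBall 0 ε) (x : ℂ) (hx : Metric.closedBall x ε ⊆ Ω) :
    𝓓(Ω, ℝ) :=
  have hsub : tsupport (fun u => κ (x - u)) ⊆ Metric.closedBall x ε := by
    refine closure_minimal (fun u hu => ?_) Metric.isClosed_closedBall
    have := hs (subset_tsupport _ hu)
    rwa [mem_closedBall_zero_iff, ← dist_eq_norm, dist_comm] at this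
  { toFun := fun u => κ (x - u)
    contDiff' := hκ.comp (contDiff_const.sub contDiff_id)
    hasCompactSupport' := (isCompact_closedBall x ε).of_isClosed_subset (isClosed_tsupport _) hsub
    tsupport_subset' := hsub.trans hx }

lemma fderiv_reflectedTest {Ω : TopologicalSpace.Opens ℂ} {κ : ℂ → ℝ}
    (hκ : ContDiff ℝ ((⊤ : ℕ∞) : WithTop ℕ∞) κ) {ε : ℝ}
    (hs : tsupport κ ⊆ Metric.closedBall 0 ε) (x : ℂ) (hx : Metric.closedBall x ε ⊆ Ω) (t v : ℂ) :
    fderiv ℝ (reflectedTest hκ hs x hx) t v = -fderiv ℝ κ (x - t) v := by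
  change fderiv ℝ (fun u => κ (x - u)) t v = _
  have h1 : HasFDerivAt κ (fderiv ℝ κ (x - t)) (x - t) :=
    (hκ.differentiable (by simp) _).hasFDerivAt
  have h2 : HasFDerivAt (fun u => x - u) (-ContinuousLinearMap.id ℝ ℂ) t :=
    (hasFDerivAt_id t).const_sub x
  have h3 : HasFDerivAt (fun u => κ (x - u)) _ t := HasFDerivAt.comp t h1 h2
  rw [h3.fderiv]
  simp

/-- A smoothing of a weak solution of the Cauchy-Riemann equations is holomorphic. -/
lemma differentiableAt_smoothing {Ω : TopologicalSpace.Opens ℂ} {W : ℂ → ℂ}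
    (hW : IntegrableOn W Ω)
    (h0 : ∀ φ : 𝓓(Ω, ℝ), ∫ z in Ω, ((partialX φ z : ℂ) + Complex.I * partialY φ z) * W z = 0)
    {κ : ℂ → ℝ} (hκ : ContDiff ℝ ((⊤ : ℕ∞) : WithTop ℕ∞) κ) (hc : HasCompactSupport κ) {ε : ℝ}
    (hs : tsupport κ ⊆ Metric.closedBall 0 ε) {x : ℂ} (hx : Metric.closedBall x ε ⊆ Ω) :
    DifferentiableAt ℂ (κ ⋆[lsmul ℝ ℝ, volume] (Ω : Set ℂ).indicator W) x := by
  have hm : MeasurableSet (Ω : Set ℂ) := Ω.isOpen.measurableSet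
  have hWi : Integrable ((Ω : Set ℂ).indicator W) := (integrable_indicator_iff hm).2 hW
  have hli := hWi.locallyIntegrable
  rw [differentiableAt_complex_iff_differentiableAt_real]
  refine ⟨(contDiff_smoothing hκ hc hli).differentiable (by simp) x, ?_⟩
  have hint : ∀ v, Integrable (fun t => fderiv ℝ κ (x - t) v • (Ω : Set ℂ).indicator W t) := by
    intro v
    have hcont : Continuous fun t => fderiv ℝ κ (x - t) v :=
      ((hκ.continuous_fderiv (by simp)).comp (continuous_const.sub continuous_id)).clm_apply
        continuous_const
    obtain ⟨C, hC⟩ := (hκ.continuous_fderiv (by simp)).bounded_above_of_compact_support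
      (hc.fderiv ℝ)
    refine hWi.bdd_smul (C * ‖v‖) hcont.aestronglyMeasurable (Eventually.of_forall fun t => ?_)
    exact (le_opNorm _ _).trans (mul_le_mul_of_nonneg_right (hC _) (norm_nonneg _))
  have key := h0 (reflectedTest hκ hs x hx)
  simp only [partialX, partialY, fderiv_reflectedTest] at key
  rw [fderiv_smoothing_apply hκ hc hli, fderiv_smoothing_apply hκ hc hli]
  rw [← integral_indicator hm] at key
  have e : ∀ z, (Ω : Set ℂ).indicator (fun z => (((-fderiv ℝ κ (x - z) 1 : ℝ) : ℂ) +
      Complex.I * ((-fderiv ℝ κ (x - z) Complex.I : ℝ) : ℂ)) * W z) z =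
      -(fderiv ℝ κ (x - z) 1 • (Ω : Set ℂ).indicator W z) -
        Complex.I * (fderiv ℝ κ (x - z) Complex.I • (Ω : Set ℂ).indicator W z) := by
    intro z
    by_cases hz : z ∈ (Ω : Set ℂ)
    · simp [hz]; ring
    · simp [hz]
  simp only [e] at key
  have e2 := integral_sub (hint 1).neg ((hint Complex.I).const_mul Complex.I)
  simp only [Pi.neg_apply] at e2
  rw [e2, integral_neg, integral_const_mul] at key
  rw [smul_eq_mul]
  -- With `A`, `B` the derivatives in the directions `1` and `I`, `key` says `-A - I B = 0`;
  -- multiplied by `I` this is the Cauchy-Riemann equation `B = I A`.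
  linear_combination Complex.I * key + (∫ t, fderiv ℝ κ (x - t) Complex.I •
    (Ω : Set ℂ).indicator W t) * Complex.I_mul_I

/-- A smoothing of a function with a weak derivative is differentiated by smoothing the weak
derivative. -/
lemma fderiv_smoothing_eq {Ω : TopologicalSpace.Opens ℂ} {h h' : ℂ → ℝ} {v : ℂ}
    (hh : IntegrableOn h Ω)
    (hw : ∀ φ : 𝓓(Ω, ℝ), ∫ z in Ω, h z * fderiv ℝ φ z v = -∫ z in Ω, h' z * φ z)
    {κ : ℂ → ℝ} (hκ : ContDiff ℝ ((⊤ : ℕ∞) : WithTop ℕ∞) κ) (hc : HasCompactSupport κ) {ε : ℝ}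
    (hs : tsupport κ ⊆ Metric.closedBall 0 ε) {x : ℂ} (hx : Metric.closedBall x ε ⊆ Ω) :
    fderiv ℝ (κ ⋆[lsmul ℝ ℝ, volume] (Ω : Set ℂ).indicator h) x v =
      ∫ t in Ω, κ (x - t) * h' t := by
  have hm : MeasurableSet (Ω : Set ℂ) := Ω.isOpen.measurableSet
  have hli := ((integrable_indicator_iff hm).2 hh).locallyIntegrable
  have key := hw (reflectedTest hκ hs x hx)
  simp only [fderiv_reflectedTest, mul_neg, integral_neg, neg_inj] at key
  rw [fderiv_smoothing_apply hκ hc hli]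
  have e : ∀ t, fderiv ℝ κ (x - t) v • (Ω : Set ℂ).indicator h t =
      (Ω : Set ℂ).indicator (fun t => h t * fderiv ℝ κ (x - t) v) t := by
    intro t
    by_cases ht : t ∈ (Ω : Set ℂ)
    · simp [ht, mul_comm]
    · simp [ht]
  simp only [e]
  rw [integral_indicator hm, key]
  exact integral_congr_ae (Eventually.of_forall fun t => mul_comm _ _)

/-- Used with `χ` radial and `ρ` an approximate identity: the mean value property applies to the
smooth function `ρ * W`, and commuting carries it over to `χ * W`. -/
lemma smoothing_comm {χ ρ : ℂ → ℝ} (hχ : Continuous χ) (hχc : HasCompactSupport χ)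
    (hρ : Continuous ρ) (hρc : HasCompactSupport ρ) {W : ℂ → ℂ} (hW : Integrable W) (x : ℂ) :
    (χ ⋆[lsmul ℝ ℝ, volume] (ρ ⋆[lsmul ℝ ℝ, volume] W)) x =
      (ρ ⋆[lsmul ℝ ℝ, volume] (χ ⋆[lsmul ℝ ℝ, volume] W)) x := by
  have h1 : Integrable (fun p : ℂ × ℂ => χ (x - p.1) • (ρ p.2 • W (p.1 - p.2)))
      (volume.prod volume) := by
    have hi := Integrable.convolution_integrand (lsmul ℝ ℝ : ℝ →L[ℝ] ℂ →L[ℝ] ℂ) 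
      (hρ.integrable_of_hasCompactSupport (μ := volume) hρc) hW
    obtain ⟨C, hC⟩ := hχ.bounded_above_of_compact_support hχc
    exact hi.bdd_smul C (hχ.comp (continuous_const.sub continuous_fst)).aestronglyMeasurable
      (Eventually.of_forall fun p => hC _)
  rw [convolution_eq_swap]
  simp only [convolution_def, lsmul_apply, ← integral_smul]
  rw [integral_integral_swap h1]
  refine integral_congr_ae (Eventually.of_forall fun s => ?_)
  have e : ∀ t, χ (x - t) • ρ s • W (t - s) = ρ s • (χ (x - t) • W (t - s)) := fun t => by
    rw [smul_comm]
  have := convolution_eq_swap (f := χ) (g := W) (x := x - s) (μ := volume)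
    (lsmul ℝ ℝ : ℝ →L[ℝ] ℂ →L[ℝ] ℂ)
  simp only [e, integral_smul]
  simp only [convolution_def, lsmul_apply] at this
  rw [this, ← integral_add_right_eq_self _ s]
  simp [sub_sub, add_comm]

end Mollification

/-! ### Weyl's lemma by the mean value property. -/

section Weyl

open ContinuousLinearMap
open scoped Convolution

/-- A smooth radial bump supported in the closed ball of radius `R`. -/
noncomputable def radialBump (R : ℝ) (z : ℂ) : ℝ := expNegInvGlue (R ^ 2 - ‖z‖ ^ 2)

lemma contDiff_radialBump (R : ℝ) : ContDiff ℝ ((⊤ : ℕ∞) : WithTop ℕ∞) (radialBump R) :=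
  expNegInvGlue.contDiff.comp (contDiff_const.sub (contDiff_norm_sq ℝ))

lemma radialBump_eq_zero {R : ℝ} (hR : 0 < R) {z : ℂ} (hz : R ≤ ‖z‖) : radialBump R z = 0 := by
  refine expNegInvGlue.zero_of_nonpos ?_
  nlinarith

lemma tsupport_radialBump {R : ℝ} (hR : 0 < R) :
    tsupport (radialBump R) ⊆ Metric.closedBall 0 R := by
  refine closure_minimal (fun u hu => ?_) Metric.isClosed_closedBall
  rw [mem_closedBall_zero_iff]
  by_contra hcon
  exact hu (radialBump_eq_zero hR (not_le.1 hcon).le)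

lemma hasCompactSupport_radialBump {R : ℝ} (hR : 0 < R) : HasCompactSupport (radialBump R) :=
  (isCompact_closedBall 0 R).of_isClosed_subset (isClosed_tsupport _) (tsupport_radialBump hR)

lemma integral_radialBump_pos {R : ℝ} (hR : 0 < R) : 0 < ∫ z, radialBump R z := by
  refine (contDiff_radialBump R).continuous.integral_pos_of_hasCompactSupport_nonneg_nonzero
    (hasCompactSupport_radialBump hR) (fun z => expNegInvGlue.nonneg _) (x := 0) ?_
  exact (expNegInvGlue.pos_of_pos (by simpa using by positivity)).ne'

/-- The mean value property against a radial kernel. -/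
lemma radialBump_smoothing_eq {R : ℝ} (hR : 0 < R) {f : ℂ → ℂ} (hf : Continuous f) {x : ℂ}
    (hd : DifferentiableOn ℂ f (Metric.ball x R)) :
    (radialBump R ⋆[lsmul ℝ ℝ, volume] f) x = (∫ z, radialBump R z) • f x := by
  -- Stated for all `g` because the instance `g = 1` identifies the radial integral with `∫
  -- radialBump R`, which then need not be computed.
  have main : ∀ g : ℂ → ℂ, Continuous g → DifferentiableOn ℂ g (Metric.ball x R) →
      ∫ t, radialBump R t • g (x - t) =
        (∫ r in Ioi (0 : ℝ), 2 * Real.pi * r * expNegInvGlue (R ^ 2 - r ^ 2)) • g x := by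
    intro g hg hgd
    have hint : Integrable fun t => radialBump R t • g (x - t) :=
      ((contDiff_radialBump R).continuous.smul
        (hg.comp (continuous_const.sub continuous_id))).integrable_of_hasCompactSupport
        (hasCompactSupport_radialBump hR).smul_right
    rw [← Complex.integral_comp_polarCoord_symm]
    have hint' : IntegrableOn (fun p : ℝ × ℝ => p.1 • (radialBump R (Complex.polarCoord.symm p) •
        g (x - Complex.polarCoord.symm p))) (Ioi 0 ×ˢ Ioo (-Real.pi) Real.pi) := by
      have hcont : Continuous fun p : ℝ × ℝ => p.1 • (radialBump R (Complex.polarCoord.symm p) •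
          g (x - Complex.polarCoord.symm p)) := by
        have hp : Continuous fun p : ℝ × ℝ => Complex.polarCoord.symm p := by
          simp only [Complex.polarCoord_symm_apply]
          fun_prop
        exact continuous_fst.smul (((contDiff_radialBump R).continuous.comp hp).smul
          (hg.comp (continuous_const.sub hp)))
      have hK : IntegrableOn (fun p : ℝ × ℝ => p.1 • (radialBump R (Complex.polarCoord.symm p) •
          g (x - Complex.polarCoord.symm p))) (Icc 0 R ×ˢ Icc (-Real.pi) Real.pi) :=
        hcont.continuousOn.integrableOn_compact (isCompact_Icc.prod isCompact_Icc)
      refine IntegrableOn.of_forall_sdiff_eq_zero hK (measurableSet_Ioi.prod measurableSet_Ioo) ?_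
      rintro ⟨r, θ⟩ ⟨⟨hr, hθ⟩, hn⟩
      have hr : 0 < r := hr
      have hRr : R ≤ r := by
        by_contra hlt
        exact hn ⟨⟨hr.le, (not_le.1 hlt).le⟩, Ioo_subset_Icc_self hθ⟩
      have : radialBump R (Complex.polarCoord.symm (r, θ)) = 0 := by
        refine radialBump_eq_zero hR ?_
        rw [Complex.norm_polarCoord_symm, abs_of_pos hr]
        exact hRr
      simp only [this, zero_smul, smul_zero]
    rw [polarCoord_target, Measure.volume_eq_prod, setIntegral_prod _ hint', ← integral_smul_const]
    refine setIntegral_congr_fun measurableSet_Ioi fun r hr => ?_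
    have hr : 0 < r := hr
    simp only [Complex.polarCoord_symm_apply]
    have hn : ∀ θ : ℝ, radialBump R (r * (Real.cos θ + Real.sin θ * Complex.I)) =
        expNegInvGlue (R ^ 2 - r ^ 2) := by
      intro θ
      have : ‖(r : ℂ) * (Real.cos θ + Real.sin θ * Complex.I)‖ = r := by
        rw [Complex.ofReal_cos, Complex.ofReal_sin, norm_mul, Complex.norm_cos_add_sin_mul_I]
        simp [abs_of_pos hr]
      rw [radialBump, this]
    simp only [hn, integral_smul]
    rcases le_or_gt R r with hRr | hRr
    · rw [expNegInvGlue.zero_of_nonpos (by nlinarith)]; simp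
    have hav : Real.circleAverage g x r = g x := by
      refine DiffContOnCl.circleAverage ⟨hgd.mono ?_, hg.continuousOn⟩
      rw [abs_of_pos hr]
      exact Metric.ball_subset_ball hRr.le
    rw [Real.circleAverage] at hav
    have hin : ∫ θ in Ioo (-Real.pi) Real.pi, g (x - r * (Real.cos θ + Real.sin θ * Complex.I)) =
        (2 * Real.pi) • g x := by
      rw [← hav, smul_smul, mul_inv_cancel₀ (by positivity), one_smul,
        ← integral_Ioc_eq_integral_Ioo, ← intervalIntegral.integral_of_le (by linarith [Real.pi_pos])]
      -- Polar angles run over `(-π, π)` and the convolution evaluates at `x - r e^{iθ}`; the shift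
      -- of `θ` by `π` corrects both at once.
      have := intervalIntegral.integral_comp_add_right (a := -Real.pi) (b := Real.pi)
        (fun θ => g (circleMap x r θ)) Real.pi
      rw [show -Real.pi + Real.pi = 0 by ring, show Real.pi + Real.pi = 2 * Real.pi by ring] at this
      rw [← this]
      refine intervalIntegral.integral_congr fun θ _ => ?_
      simp only [circleMap]
      congr 1
      push_cast
      rw [add_mul, Complex.exp_add, Complex.exp_pi_mul_I, Complex.exp_mul_I]
      ring
    rw [hin, smul_smul, smul_smul]
    congr 1
    ring
  rw [convolution_def]
  simp only [lsmul_apply]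
  rw [main f hf hd]
  congr 1
  have h1 := main (fun _ => 1) continuous_const (differentiableOn_const _)
  simp only [Complex.real_smul, mul_one] at h1
  rw [integral_complex_ofReal] at h1
  exact_mod_cast h1.symm

/-- A sequence of bump functions that concentrates at the origin. -/
noncomputable def shrinkingBump {E : Type*} [NormedAddCommGroup E] (i : ℕ) :
    ContDiffBump (0 : E) where
  rIn := 1 / (i + 1)
  rOut := 2 / (i + 1)
  rIn_pos := by positivity
  rIn_lt_rOut := by gcongr; norm_num

lemma tendsto_shrinkingBump_rOut {E : Type*} [NormedAddCommGroup E] :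
    Tendsto (fun i => (shrinkingBump i : ContDiffBump (0 : E)).rOut) atTop (𝓝 0) := by
  have := (tendsto_one_div_add_atTop_nhds_zero_nat (𝕜 := ℝ)).const_mul 2
  simpa [shrinkingBump, div_eq_mul_inv] using this

/-- The outer radius is always twice the inner one; this bounded ratio is what lets Lebesgue
differentiation give convergence almost everywhere. -/
lemma ae_tendsto_shrinkingBump {E F : Type*} [NormedAddCommGroup E] [NormedSpace ℝ E]
    [FiniteDimensional ℝ E] [MeasurableSpace E] [BorelSpace E] {ν : Measure E}
    [ν.IsAddHaarMeasure] [NormedAddCommGroup F] [NormedSpace ℝ F] [CompleteSpace F] {g : E → F}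
    (hg : LocallyIntegrable g ν) : ∀ᵐ x ∂ν,
      Tendsto (fun i => ((shrinkingBump i : ContDiffBump (0 : E)).normed ν ⋆[lsmul ℝ ℝ, ν] g) x)
        atTop (𝓝 (g x)) := by
  refine ContDiffBump.ae_convolution_tendsto_right_of_locallyIntegrable (K := 2)
    tendsto_shrinkingBump_rOut (Eventually.of_forall fun i => ?_) hg
  simp only [shrinkingBump]
  exact le_of_eq (by ring)

/-- Continuous functions that agree almost everywhere on an open set agree there, so local
representatives glue, here as the diagonal `p ↦ g p p`. The last clause transfers any local property
of a local representative (holomorphic, Lipschitz) to `G`. -/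
lemma exists_continuous_representative {E F : Type*} [TopologicalSpace E] [SecondCountableTopology E]
    [MeasurableSpace E] [BorelSpace E] {ν : Measure E} [ν.IsOpenPosMeasure] [TopologicalSpace F]
    [T2Space F] [Nonempty F] {U : Set E} (hU : IsOpen U) (f : E → F)
    (hloc : ∀ p ∈ U, ∃ B, IsOpen B ∧ p ∈ B ∧ B ⊆ U ∧ ∃ g : E → F, ContinuousOn g B ∧
      g =ᵐ[ν.restrict B] f) :
    ∃ G : E → F, G =ᵐ[ν.restrict U] f ∧ ∀ (B : Set E) (g : E → F), IsOpen B → B ⊆ U →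
      ContinuousOn g B → g =ᵐ[ν.restrict B] f → EqOn G g B := by
  classical
  choose! B hBo hpB hBU g hgc hge using hloc
  have heq : ∀ (B' : Set E) (g' : E → F), IsOpen B' → B' ⊆ U →
      ContinuousOn g' B' → g' =ᵐ[ν.restrict B'] f → EqOn (fun p => g p p) g' B' := by
    intro B' g' hB' hB'U hg' he p hp
    have hpU := hB'U hp
    have h1 : g p =ᵐ[ν.restrict (B p ∩ B')] g' := by
      have a1 := ae_restrict_of_ae_restrict_of_subset (inter_subset_left (s := B p) (t := B'))
        (hge p hpU)
      have a2 := ae_restrict_of_ae_restrict_of_subset (inter_subset_right (s := B p) (t := B')) he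
      filter_upwards [a1, a2] with z h1 h2 using h1.trans h2.symm
    exact Measure.eqOn_open_of_ae_eq h1 ((hBo p hpU).inter hB')
      ((hgc p hpU).mono inter_subset_left) (hg'.mono inter_subset_right) ⟨hpB p hpU, hp⟩
  refine ⟨fun p => g p p, ?_, heq⟩
  rw [Filter.EventuallyEq, ae_restrict_iff' hU.measurableSet, ae_iff]
  refine measure_null_of_locally_null _ fun x hx => ?_
  have hxU : x ∈ U := by
    by_contra hcon
    exact hx fun h => absurd h hcon
  refine ⟨_, inter_mem self_mem_nhdsWithin
    (mem_nhdsWithin_of_mem_nhds ((hBo x hxU).mem_nhds (hpB x hxU))), ?_⟩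
  have h1 := hge x hxU
  rw [Filter.EventuallyEq, ae_restrict_iff' (hBo x hxU).measurableSet, ae_iff] at h1
  refine measure_mono_null ?_ h1
  rintro z ⟨hz, hzB⟩ hcon
  refine hz fun hzU => ?_
  have e : g z z = g x z := heq (B x) (g x) (hBo x hxU) (hBU x hxU) (hgc x hxU) (hge x hxU) hzB
  exact e.trans (hcon hzB)

/-- **Weyl's lemma** for the Cauchy-Riemann operator. -/
theorem exists_holomorphic_representative {Ω : TopologicalSpace.Opens ℂ} {W : ℂ → ℂ}
    (hW : IntegrableOn W Ω)
    (h0 : ∀ φ : 𝓓(Ω, ℝ), ∫ z in Ω, ((partialX φ z : ℂ) + Complex.I * partialY φ z) * W z = 0) :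
    ∃ ω : ℂ → ℂ, DifferentiableOn ℂ ω Ω ∧ ω =ᵐ[volume.restrict Ω] W := by
  have hm : MeasurableSet (Ω : Set ℂ) := Ω.isOpen.measurableSet
  set W' := (Ω : Set ℂ).indicator W with hW'
  have hWi : Integrable W' := (integrable_indicator_iff hm).2 hW
  have hae := ae_tendsto_shrinkingBump hWi.locallyIntegrable
  have hloc : ∀ p ∈ (Ω : Set ℂ), ∃ B, IsOpen B ∧ p ∈ B ∧ B ⊆ Ω ∧ ∃ g : ℂ → ℂ,
      DifferentiableOn ℂ g B ∧ g =ᵐ[volume.restrict B] W := by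
    intro p hp
    obtain ⟨R', hR', hball⟩ := Metric.isOpen_iff.1 Ω.isOpen p hp
    -- Room for three steps of length `R`: from `p` to `x`, from `x` across the radial kernel, and
    -- across a narrow kernel `ρ`.
    set R := R' / 4 with hRdef
    have hR : 0 < R := by positivity
    have hcb : ∀ x ∈ Metric.ball p (2 * R), ∀ ε ≤ R, Metric.closedBall x ε ⊆ Ω := by
      intro x hx ε hε y hy
      refine hball ?_
      rw [Metric.mem_ball] at hx ⊢
      rw [Metric.mem_closedBall] at hy
      linarith [dist_triangle y x p]
    set c := ∫ z, radialBump R z with hc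
    have hcpos : 0 < c := integral_radialBump_pos hR
    set G := radialBump R ⋆[lsmul ℝ ℝ, volume] W' with hG
    have hGc : Continuous G := (contDiff_smoothing (contDiff_radialBump R)
      (hasCompactSupport_radialBump hR) hWi.locallyIntegrable).continuous
    refine ⟨Metric.ball p R, Metric.isOpen_ball, Metric.mem_ball_self hR,
      (Metric.ball_subset_ball (by linarith)).trans hball, fun x => c⁻¹ • G x, ?_, ?_⟩
    · intro x hx
      have := differentiableAt_smoothing hW h0 (contDiff_radialBump R)
        (hasCompactSupport_radialBump hR) (tsupport_radialBump hR)
        (hcb x (Metric.ball_subset_ball (by linarith) hx) R le_rfl)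
      exact (this.const_smul c⁻¹).differentiableWithinAt
    · rw [Filter.EventuallyEq, ae_restrict_iff' measurableSet_ball]
      filter_upwards [hae] with x hx hxB
      have hWx : W' x = W x := indicator_of_mem (hcb x (Metric.ball_subset_ball (by linarith) hxB)
        0 hR.le (by simp)) _
      rw [← hWx]
      have hconv : Tendsto (fun i => ((shrinkingBump i : ContDiffBump (0 : ℂ)).normed volume
          ⋆[lsmul ℝ ℝ, volume] G) x) atTop (𝓝 (G x)) :=
        ContDiffBump.convolution_tendsto_right_of_continuous tendsto_shrinkingBump_rOut hGc x
      -- Each `ρ * W'` is holomorphic near `x`, so the radial kernel multiplies it by the constant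
      -- `c`. As `i` grows, the left side tends to `G x` and the right side to `c W' x`: `W` is
      -- almost everywhere `c⁻¹ G`.
      have hev : ∀ᶠ i in atTop, ((shrinkingBump i : ContDiffBump (0 : ℂ)).normed volume
          ⋆[lsmul ℝ ℝ, volume] G) x = c • ((shrinkingBump i : ContDiffBump (0 : ℂ)).normed volume
          ⋆[lsmul ℝ ℝ, volume] W') x := by
        filter_upwards [tendsto_shrinkingBump_rOut (E := ℂ) |>.eventually (gt_mem_nhds hR)] with i hi
        set ρ := (shrinkingBump i : ContDiffBump (0 : ℂ)) with hρ
        have hs : tsupport (ρ.normed volume) ⊆ Metric.closedBall 0 ρ.rOut :=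
          (ρ.tsupport_normed_eq (μ := volume)).le
        rw [hG, ← smoothing_comm (contDiff_radialBump R).continuous
          (hasCompactSupport_radialBump hR) ρ.continuous_normed ρ.hasCompactSupport_normed hWi]
        refine radialBump_smoothing_eq hR (contDiff_smoothing ρ.contDiff_normed
          ρ.hasCompactSupport_normed hWi.locallyIntegrable).continuous ?_
        intro y hy
        refine (differentiableAt_smoothing hW h0 ρ.contDiff_normed ρ.hasCompactSupport_normed hs
          (hcb y ?_ _ hi.le)).differentiableWithinAt
        rw [Metric.mem_ball] at hxB hy ⊢
        linarith [dist_triangle y x p]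
      have hlim := tendsto_nhds_unique (hconv.congr' hev) (hx.const_smul c)
      rw [hlim, smul_smul, inv_mul_cancel₀ hcpos.ne', one_smul]
  obtain ⟨ω, hωae, hω⟩ := exists_continuous_representative (ν := volume) Ω.isOpen W
    fun p hp => by
      obtain ⟨B, h1, h2, h3, g, h4, h5⟩ := hloc p hp
      exact ⟨B, h1, h2, h3, g, h4.continuousOn, h5⟩
  refine ⟨ω, fun p hp => ?_, hωae⟩
  obtain ⟨B, h1, h2, h3, g, h4, h5⟩ := hloc p hp
  have he := hω B g h1 h3 h4.continuousOn h5
  exact (((h4 p h2).differentiableAt (h1.mem_nhds h2)).congr_of_eventuallyEq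
    (he.eventuallyEq_of_mem (h1.mem_nhds h2))).differentiableWithinAt

end Weyl

/-! ### Regularity of `h` and of its Hopf differential. -/

section Regularity

open scoped Convolution

/-- The real and imaginary parts of `(∂ₓφ + i ∂_yφ) ω_h` are `-2` times the first and `2` times the
second row of the stress-energy tensor tested against `∇φ`. -/
lemma weak_cauchyRiemann_hopfDifferential {Ω : TopologicalSpace.Opens ℂ} {h hx hy : ℂ → ℝ}
    (hH1 : IsH1WithGradient Ω h hx hy) (hstat : IsStationaryHarmonic Ω hx hy) :
    IntegrableOn (hopfDifferential hx hy) Ω ∧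
    ∀ φ : 𝓓(Ω, ℝ), ∫ z in Ω, ((partialX φ z : ℂ) + Complex.I * partialY φ z) *
      hopfDifferential hx hy z = 0 := by
  have i1 : Integrable (fun z => hx z ^ 2 - hy z ^ 2) (volume.restrict (Ω : Set ℂ)) :=
    hH1.memLp_x.integrable_sq.sub hH1.memLp_y.integrable_sq
  have i2 : Integrable (fun z => hx z * hy z) (volume.restrict (Ω : Set ℂ)) :=
    hH1.memLp_x.integrable_mul hH1.memLp_y
  have hW : ∀ z, hopfDifferential hx hy z =
      ((hx z ^ 2 - hy z ^ 2 : ℝ) : ℂ) - 2 * Complex.I * ((hx z * hy z : ℝ) : ℂ) := by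
    intro z; simp [hopfDifferential]; ring
  refine ⟨?_, fun φ => ?_⟩
  · have := i1.ofReal (𝕜 := ℂ) |>.sub (i2.ofReal (𝕜 := ℂ) |>.const_mul (2 * Complex.I))
    exact this.congr (Eventually.of_forall fun z => (hW z).symm)
  · obtain ⟨s1, s2⟩ := hstat
    have bd : ∀ (f : ℂ → ℝ) (v : ℂ), Integrable f (volume.restrict (Ω : Set ℂ)) →
        Integrable (fun z => f z * fderiv ℝ φ z v) (volume.restrict (Ω : Set ℂ)) := by
      intro f v hf
      obtain ⟨C, hC⟩ := (directionalTest φ v).continuous.bounded_above_of_compact_support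
        (directionalTest φ v).hasCompactSupport
      exact hf.mul_bdd (directionalTest φ v).continuous.aestronglyMeasurable
        (Eventually.of_forall hC)
    have e : ∀ z, ((partialX φ z : ℂ) + Complex.I * partialY φ z) * hopfDifferential hx hy z =
        ((-2 * (((hy z ^ 2 - hx z ^ 2) / 2) * partialX φ z + (-(hx z * hy z)) * partialY φ z) : ℝ)
          : ℂ) + Complex.I * ((2 * ((-(hx z * hy z)) * partialX φ z +
          ((hx z ^ 2 - hy z ^ 2) / 2) * partialY φ z) : ℝ) : ℂ) := by
      intro z
      rw [hW]
      push_cast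
      linear_combination (-2 * (partialY φ z : ℂ) * hx z * hy z) * Complex.I_mul_I
    simp only [e]
    have j1 : Integrable (fun z => ((hy z ^ 2 - hx z ^ 2) / 2) * partialX φ z +
        (-(hx z * hy z)) * partialY φ z) (volume.restrict (Ω : Set ℂ)) := by
      refine (bd _ 1 ?_).add (bd _ Complex.I i2.neg)
      exact (i1.neg.div_const 2).congr (Eventually.of_forall fun z => by simp)
    have j2 : Integrable (fun z => (-(hx z * hy z)) * partialX φ z +
        ((hx z ^ 2 - hy z ^ 2) / 2) * partialY φ z) (volume.restrict (Ω : Set ℂ)) :=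
      (bd _ 1 i2.neg).add (bd _ Complex.I (i1.div_const 2))
    have c1 : Integrable (fun z => ((-2 * (((hy z ^ 2 - hx z ^ 2) / 2) * partialX φ z +
        (-(hx z * hy z)) * partialY φ z) : ℝ) : ℂ)) (volume.restrict (Ω : Set ℂ)) :=
      (j1.const_mul (-2)).ofReal
    have c2 : Integrable (fun z => ((2 * ((-(hx z * hy z)) * partialX φ z +
        ((hx z ^ 2 - hy z ^ 2) / 2) * partialY φ z) : ℝ) : ℂ)) (volume.restrict (Ω : Set ℂ)) :=
      (j2.const_mul 2).ofReal
    rw [integral_add c1 (c2.const_mul Complex.I), integral_const_mul,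
      integral_complex_ofReal, integral_complex_ofReal, integral_const_mul, integral_const_mul,
      s1 φ, s2 φ]
    simp

/-- `ω_h` is the square of `∂ₓh - i ∂_y h`. This is how a bound on the holomorphic representative
becomes a bound on the gradient. -/
lemma norm_hopfDifferential (hx hy : ℂ → ℝ) (z : ℂ) :
    ‖hopfDifferential hx hy z‖ = hx z ^ 2 + hy z ^ 2 := by
  have : hopfDifferential hx hy z = ((hx z : ℂ) - Complex.I * hy z) ^ 2 := by
    rw [hopfDifferential]
    linear_combination (-(hy z : ℂ) ^ 2) * Complex.I_mul_I
  rw [this, norm_pow, Complex.sq_norm, Complex.normSq_apply]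
  simp; ring

lemma abs_smoothing_le {Ω : TopologicalSpace.Opens ℂ} {g : ℂ → ℝ} {κ : ℂ → ℝ}
    (hκ : Continuous κ) (hc : HasCompactSupport κ) (hpos : ∀ z, 0 ≤ κ z) (hint : ∫ z, κ z = 1)
    {x : ℂ} {L : ℝ} (hL : ∀ᵐ z ∂volume.restrict (Ω : Set ℂ), κ (x - z) ≠ 0 → |g z| ≤ L)
    (hL0 : 0 ≤ L) :
    |∫ t in Ω, κ (x - t) * g t| ≤ L := by
  have hi : Integrable fun t => κ (x - t) :=
    (hκ.integrable_of_hasCompactSupport hc).comp_sub_left x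
  calc |∫ t in Ω, κ (x - t) * g t| ≤ ∫ t in Ω, κ (x - t) * L := by
        rw [← Real.norm_eq_abs]
        refine norm_integral_le_of_norm_le (hi.mul_const L).integrableOn ?_
        filter_upwards [hL] with z hz
        rw [norm_mul, Real.norm_of_nonneg (hpos _), Real.norm_eq_abs]
        by_cases h0 : κ (x - z) = 0
        · simp [h0]
        · exact mul_le_mul_of_nonneg_left (hz h0) (hpos _)
    _ ≤ ∫ t, κ (x - t) * L := by
        refine setIntegral_le_integral (hi.mul_const L) (Eventually.of_forall fun t => ?_)
        exact mul_nonneg (hpos _) hL0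
    _ = L := by
        rw [integral_mul_const, integral_sub_left_eq_self κ volume x, hint, one_mul]

/-- A Sobolev function with bounded gradient agrees locally with a Lipschitz function. -/
lemma exists_lipschitz_of_bounded_gradient {Ω : TopologicalSpace.Opens ℂ} {h hx hy : ℂ → ℝ}
    (hΩ : Bornology.IsBounded (Ω : Set ℂ)) (hH1 : IsH1WithGradient Ω h hx hy) {p : ℂ} {R L : ℝ}
    (hR : 0 < R) (hL0 : 0 ≤ L)
    (hsub : Metric.ball p (3 * R) ⊆ Ω)
    (hL : ∀ᵐ z ∂volume.restrict (Ω : Set ℂ), z ∈ Metric.ball p (3 * R) → |hx z| ≤ L ∧ |hy z| ≤ L) :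
    ∃ (C : NNReal) (g : ℂ → ℝ), LipschitzWith C g ∧ g =ᵐ[volume.restrict (Metric.ball p R)] h := by
  have hm : MeasurableSet (Ω : Set ℂ) := Ω.isOpen.measurableSet
  have : IsFiniteMeasure (volume.restrict (Ω : Set ℂ)) :=
    ⟨by simpa using hΩ.measure_lt_top⟩
  have hh : IntegrableOn h Ω := hH1.memLp.integrable (by norm_num)
  set h' := (Ω : Set ℂ).indicator h with hh'
  have hli : LocallyIntegrable h' := ((integrable_indicator_iff hm).2 hh).locallyIntegrable
  have hae := ae_tendsto_shrinkingBump (ν := volume) hli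
  -- Each partial derivative is at most `L`, and `|v.re| + |v.im| ≤ 2 ‖v‖`.
  set C : NNReal := ⟨2 * L, by positivity⟩ with hC
  have hev : ∀ᶠ i in atTop, LipschitzOnWith C ((shrinkingBump i : ContDiffBump (0 : ℂ)).normed volume
      ⋆[ContinuousLinearMap.lsmul ℝ ℝ, volume] h') (Metric.ball p R) := by
    filter_upwards [tendsto_shrinkingBump_rOut (E := ℂ) |>.eventually (gt_mem_nhds hR)] with i hi
    set ρ := (shrinkingBump i : ContDiffBump (0 : ℂ)) with hρ
    have hs : tsupport (ρ.normed volume) ⊆ Metric.closedBall 0 ρ.rOut :=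
      (ρ.tsupport_normed_eq (μ := volume)).le
    have hcd := contDiff_smoothing (E := ℝ) (ρ.contDiff_normed (μ := volume))
      ρ.hasCompactSupport_normed hli
    refine Convex.lipschitzOnWith_of_nnnorm_fderiv_le (𝕜 := ℝ)
      (fun x _ => hcd.differentiable (by simp) x) (fun x hx => ?_) (convex_ball p R)
    have hnear : ∀ z, ρ.normed volume (x - z) ≠ 0 → z ∈ Metric.ball p (3 * R) := by
      intro z hz
      have := hs (subset_tsupport _ hz)
      rw [mem_closedBall_zero_iff, ← dist_eq_norm, dist_comm] at this
      rw [Metric.mem_ball] at hx ⊢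
      linarith [dist_triangle z x p]
    have hcb : Metric.closedBall x ρ.rOut ⊆ Ω := by
      intro y hy
      refine hsub ?_
      rw [Metric.mem_ball] at hx ⊢
      rw [Metric.mem_closedBall] at hy
      linarith [dist_triangle y x p]
    have b1 : |fderiv ℝ (ρ.normed volume ⋆[ContinuousLinearMap.lsmul ℝ ℝ, volume] h') x 1| ≤ L := by
      rw [fderiv_smoothing_eq hh hH1.weak_x ρ.contDiff_normed ρ.hasCompactSupport_normed hs hcb]
      refine abs_smoothing_le ρ.continuous_normed ρ.hasCompactSupport_normed ρ.nonneg_normed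
        ρ.integral_normed ?_ hL0
      filter_upwards [hL] with z hz h0 using (hz (hnear z h0)).1
    have b2 : |fderiv ℝ (ρ.normed volume ⋆[ContinuousLinearMap.lsmul ℝ ℝ, volume] h') x
        Complex.I| ≤ L := by
      rw [fderiv_smoothing_eq hh hH1.weak_y ρ.contDiff_normed ρ.hasCompactSupport_normed hs hcb]
      refine abs_smoothing_le ρ.continuous_normed ρ.hasCompactSupport_normed ρ.nonneg_normed
        ρ.integral_normed ?_ hL0
      filter_upwards [hL] with z hz h0 using (hz (hnear z h0)).2
    rw [← NNReal.coe_le_coe, coe_nnnorm]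
    refine ContinuousLinearMap.opNorm_le_bound _ (by positivity) fun v => ?_
    set T := fderiv ℝ (ρ.normed volume ⋆[ContinuousLinearMap.lsmul ℝ ℝ, volume] h') x with hT
    have hv : T v = v.re * T 1 + v.im * T Complex.I := by
      conv_lhs => rw [← Complex.re_add_im v]
      rw [map_add, show (v.re : ℂ) = v.re • (1 : ℂ) by simp,
        show (v.im : ℂ) * Complex.I = v.im • Complex.I by simp, map_smul, map_smul]
      simp
    rw [hv, Real.norm_eq_abs]
    change _ ≤ 2 * L * ‖v‖
    calc |v.re * T 1 + v.im * T Complex.I| ≤ |v.re| * |T 1| + |v.im| * |T Complex.I| := by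
          rw [← abs_mul, ← abs_mul]; exact abs_add_le _ _
      _ ≤ ‖v‖ * L + ‖v‖ * L := by
          gcongr
          · exact Complex.abs_re_le_norm v
          · exact Complex.abs_im_le_norm v
      _ = _ := by ring
  -- The smoothings have the common Lipschitz constant `C` on the ball, which passes to their limit
  -- on the set `D` of convergence, of full measure in the ball. The limit is then extended from `D`
  -- to the plane.
  set D := {x ∈ Metric.ball p R | Tendsto (fun i => ((shrinkingBump i : ContDiffBump (0 : ℂ)).normed
    volume ⋆[ContinuousLinearMap.lsmul ℝ ℝ, volume] h') x) atTop (𝓝 (h' x))} with hD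
  have hLip : LipschitzOnWith C h' D := by
    rw [lipschitzOnWith_iff_dist_le_mul]
    intro x hx y hy
    refine le_of_tendsto (hx.2.dist hy.2) ?_
    filter_upwards [hev] with i hi using hi.dist_le_mul x hx.1 y hy.1
  obtain ⟨g, hg, hgD⟩ := hLip.extend_real
  refine ⟨C, g, hg, ?_⟩
  rw [Filter.EventuallyEq, ae_restrict_iff' measurableSet_ball]
  filter_upwards [hae] with x hx hxB
  rw [← hgD ⟨hxB, hx⟩]
  exact indicator_of_mem (hsub (Metric.ball_subset_ball (by linarith) hxB)) _

/-- The classical derivative of a Lipschitz representative is the weak derivative. -/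
lemma ae_lineDeriv_eq_weak {Ω : TopologicalSpace.Opens ℂ} {h h' g : ℂ → ℝ} {v : ℂ} {C : NNReal}
    (hg : LipschitzWith C g) {B : Set ℂ} (hB : IsOpen B) (hBΩ : B ⊆ Ω)
    (hgh : g =ᵐ[volume.restrict B] h) (hi : IntegrableOn h' Ω)
    (hw : ∀ φ : 𝓓(Ω, ℝ), ∫ z in Ω, h z * fderiv ℝ φ z v = -∫ z in Ω, h' z * φ z) :
    ∀ᵐ z, z ∈ B → lineDeriv ℝ g z v = h' z := by
  have hm : MeasurableSet (Ω : Set ℂ) := Ω.isOpen.measurableSet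
  set H := (Ω : Set ℂ).indicator h' with hH
  have hHi : Integrable H := (integrable_indicator_iff hm).2 hi
  have hlg := hg.locallyIntegrable_lineDeriv (μ := volume) v
  have hl : LocallyIntegrable (fun z => lineDeriv ℝ g z v - H z) :=
    hlg.sub hHi.locallyIntegrable
  have := hB.ae_eq_zero_of_integral_contDiff_smul_eq_zero (hl.locallyIntegrableOn B)
    (fun ψ hψ hc hs => by
      let φ : 𝓓(Ω, ℝ) := ⟨ψ, hψ, hc, hs.trans hBΩ⟩
      have key := hw φ
      have hφ : (φ : ℂ → ℝ) = ψ := rfl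
      rw [hφ] at key
      obtain ⟨D, hD⟩ := hψ.lipschitzWith_of_hasCompactSupport hc (by simp)
      -- Integration by parts for a Lipschitz function against a test function: both candidates for
      -- the derivative have the same integrals against every `ψ` supported in `B`.
      have k2 := hg.integral_lineDeriv_mul_eq (μ := volume) hD hc v
      have hzero : ∀ z, z ∉ B → ψ z = 0 := fun z hz => by
        by_contra h0; exact hz (hs (subset_tsupport _ h0))
      have hzero' : ∀ z, z ∉ B → fderiv ℝ ψ z v = 0 := fun z hz => by
        have : fderiv ℝ ψ z = 0 := by
          by_contra h0
          exact hz (hs (support_fderiv_subset ℝ h0))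
        simp [this]
      have e1 : ∫ z, lineDeriv ℝ ψ z (-v) * g z = -∫ z in Ω, h z * fderiv ℝ ψ z v := by
        have a1 : ∀ z, lineDeriv ℝ ψ z (-v) * g z = -(g z * fderiv ℝ ψ z v) := fun z => by
          rw [(hψ.differentiable (by simp) z).lineDeriv_eq_fderiv]
          simp; ring
        simp only [a1, integral_neg]
        have b1 : ∫ z in B, g z * fderiv ℝ ψ z v = ∫ z, g z * fderiv ℝ ψ z v :=
          setIntegral_eq_integral_of_forall_compl_eq_zero (fun z hz => by simp [hzero' z hz])
        have b2 : ∫ z in Ω, h z * fderiv ℝ ψ z v = ∫ z in B, h z * fderiv ℝ ψ z v :=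
          setIntegral_eq_of_subset_of_forall_sdiff_eq_zero hm hBΩ
            (fun z hz => by simp [hzero' z hz.2])
        rw [← b1, b2]
        congr 1
        refine integral_congr_ae ?_
        filter_upwards [hgh] with z hz
        rw [hz]
      have e2 : ∫ z, ψ z • (lineDeriv ℝ g z v - H z) =
          (∫ z, lineDeriv ℝ g z v * ψ z) - ∫ z in Ω, h' z * ψ z := by
        rw [← integral_indicator hm, ← integral_sub]
        · refine integral_congr_ae (Eventually.of_forall fun z => ?_)
          by_cases hz : z ∈ (Ω : Set ℂ) <;> simp [hH, hz] <;> ring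
        · simpa [mul_comm] using
            (hlg.integrable_smul_left_of_hasCompactSupport hψ.continuous hc)
        · have := (hHi.locallyIntegrable.integrable_smul_left_of_hasCompactSupport hψ.continuous hc)
          refine this.congr (Eventually.of_forall fun z => ?_)
          by_cases hz : z ∈ (Ω : Set ℂ) <;> simp [hH, hz, mul_comm]
      rw [e2, k2, e1, key]
      simp)
  filter_upwards [this] with z hz hzB
  have := hz hzB
  rw [hH, indicator_of_mem (hBΩ hzB)] at this
  linarith

/-- The regular representatives of a stationary harmonic function and of its Hopf differential. -/
theorem exists_regular_representatives {Ω : TopologicalSpace.Opens ℂ} {h hx hy : ℂ → ℝ}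
    (hΩ : Bornology.IsBounded (Ω : Set ℂ)) (hH1 : IsH1WithGradient Ω h hx hy)
    (hstat : IsStationaryHarmonic Ω hx hy) :
    ∃ (hc : ℂ → ℝ) (ω : ℂ → ℂ), LocallyLipschitzOn Ω hc ∧ hc =ᵐ[volume.restrict Ω] h ∧
      DifferentiableOn ℂ ω Ω ∧ ω =ᵐ[volume.restrict Ω] hopfDifferential hx hy ∧
      ∀ᵐ z ∂volume.restrict (Ω : Set ℂ), DifferentiableAt ℝ hc z ∧
        fderiv ℝ hc z 1 = hx z ∧ fderiv ℝ hc z Complex.I = hy z := by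
  have hm : MeasurableSet (Ω : Set ℂ) := Ω.isOpen.measurableSet
  have : IsFiniteMeasure (volume.restrict (Ω : Set ℂ)) :=
    ⟨by simpa using hΩ.measure_lt_top⟩
  obtain ⟨hWi, hW0⟩ := weak_cauchyRiemann_hopfDifferential hH1 hstat
  obtain ⟨ω, hω, hωae⟩ := exists_holomorphic_representative hWi hW0
  have hloc : ∀ p ∈ (Ω : Set ℂ), ∃ B, IsOpen B ∧ p ∈ B ∧ B ⊆ Ω ∧ ∃ (C : NNReal) (g : ℂ → ℝ),
      LipschitzWith C g ∧ g =ᵐ[volume.restrict B] h := by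
    intro p hp
    obtain ⟨R', hR', hball⟩ := Metric.isOpen_iff.1 Ω.isOpen p hp
    have hK : Metric.closedBall p (R' / 2) ⊆ Ω :=
      (Metric.closedBall_subset_ball (by linarith)).trans hball
    obtain ⟨M, hM⟩ := (isCompact_closedBall p (R' / 2)).exists_bound_of_continuousOn
      (hω.continuousOn.mono hK)
    have hM0 : 0 ≤ M := (norm_nonneg _).trans (hM p (Metric.mem_closedBall_self (by positivity)))
    have hR6 : 3 * (R' / 6) = R' / 2 := by ring
    -- `√M` bounds the partial derivatives because `|∇h|² = |ω| ≤ M`; the radius `R' / 6` is such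
    -- that its triple stays in the compact ball.
    obtain ⟨C, g, hg, hge⟩ := exists_lipschitz_of_bounded_gradient hΩ hH1 (p := p) (R := R' / 6)
      (L := √M) (by positivity) (by positivity)
      (by rw [hR6]; exact Metric.ball_subset_closedBall.trans hK) (by
        filter_upwards [hωae] with z hz hzB
        rw [hR6] at hzB
        have h1 := hM z (Metric.ball_subset_closedBall hzB)
        rw [hz, norm_hopfDifferential] at h1
        constructor <;> refine Real.abs_le_sqrt ?_ <;> nlinarith [sq_nonneg (hx z), sq_nonneg (hy z)])
    exact ⟨_, Metric.isOpen_ball, Metric.mem_ball_self (by positivity),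
      (Metric.ball_subset_ball (by linarith)).trans hball, C, g, hg, hge⟩
  obtain ⟨hc, hcae, hcl⟩ := exists_continuous_representative (ν := volume) Ω.isOpen h
    fun p hp => by
      obtain ⟨B, h1, h2, h3, C, g, h4, h5⟩ := hloc p hp
      exact ⟨B, h1, h2, h3, g, h4.continuous.continuousOn, h5⟩
  refine ⟨hc, ω, ?_, hcae, hω, hωae, ?_⟩
  · intro p hp
    obtain ⟨B, h1, h2, h3, C, g, h4, h5⟩ := hloc p hp
    refine ⟨C, B, mem_nhdsWithin_of_mem_nhds (h1.mem_nhds h2), ?_⟩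
    have he := hcl B g h1 h3 h4.continuous.continuousOn h5
    intro x hx y hy
    rw [he hx, he hy]
    exact h4 x y
  · rw [ae_restrict_iff' hm, ae_iff]
    refine measure_null_of_locally_null _ fun p hp => ?_
    have hpΩ : p ∈ (Ω : Set ℂ) := by
      by_contra hcon
      exact hp fun h => absurd h hcon
    obtain ⟨B, h1, h2, h3, C, g, h4, h5⟩ := hloc p hpΩ
    have he := hcl B g h1 h3 h4.continuous.continuousOn h5
    refine ⟨_, inter_mem self_mem_nhdsWithin
      (mem_nhdsWithin_of_mem_nhds (h1.mem_nhds h2)), ?_⟩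
    have a1 := ae_lineDeriv_eq_weak h4 h1 h3 h5 (hH1.memLp_x.integrable (by norm_num)) hH1.weak_x
    have a2 := ae_lineDeriv_eq_weak h4 h1 h3 h5 (hH1.memLp_y.integrable (by norm_num)) hH1.weak_y
    have a3 := h4.ae_differentiableAt (μ := volume)
    have hall := a1.and (a2.and a3)
    rw [ae_iff] at hall
    refine measure_mono_null ?_ hall
    rintro z ⟨hz, hzB⟩ ⟨hz1, hz2, hz3⟩
    refine hz fun _ => ?_
    have hev : hc =ᶠ[𝓝 z] g := he.eventuallyEq_of_mem (h1.mem_nhds hzB)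
    refine ⟨hz3.congr_of_eventuallyEq hev, ?_, ?_⟩
    · rw [hev.fderiv_eq, ← hz3.lineDeriv_eq_fderiv, hz1 hzB]
    · rw [hev.fderiv_eq, ← hz3.lineDeriv_eq_fderiv, hz2 hzB]

end Regularity

/-! ### Natural charts of the quadratic differential `ω dz²`. -/

lemma contDiff_indicator_of_eq_zero {U K : Set ℂ} (hU : IsOpen U) (hK : IsClosed K) (hKU : K ⊆ U)
    {f : ℂ → ℝ} {n : WithTop ℕ∞} (hf : ContDiffOn ℝ n f U) (h0 : ∀ z ∈ U, z ∉ K → f z = 0) :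
    ContDiff ℝ n (U.indicator f) := by
  rw [contDiff_iff_contDiffAt]
  intro z
  by_cases hz : z ∈ U
  · refine (hf.contDiffAt (hU.mem_nhds hz)).congr_of_eventuallyEq ?_
    filter_upwards [hU.mem_nhds hz] with y hy using indicator_of_mem hy f
  · have hzK : z ∈ Kᶜ := fun h => hz (hKU h)
    refine (contDiffAt_const (c := (0 : ℝ))).congr_of_eventuallyEq ?_
    filter_upwards [hK.isOpen_compl.mem_nhds hzK] with y hy
    by_cases hyU : y ∈ U
    · rw [indicator_of_mem hyU, h0 y hyU hy]
    · exact indicator_of_notMem hyU f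

/-- A nonzero derivative makes `F` open at each point, in the form `map F (𝓝 w) = 𝓝 (F w)`. This
gives the continuity of the set-theoretic inverse, and continuity is all that is needed to
differentiate it. -/
lemma exists_holomorphic_inverse {F : ℂ → ℂ} {N : Set ℂ} (hN : IsOpen N)
    (hF : DifferentiableOn ℂ F N) (hinj : InjOn F N) (hF' : ∀ w ∈ N, deriv F w ≠ 0) :
    IsOpen (F '' N) ∧ ∃ Ψ : ℂ → ℂ, DifferentiableOn ℂ Ψ (F '' N) ∧ ∀ w ∈ N, Ψ (F w) = w := by
  have hstrict : ∀ w ∈ N, HasStrictDerivAt F (deriv F w) w := fun w hw =>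
    ((hF.analyticAt (hN.mem_nhds hw)).contDiffAt (n := 1)).hasStrictDerivAt (by simp)
  have hmap : ∀ w ∈ N, map F (𝓝 w) = 𝓝 (F w) := fun w hw =>
    (hstrict w hw).map_nhds_eq (hF' w hw)
  have hopen : IsOpen (F '' N) := by
    rw [isOpen_iff_mem_nhds]
    rintro _ ⟨w, hw, rfl⟩
    rw [← hmap w hw]
    exact image_mem_map (hN.mem_nhds hw)
  refine ⟨hopen, Function.invFunOn F N, ?_, fun w hw => hinj.leftInvOn_invFunOn hw⟩
  rintro _ ⟨w, hw, rfl⟩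
  have hleft : ∀ w ∈ N, Function.invFunOn F N (F w) = w := fun w hw => hinj.leftInvOn_invFunOn hw
  have hcont : ContinuousAt (Function.invFunOn F N) (F w) := by
    rw [ContinuousAt, ← hmap w hw, tendsto_map'_iff, hleft w hw]
    refine tendsto_id.congr' ?_
    filter_upwards [hN.mem_nhds hw] with y hy using (hleft y hy).symm
  have hd : HasDerivAt F (deriv F w) (Function.invFunOn F N (F w)) := by
    rw [hleft w hw]; exact (hstrict w hw).hasDerivAt
  have := hd.of_local_left_inverse hcont (hF' w hw) (by
    filter_upwards [hopen.mem_nhds (mem_image_of_mem F hw)] with y hy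
    exact Function.invFunOn_eq hy)
  exact this.differentiableAt.differentiableWithinAt

/-- The facts on a stationary harmonic function that its local description rests on: it is locally
Lipschitz, the square of its complex gradient is `ω`, and its Laplacian is `μ`. -/
structure IsStationarySolution {Ω : TopologicalSpace.Opens ℂ} (μ : SignedRadonMeasure Ω)
    (h : ℂ → ℝ) (ω : ℂ → ℂ) : Prop where
  locallyLipschitz : LocallyLipschitzOn Ω h
  ae_sq : ∀ᵐ z ∂volume.restrict (Ω : Set ℂ), DifferentiableAt ℝ h z ∧
    ((fderiv ℝ h z 1 : ℂ) - Complex.I * fderiv ℝ h z Complex.I) ^ 2 = ω z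
  pairing_eq : ∀ φ : 𝓓(Ω, ℝ), μ.pairing φ = -∫ z in Ω,
    (fderiv ℝ h z 1 * fderiv ℝ φ z 1 + fderiv ℝ h z Complex.I * fderiv ℝ φ z Complex.I)

/-- An injective holomorphic map `F : N → Ω` that pulls the quadratic differential `ω dz²` back to
`dw²`. -/
structure IsNaturalChart (Ω : TopologicalSpace.Opens ℂ) (ω F : ℂ → ℂ) (N : Set ℂ) : Prop where
  isOpen : IsOpen N
  differentiableOn : DifferentiableOn ℂ F N
  injOn : InjOn F N
  mapsTo : MapsTo F N Ω
  deriv_sq : ∀ w ∈ N, ω (F w) * deriv F w ^ 2 = 1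

namespace IsNaturalChart

variable {Ω : TopologicalSpace.Opens ℂ} {ω F : ℂ → ℂ} {N : Set ℂ}

lemma mono (hF : IsNaturalChart Ω ω F N) {N' : Set ℂ} (hN' : IsOpen N') (hsub : N' ⊆ N) :
    IsNaturalChart Ω ω F N' :=
  ⟨hN', hF.differentiableOn.mono hsub, hF.injOn.mono hsub, hF.mapsTo.mono_left hsub,
    fun w hw => hF.deriv_sq w (hsub hw)⟩

lemma deriv_ne_zero (hF : IsNaturalChart Ω ω F N) {w : ℂ} (hw : w ∈ N) : deriv F w ≠ 0 := by
  intro h0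
  have := hF.deriv_sq w hw
  simp [h0] at this

lemma hasDerivAt (hF : IsNaturalChart Ω ω F N) {w : ℂ} (hw : w ∈ N) :
    HasDerivAt F (deriv F w) w :=
  (hF.differentiableOn.differentiableAt (hF.isOpen.mem_nhds hw)).hasDerivAt

lemma hasFDerivAt (hF : IsNaturalChart Ω ω F N) {w : ℂ} (hw : w ∈ N) :
    HasFDerivAt F (deriv F w • (1 : ℂ →L[ℝ] ℂ)) w := (hF.hasDerivAt hw).complexToReal_fderiv

lemma isOpen_image (hF : IsNaturalChart Ω ω F N) : IsOpen (F '' N) :=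
  (exists_holomorphic_inverse hF.isOpen hF.differentiableOn hF.injOn
    fun _ => hF.deriv_ne_zero).1

/-- The inverse of the chart is differentiable, so it maps null sets to null sets; exceptional sets
in `Ω` stay negligible in the chart. -/
lemma ae_comp (hF : IsNaturalChart Ω ω F N) {P : ℂ → Prop}
    (hP : ∀ᵐ z ∂volume.restrict (Ω : Set ℂ), P z) : ∀ᵐ w, w ∈ N → P (F w) := by
  obtain ⟨ho, Ψ, hΨ, hl⟩ := exists_holomorphic_inverse hF.isOpen hF.differentiableOn hF.injOn
    fun _ => hF.deriv_ne_zero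
  rw [ae_restrict_iff' Ω.isOpen.measurableSet, ae_iff] at hP
  rw [ae_iff]
  have h0 := addHaar_image_eq_zero_of_differentiableOn_of_addHaar_eq_zero (μ := volume)
    (f := Ψ) (s := {z | ¬(z ∈ (Ω : Set ℂ) → P z)} ∩ F '' N)
    ((hΨ.restrictScalars ℝ).mono inter_subset_right) (measure_mono_null inter_subset_left hP)
  refine measure_mono_null (fun w hw => ?_) h0
  have hw' : w ∈ N ∧ ¬ P (F w) := by simpa using hw
  exact ⟨F w, ⟨fun h => hw'.2 (h (hF.mapsTo hw'.1)), mem_image_of_mem F hw'.1⟩, hl w hw'.1⟩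

lemma fderiv_comp_apply (hF : IsNaturalChart Ω ω F N) {w : ℂ} (hw : w ∈ N) {g : ℂ → ℝ}
    (hg : DifferentiableAt ℝ g (F w)) :
    DifferentiableAt ℝ (g ∘ F) w ∧
    fderiv ℝ (g ∘ F) w 1 = (deriv F w).re * fderiv ℝ g (F w) 1 +
      (deriv F w).im * fderiv ℝ g (F w) Complex.I ∧
    fderiv ℝ (g ∘ F) w Complex.I = (deriv F w).re * fderiv ℝ g (F w) Complex.I -
      (deriv F w).im * fderiv ℝ g (F w) 1 := by
  have h := hg.hasFDerivAt.comp w (hF.hasFDerivAt hw)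
  have hv : ∀ v : ℂ, fderiv ℝ g (F w) v =
      v.re * fderiv ℝ g (F w) 1 + v.im * fderiv ℝ g (F w) Complex.I := by
    intro v
    conv_lhs => rw [← Complex.re_add_im v]
    rw [map_add, show (v.re : ℂ) = v.re • (1 : ℂ) by simp,
      show (v.im : ℂ) * Complex.I = v.im • Complex.I by simp, map_smul, map_smul]
    simp
  refine ⟨h.differentiableAt, ?_, ?_⟩
  · rw [h.fderiv]
    simp only [ContinuousLinearMap.comp_apply]
    rw [hv]; simp
  · rw [h.fderiv]
    simp only [ContinuousLinearMap.comp_apply]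
    rw [hv]; simp; ring

variable {μ : SignedRadonMeasure Ω} {h : ℂ → ℝ}

/-- In a natural chart the gradient is `(±1, 0)` almost everywhere. -/
lemma ae_gradient (hF : IsNaturalChart Ω ω F N) (hS : IsStationarySolution μ h ω) :
    ∀ᵐ w, w ∈ N → DifferentiableAt ℝ h (F w) ∧ DifferentiableAt ℝ (h ∘ F) w ∧
      fderiv ℝ (h ∘ F) w Complex.I = 0 ∧
      (fderiv ℝ (h ∘ F) w 1 = 1 ∨ fderiv ℝ (h ∘ F) w 1 = -1) := by
  filter_upwards [hF.ae_comp hS.ae_sq] with w hw hwN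
  obtain ⟨hd, hsq⟩ := hw hwN
  obtain ⟨hd', h1, h2⟩ := hF.fderiv_comp_apply hwN hd
  have hone := hF.deriv_sq w hwN
  rw [← hsq, ← mul_pow] at hone
  set c := deriv F w with hc
  set p := fderiv ℝ h (F w) 1 with hp
  set q := fderiv ℝ h (F w) Complex.I with hq
  -- The complex gradient of `h ∘ F` is that of `h` times `F'`. Its square is `ω F'² = 1`, so it is
  -- `1` or `-1`; in particular it is real.
  have he : ((p : ℂ) - Complex.I * q) * c =
      ((c.re * p + c.im * q : ℝ) : ℂ) - Complex.I * ((c.re * q - c.im * p : ℝ) : ℂ) := by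
    apply Complex.ext <;> simp <;> ring
  rw [he, ← h1, ← h2] at hone
  refine ⟨hd, hd', ?_⟩
  rw [sq] at hone
  rcases mul_self_eq_one_iff.1 hone with h | h
  all_goals
    have hre := congrArg Complex.re h
    have him := congrArg Complex.im h
    simp at hre him
    simp [hre, him]

lemma locallyLipschitzOn (hF : IsNaturalChart Ω ω F N) (hS : IsStationarySolution μ h ω) :
    LocallyLipschitzOn N (h ∘ F) := by
  have hF1 : LocallyLipschitzOn N F := by
    intro w hw
    have hc : ContDiffAt ℝ 1 F w :=
      ((hF.differentiableOn.analyticAt (hF.isOpen.mem_nhds hw)).contDiffAt (n := 1)).restrict_scalars ℝ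
    obtain ⟨K, t, ht, hL⟩ := hc.exists_lipschitzOnWith
    exact ⟨K, t, mem_nhdsWithin_of_mem_nhds ht, hL⟩
  intro w hw
  obtain ⟨K, t, ht, hL⟩ := hF1 hw
  obtain ⟨K', t', ht', hL'⟩ := hS.locallyLipschitz (hF.mapsTo hw)
  have hc : Tendsto F (𝓝[N] w) (𝓝[(Ω : Set ℂ)] (F w)) :=
    (hF.differentiableOn.continuousOn w hw).tendsto_nhdsWithin hF.mapsTo
  exact ⟨K' * K, t ∩ F ⁻¹' t', inter_mem ht (hc ht'), hL'.comp (hL.mono inter_subset_left)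
    fun y hy => hy.2⟩

/-- The pairing of `μ` with a test function, in a natural chart. -/
lemma pairing_eq (hF : IsNaturalChart Ω ω F N) (hS : IsStationarySolution μ h ω) (φ : 𝓓(Ω, ℝ))
    (hφ : tsupport φ ⊆ F '' N) :
    μ.pairing φ = -∫ w in N, fderiv ℝ (h ∘ F) w 1 * fderiv ℝ (φ ∘ F) w 1 := by
  rw [hS.pairing_eq]
  congr 1
  have hz : ∀ z, z ∉ F '' N → fderiv ℝ φ z = 0 := fun z hz => by
    by_contra h0
    exact hz (hφ (support_fderiv_subset ℝ h0))
  rw [setIntegral_eq_of_subset_of_forall_sdiff_eq_zero Ω.isOpen.measurableSet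
    (image_subset_iff.2 hF.mapsTo) (fun z hzz => by simp [hz z hzz.2]),
    integral_image_eq_integral_abs_det_fderiv_smul volume hF.isOpen.measurableSet
      (fun w hw => (hF.hasFDerivAt hw).hasFDerivWithinAt) hF.injOn]
  refine setIntegral_congr_ae hF.isOpen.measurableSet ?_
  filter_upwards [hF.ae_gradient hS] with w hw hwN
  obtain ⟨hd, hd', hI, -⟩ := hw hwN
  obtain ⟨-, h1, h2⟩ := hF.fderiv_comp_apply hwN hd
  obtain ⟨-, h3, h4⟩ := hF.fderiv_comp_apply hwN (φ.contDiff.differentiable (by simp) (F w))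
  -- Conformal invariance of the Dirichlet integral: the Jacobian `|F'|²` is the factor gained by
  -- the product of two gradients. The vertical part of this product drops out by `hI`.
  have hdet : |(deriv F w • (1 : ℂ →L[ℝ] ℂ)).det| = (deriv F w).re ^ 2 + (deriv F w).im ^ 2 := by
    have e : (deriv F w • (1 : ℂ →L[ℝ] ℂ)).det = Algebra.norm ℝ (deriv F w) := by
      rw [Algebra.norm_apply, ContinuousLinearMap.det]
      congr 1
    rw [e, Algebra.norm_complex_apply, Complex.normSq_apply, 
      abs_of_nonneg (add_nonneg (mul_self_nonneg _) (mul_self_nonneg _))]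
    ring
  rw [hdet, h3, smul_eq_mul]
  rw [h2] at hI
  rw [h1]
  linear_combination ((deriv F w).re * fderiv ℝ φ (F w) Complex.I -
    (deriv F w).im * fderiv ℝ φ (F w) 1) * hI

/-- A test function in the coordinates of a natural chart. -/
lemma exists_test (hF : IsNaturalChart Ω ω F N) {ψ : ℂ → ℝ}
    (hψ : ContDiff ℝ ((⊤ : ℕ∞) : WithTop ℕ∞) ψ) (hc : HasCompactSupport ψ) (hs : tsupport ψ ⊆ N) :
    ∃ φ : 𝓓(Ω, ℝ), tsupport φ ⊆ F '' N ∧ (∀ w ∈ N, φ (F w) = ψ w) ∧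
      ∀ z, z ∉ F '' Function.support ψ → φ z = 0 := by
  obtain ⟨ho, Ψ, hΨ, hl⟩ := exists_holomorphic_inverse hF.isOpen hF.differentiableOn hF.injOn
    fun _ => hF.deriv_ne_zero
  have hK : IsCompact (F '' tsupport ψ) :=
    hc.isCompact.image_of_continuousOn (hF.differentiableOn.continuousOn.mono hs)
  have hKs : F '' tsupport ψ ⊆ F '' N := image_mono hs
  have hsup : Function.support ((F '' N).indicator (ψ ∘ Ψ)) ⊆ F '' Function.support ψ := by
    intro z hz
    rw [Set.support_indicator] at hz
    obtain ⟨⟨w, hw, rfl⟩, hz0⟩ := hz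
    rw [Function.mem_support, Function.comp_apply, hl w hw] at hz0
    exact mem_image_of_mem F hz0
  have hts : tsupport ((F '' N).indicator (ψ ∘ Ψ)) ⊆ F '' tsupport ψ :=
    closure_minimal (hsup.trans (image_mono (subset_tsupport _))) hK.isClosed
  refine ⟨⟨(F '' N).indicator (ψ ∘ Ψ), ?_, hK.of_isClosed_subset (isClosed_tsupport _) hts,
    hts.trans (hKs.trans (image_subset_iff.2 hF.mapsTo))⟩, hts.trans hKs, fun w hw => ?_,
    fun z hz => ?_⟩
  · refine contDiff_indicator_of_eq_zero ho hK.isClosed hKs ?_ ?_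
    · exact hψ.comp_contDiffOn ((hΨ.contDiffOn ho).restrict_scalars ℝ)
    · rintro _ ⟨w, hw, rfl⟩ hn
      simp only [Function.comp_apply, hl w hw]
      exact image_eq_zero_of_notMem_tsupport fun h => hn (mem_image_of_mem F h)
  · change (F '' N).indicator (ψ ∘ Ψ) (F w) = ψ w
    rw [indicator_of_mem (mem_image_of_mem F hw), Function.comp_apply, hl w hw]
  · by_contra h0
    exact hz (hsup h0)

/-- Where `h` is affine in the natural coordinate, `μ` vanishes. -/
lemma totalVariation_image_eq_zero (hF : IsNaturalChart Ω ω F N) (hS : IsStationarySolution μ h ω)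
    {s : ℝ} (hs : ∀ w ∈ N, h (F w) = s * w.re) : μ.totalVariation (F '' N) = 0 := by
  refine μ.totalVariation_eq_zero_of_pairing hF.isOpen_image (image_subset_iff.2 hF.mapsTo)
    fun φ hφ => ?_
  rw [hF.pairing_eq hS φ hφ, neg_eq_zero]
  obtain ⟨ho, Ψ, hΨ, hl⟩ := exists_holomorphic_inverse hF.isOpen hF.differentiableOn hF.injOn
    fun _ => hF.deriv_ne_zero
  have hK : IsCompact (Ψ '' tsupport φ) :=
    φ.hasCompactSupport.isCompact.image_of_continuousOn (hΨ.continuousOn.mono hφ)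
  have hKN : Ψ '' tsupport φ ⊆ N := by
    rintro _ ⟨z, hz, rfl⟩
    obtain ⟨w, hw, rfl⟩ := hφ hz
    rwa [hl w hw]
  have h0 : ∀ w ∈ N, w ∉ Ψ '' tsupport φ → (φ ∘ F) w = 0 := by
    intro w hw hn
    refine image_eq_zero_of_notMem_tsupport (f := φ) fun hz => hn ⟨F w, hz, hl w hw⟩
  -- The test function in the chart, extended by zero, so that the integral of its `x`-derivative is
  -- one over the whole plane and vanishes.
  set ψ := N.indicator (φ ∘ F) with hψ
  have hψd : ContDiff ℝ 1 ψ := contDiff_indicator_of_eq_zero hF.isOpen hK.isClosed hKN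
    ((φ.contDiff.of_le (by exact_mod_cast le_top)).comp_contDiffOn
      ((hF.differentiableOn.contDiffOn hF.isOpen).restrict_scalars ℝ)) h0
  have hψs : tsupport ψ ⊆ Ψ '' tsupport φ := by
    refine closure_minimal (fun w hw => ?_) hK.isClosed
    by_contra hn
    refine hw ?_
    by_cases hwN : w ∈ N
    · rw [hψ, indicator_of_mem hwN, h0 w hwN hn]
    · exact indicator_of_notMem hwN _
  have hψc : HasCompactSupport ψ := hK.of_isClosed_subset (isClosed_tsupport _) hψs
  have hz : ∀ w, w ∉ N → fderiv ℝ ψ w = 0 := fun w hw => by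
    by_contra h0
    exact hw (hKN (hψs (support_fderiv_subset ℝ h0)))
  have e1 : ∀ w ∈ N, fderiv ℝ (h ∘ F) w 1 * fderiv ℝ (φ ∘ F) w 1 = s * fderiv ℝ ψ w 1 := by
    intro w hw
    have a1 : (h ∘ F) =ᶠ[𝓝 w] fun w => s • Complex.reCLM w := by
      filter_upwards [hF.isOpen.mem_nhds hw] with y hy
      simp [hs y hy]
    have a2 : (φ ∘ F) =ᶠ[𝓝 w] ψ := by
      filter_upwards [hF.isOpen.mem_nhds hw] with y hy
      rw [hψ, indicator_of_mem hy]
    have a3 : HasFDerivAt (fun w => s • Complex.reCLM w) (s • Complex.reCLM) w :=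
      Complex.reCLM.hasFDerivAt.const_smul s
    rw [a1.fderiv_eq, a2.fderiv_eq, a3.fderiv]
    simp
  rw [setIntegral_congr_fun hF.isOpen.measurableSet e1, integral_const_mul,
    setIntegral_eq_integral_of_forall_compl_eq_zero (fun w hw => by simp [hz w hw])]
  have hint : Integrable fun w => fderiv ℝ ψ w 1 :=
    ((hψd.continuous_fderiv (by simp)).clm_apply continuous_const).integrable_of_hasCompactSupport
      (hψc.fderiv_apply ℝ 1)
  have := integral_mul_fderiv_eq_neg_fderiv_mul_of_integrable (μ := volume) (f := fun _ : ℂ => (1 : ℝ))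
    (g := ψ) (v := 1) (by simp) (by simpa using hint)
    (by simpa using hψd.continuous.integrable_of_hasCompactSupport hψc) 
    (fun _ _ => differentiableAt_const _) (fun w _ => hψd.differentiable (by simp) w)
  simp at this
  rw [this, mul_zero]

end IsNaturalChart

/-! ### Functions of one variable with derivative `±1`. -/

section OneDimensional

open scoped Convolution

/-- The smooth cutoff between `p` and `q` with kernel `η`: the difference of the primitives of
`η (· - p)` and `η (· - q)`. -/
noncomputable def smoothCutoff (η : ℝ → ℝ) (p q x : ℝ) : ℝ := ∫ t in (x - q)..(x - p), η t

lemma hasDerivAt_smoothCutoff {η : ℝ → ℝ} (hη : Continuous η) (p q x : ℝ) :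
    HasDerivAt (smoothCutoff η p q) (η (x - p) - η (x - q)) x := by
  have h0 : ∀ c : ℝ, HasDerivAt (fun x => ∫ t in (0 : ℝ)..(x - c), η t) (η (x - c)) x := fun c => by
    have := (intervalIntegral.integral_hasDerivAt_right (hη.intervalIntegrable 0 (x - c))
      hη.stronglyMeasurable.stronglyMeasurableAtFilter hη.continuousAt).comp x
      ((hasDerivAt_id x).sub_const c)
    rw [mul_one] at this
    exact this
  refine ((h0 p).sub (h0 q)).congr_of_eventuallyEq (Eventually.of_forall fun y => ?_)
  exact (intervalIntegral.integral_interval_sub_left (hη.intervalIntegrable _ _)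
    (hη.intervalIntegrable _ _)).symm

lemma contDiff_smoothCutoff {η : ℝ → ℝ} (hη : ContDiff ℝ ((⊤ : ℕ∞) : WithTop ℕ∞) η) (p q : ℝ) :
    ContDiff ℝ ((⊤ : ℕ∞) : WithTop ℕ∞) (smoothCutoff η p q) := by
  rw [contDiff_infty_iff_deriv]
  refine ⟨fun x => (hasDerivAt_smoothCutoff hη.continuous p q x).differentiableAt, ?_⟩
  have : deriv (smoothCutoff η p q) = fun x => η (x - p) - η (x - q) :=
    funext fun x => (hasDerivAt_smoothCutoff hη.continuous p q x).deriv
  rw [this]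
  exact (hη.comp (contDiff_id.sub contDiff_const)).sub (hη.comp (contDiff_id.sub contDiff_const))

lemma smoothCutoff_nonneg {η : ℝ → ℝ} (hpos : ∀ x, 0 ≤ η x) {p q : ℝ} (hpq : p ≤ q) (x : ℝ) :
    0 ≤ smoothCutoff η p q x :=
  intervalIntegral.integral_nonneg (by linarith) fun t _ => hpos t

lemma smoothCutoff_le_one {η : ℝ → ℝ} (hη : Integrable η) (hpos : ∀ x, 0 ≤ η x)
    (h1 : ∫ x, η x = 1) {p q : ℝ} (hpq : p ≤ q) (x : ℝ) : smoothCutoff η p q x ≤ 1 := by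
  rw [smoothCutoff, intervalIntegral.integral_of_le (by linarith), ← h1]
  exact setIntegral_le_integral hη (Eventually.of_forall hpos)

lemma smoothCutoff_eq_zero {η : ℝ → ℝ} {p q r : ℝ} (hpq : p ≤ q)
    (hη : ∀ t, r ≤ |t| → η t = 0) {x : ℝ} (hx : x ∉ Ioo (p - r) (q + r)) :
    smoothCutoff η p q x = 0 := by
  rw [smoothCutoff, intervalIntegral.integral_of_le (by linarith)]
  refine setIntegral_eq_zero_of_forall_eq_zero fun t ht => hη t ?_
  rw [mem_Ioo, not_and_or, not_lt, not_lt] at hx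
  rcases hx with hx | hx
  · rw [le_abs]; right; linarith [ht.2]
  · rw [le_abs]; left; linarith [ht.1]

/-- A locally Lipschitz function with almost everywhere constant derivative is affine. -/
lemma eq_affine_of_ae_deriv {f : ℝ → ℝ} {a b s : ℝ} (hf : LocallyLipschitzOn (Ioo a b) f)
    (hd : ∀ᵐ x, x ∈ Ioo a b → HasDerivAt f s x) {x y : ℝ} (hx : x ∈ Ioo a b) (hy : y ∈ Ioo a b) :
    f x - s * x = f y - s * y := by
  have hsub : uIcc x y ⊆ Ioo a b := (convex_Ioo a b).ordConnected.uIcc_subset hx hy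
  obtain ⟨K, hK⟩ := (hf.mono hsub).exists_lipschitzOnWith_of_compact isCompact_uIcc
  have hac : AbsolutelyContinuousOnInterval (fun t => f t - s * t) x y := by
    refine hK.absolutelyContinuousOnInterval.sub ?_
    refine LipschitzOnWith.absolutelyContinuousOnInterval (K := ‖s‖₊) ?_
    refine LipschitzOnWith.of_dist_le_mul fun u _ v _ => ?_
    rw [Real.dist_eq, ← mul_sub, abs_mul, Real.dist_eq]
    rfl
  obtain ⟨C, hC⟩ := hac.const_of_ae_hasDerivAt_zero (by
    filter_upwards [hd] with t ht htm
    have := (ht (hsub htm)).sub ((hasDerivAt_id t).const_mul s)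
    rw [mul_one, sub_self] at this
    exact this)
  have h1 := hC x left_mem_uIcc
  have h2 := hC y right_mem_uIcc
  exact h1.trans h2.symm

/-- A function with values `±1` that has small derivative in the sense of distributions is
constant almost everywhere. -/
lemma ae_eq_const_of_small_variation {σ : ℝ → ℝ} {a b M : ℝ} (hM : M < 2)
    (hσm : AEStronglyMeasurable σ)
    (hσ : ∀ᵐ x, x ∈ Ioo a b → σ x = 1 ∨ σ x = -1)
    (hvar : ∀ g : ℝ → ℝ, ContDiff ℝ ((⊤ : ℕ∞) : WithTop ℕ∞) g → (∃ K, IsCompact K ∧ K ⊆ Ioo a b ∧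
      ∀ x ∉ K, g x = 0) → (∀ x, 0 ≤ g x) → (∀ x, g x ≤ 1) →
      |∫ x in Ioo a b, σ x * deriv g x| ≤ M) :
    ∃ s : ℝ, (s = 1 ∨ s = -1) ∧ ∀ᵐ x, x ∈ Ioo a b → σ x = s := by
  set τ := (Ioo a b).indicator σ with hτ
  have hτi : Integrable τ := by
    rw [hτ, integrable_indicator_iff measurableSet_Ioo]
    refine Measure.integrableOn_of_bounded (M := 1) (by simp) hσm ?_
    rw [ae_restrict_iff' measurableSet_Ioo]
    filter_upwards [hσ] with x hx hxm
    rcases hx hxm with h | h <;> simp [h]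
  have hae := ae_tendsto_shrinkingBump (ν := volume) hτi.locallyIntegrable
  set S := {x | (x ∈ Ioo a b → σ x = 1 ∨ σ x = -1) ∧
    Tendsto (fun i => ((shrinkingBump i : ContDiffBump (0 : ℝ)).normed volume
      ⋆[ContinuousLinearMap.lsmul ℝ ℝ, volume] τ) x) atTop (𝓝 (τ x))} with hS
  have hSae : ∀ᵐ x, x ∈ S := hσ.and hae
  have hkey : ∀ p ∈ S ∩ Ioo a b, ∀ q ∈ S ∩ Ioo a b, p < q → σ p = σ q := by
    rintro p ⟨⟨hp1, hp2⟩, hpI⟩ q ⟨⟨hq1, hq2⟩, hqI⟩ hpq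
    -- The cutoff between `p` and `q` has derivative `η (· - p) - η (· - q)`, so testing with it
    -- gives the difference of the smoothings of `σ` at `p` and `q`. In the limit `|σ p - σ q| ≤ M <
    -- 2`, which excludes opposite signs.
    have hlim := (hp2.sub hq2).abs
    rw [hτ, indicator_of_mem hpI, indicator_of_mem hqI] at hlim
    have hle : |σ p - σ q| ≤ M := by
      refine le_of_tendsto hlim ?_
      filter_upwards [tendsto_shrinkingBump_rOut (E := ℝ) |>.eventually
        (gt_mem_nhds (sub_pos.2 hpI.1)), tendsto_shrinkingBump_rOut (E := ℝ) |>.eventually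
        (gt_mem_nhds (sub_pos.2 hqI.2))] with i hi1 hi2
      set η := (shrinkingBump i : ContDiffBump (0 : ℝ)) with hη
      have hη0 : ∀ t, η.rOut ≤ |t| → η.normed volume t = 0 := fun t ht => by
        have : t ∉ Function.support (η.normed volume) := by
          rw [η.support_normed_eq, mem_ball_zero_iff, not_lt]; exact ht
        simpa using this
      have hηd : ContDiff ℝ ((⊤ : ℕ∞) : WithTop ℕ∞) (η.normed volume) := η.contDiff_normed
      have hηi : Integrable (η.normed volume) := η.integrable_normed
      have hv := hvar (smoothCutoff (η.normed volume) p q) (contDiff_smoothCutoff hηd p q)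
        ⟨Icc (p - η.rOut) (q + η.rOut), isCompact_Icc, fun x hx => ⟨by linarith [hx.1],
          by linarith [hx.2]⟩, fun x hx => smoothCutoff_eq_zero hpq.le hη0
            fun h => hx (Ioo_subset_Icc_self h)⟩
        (smoothCutoff_nonneg η.nonneg_normed hpq.le)
        (smoothCutoff_le_one hηi η.nonneg_normed η.integral_normed hpq.le)
      have hc : ∀ c : ℝ, (η.normed volume ⋆[ContinuousLinearMap.lsmul ℝ ℝ, volume] τ) c =
          ∫ x in Ioo a b, σ x * η.normed volume (x - c) := by
        intro c
        rw [convolution_eq_swap, ← integral_indicator measurableSet_Ioo]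
        refine integral_congr_ae (Eventually.of_forall fun x => ?_)
        have : η.normed volume (c - x) = η.normed volume (x - c) := by
          rw [← η.normed_neg, neg_sub]
        by_cases hx : x ∈ Ioo a b
        · simp only [hτ, indicator_of_mem hx, this]; simp [mul_comm]
        · simp only [hτ, indicator_of_notMem hx]; simp
      have hi : ∀ c : ℝ, IntegrableOn (fun x => σ x * η.normed volume (x - c)) (Ioo a b) := by
        intro c
        obtain ⟨C, hC⟩ := hηd.continuous.bounded_above_of_compact_support η.hasCompactSupport_normed
        exact ((integrable_indicator_iff measurableSet_Ioo).1 hτi).mul_bdd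
          (hηd.continuous.comp (continuous_sub_right c)).aestronglyMeasurable
          (Eventually.of_forall fun x => hC _)
      rw [hc, hc, ← integral_sub (hi p) (hi q)]
      refine le_trans (le_of_eq ?_) hv
      congr 1
      refine integral_congr_ae (Eventually.of_forall fun x => ?_)
      simp only [(hasDerivAt_smoothCutoff hηd.continuous p q x).deriv]
      ring
    have h2 : |σ p - σ q| < 2 := hle.trans_lt hM
    rcases hp1 hpI with h | h <;> rcases hq1 hqI with h' | h' <;> rw [h, h'] at h2 ⊢ <;>
      norm_num at h2
  by_cases hne : ∃ p, p ∈ S ∩ Ioo a b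
  · obtain ⟨p, hp⟩ := hne
    refine ⟨σ p, hp.1.1 hp.2, ?_⟩
    filter_upwards [hSae] with x hx hxI
    rcases lt_trichotomy p x with h | h | h
    · exact (hkey p hp x ⟨hx, hxI⟩ h).symm
    · rw [h]
    · exact hkey x ⟨hx, hxI⟩ p hp h
  · refine ⟨1, Or.inl rfl, ?_⟩
    filter_upwards [hSae] with x hx hxI using absurd ⟨x, hx, hxI⟩ hne

end OneDimensional

/-! ### Rigidity of `h` on rectangles of a natural chart. -/

lemma ae_ae_of_ae_complex {P : ℂ → Prop} (hP : ∀ᵐ w, P w) :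
    ∀ᵐ x : ℝ, ∀ᵐ y : ℝ, P (x + y * Complex.I) := by
  have h1 := (Complex.volume_preserving_equiv_real_prod.symm).quasiMeasurePreserving.ae hP
  rw [Measure.volume_eq_prod] at h1
  filter_upwards [Measure.ae_ae_of_ae_prod h1] with x hx
  filter_upwards [hx] with y hy
  have : Complex.measurableEquivRealProd.symm (x, y) = x + y * Complex.I := by
    apply Complex.ext <;> simp [Complex.measurableEquivRealProd]
  rwa [this] at hy

lemma integral_mul_complex (f g : ℝ → ℝ) :
    ∫ w : ℂ, f w.re * g w.im = (∫ x, f x) * ∫ y, g y := by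
  rw [← integral_prod_mul, ← Measure.volume_eq_prod]
  exact (Complex.volume_preserving_equiv_real_prod).integral_comp
    Complex.measurableEquivRealProd.measurableEmbedding (fun p : ℝ × ℝ => f p.1 * g p.2)

namespace IsNaturalChart

variable {Ω : TopologicalSpace.Opens ℂ} {ω F : ℂ → ℂ} {N : Set ℂ}
  {μ : SignedRadonMeasure Ω} {h : ℂ → ℝ}

/-- In a natural chart `h` is constant on the vertical segments of a rectangle. -/
lemma eq_of_re_eq (hF : IsNaturalChart Ω ω F N) (hS : IsStationarySolution μ h ω)
    {x₁ x₂ y₁ y₂ : ℝ} (hQ : Ioo x₁ x₂ ×ℂ Ioo y₁ y₂ ⊆ N) {w w' : ℂ}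
    (hw : w ∈ Ioo x₁ x₂ ×ℂ Ioo y₁ y₂) (hw' : w' ∈ Ioo x₁ x₂ ×ℂ Ioo y₁ y₂) (hre : w.re = w'.re) :
    h (F w) = h (F w') := by
  set k := h ∘ F with hk
  have hkL : LocallyLipschitzOn N k := hF.locallyLipschitzOn hS
  have hvert : ∀ y ∈ Ioo y₁ y₂, ContinuousOn (fun x : ℝ => k (x + y * Complex.I)) (Ioo x₁ x₂) := by
    intro y hy
    refine hkL.continuousOn.comp (by fun_prop) fun x hx => hQ ?_
    simpa [Complex.mem_reProdIm] using ⟨hx, hy⟩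
  -- By Fubini the gradient is known at almost every point of almost every vertical line. On such a
  -- line `k` is Lipschitz with zero derivative, hence constant; continuity in `x` then covers the
  -- remaining lines.
  have hae : (fun x : ℝ => k (x + w.im * Complex.I)) =ᵐ[volume.restrict (Ioo x₁ x₂)]
      fun x : ℝ => k (x + w'.im * Complex.I) := by
    rw [Filter.EventuallyEq, ae_restrict_iff' measurableSet_Ioo]
    filter_upwards [ae_ae_of_ae_complex (hF.ae_gradient hS)] with x hx hxI
    have hsub : ∀ y ∈ uIcc w.im w'.im, (x : ℂ) + y * Complex.I ∈ N := by
      intro y hy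
      have := (convex_Ioo y₁ y₂).ordConnected.uIcc_subset hw.2 hw'.2 hy
      exact hQ (by simpa [Complex.mem_reProdIm] using ⟨hxI, this⟩)
    have hline : LipschitzWith 1 fun y : ℝ => (x : ℂ) + y * Complex.I := by
      refine LipschitzWith.of_dist_le_mul fun u v => ?_
      simp [dist_eq_norm, ← sub_mul, ← Complex.ofReal_sub]
    have hcomp : LocallyLipschitzOn (uIcc w.im w'.im) fun y : ℝ => k (x + y * Complex.I) := by
      intro y hy
      obtain ⟨K, t, ht, hL⟩ := hkL (hsub y hy)
      refine ⟨K * 1, (fun y : ℝ => (x : ℂ) + y * Complex.I) ⁻¹' t ∩ uIcc w.im w'.im,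
        inter_mem ?_ self_mem_nhdsWithin, hL.comp (hline.lipschitzOnWith) fun y hy => hy.1⟩
      exact (hline.continuous.continuousWithinAt.tendsto_nhdsWithin hsub) ht
    obtain ⟨K, hK⟩ := hcomp.exists_lipschitzOnWith_of_compact isCompact_uIcc
    obtain ⟨C, hC⟩ := hK.absolutelyContinuousOnInterval.const_of_ae_hasDerivAt_zero (by
      filter_upwards [hx] with y hy hyI
      obtain ⟨-, hd, h0, -⟩ := hy (hsub y hyI)
      have hl : HasDerivAt (fun y : ℝ => (x : ℂ) + y * Complex.I) Complex.I y := by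
        have := ((Complex.ofRealCLM.hasDerivAt (x := y)).mul_const Complex.I).const_add (x : ℂ)
        simpa using this
      have := hd.hasFDerivAt.comp_hasDerivAt y hl
      rw [h0] at this
      exact this)
    have h1 := hC _ left_mem_uIcc
    have h2 := hC _ right_mem_uIcc
    exact h1.trans h2.symm
  have heq := Measure.eqOn_open_of_ae_eq hae isOpen_Ioo (hvert _ hw.2) (hvert _ hw'.2) hw.1
  simp only [hk, Function.comp_apply] at heq
  rw [Complex.re_add_im, hre, Complex.re_add_im] at heq
  exact heq

/-- If `|μ|` has small mass in a part of a rectangle, then `h` is affine in the rectangle. -/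
lemma exists_eq_affine (hF : IsNaturalChart Ω ω F N) (hS : IsStationarySolution μ h ω)
    {x₁ x₂ y₁ y₂ c d : ℝ} (hQ : Ioo x₁ x₂ ×ℂ Ioo y₁ y₂ ⊆ N) (hcd : c < d)
    (hsub : Icc c d ⊆ Ioo y₁ y₂)
    (hμ : μ.totalVariation (F '' (Ioo x₁ x₂ ×ℂ Ioo c d)) < ENNReal.ofReal (d - c)) :
    ∃ s b : ℝ, (s = 1 ∨ s = -1) ∧ ∀ w ∈ Ioo x₁ x₂ ×ℂ Ioo y₁ y₂, h (F w) = s * w.re + b := by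
  set k := h ∘ F with hk
  have hcy : c ∈ Ioo y₁ y₂ := hsub (left_mem_Icc.2 hcd.le)
  have hkL : LocallyLipschitzOn N k := hF.locallyLipschitzOn hS
  set f : ℝ → ℝ := fun x => k (x + c * Complex.I) with hf
  have hmem : ∀ x ∈ Ioo x₁ x₂, (x : ℂ) + c * Complex.I ∈ Ioo x₁ x₂ ×ℂ Ioo y₁ y₂ := fun x hx => by
    simpa [Complex.mem_reProdIm] using ⟨hx, hcy⟩
  have hkf : ∀ w ∈ Ioo x₁ x₂ ×ℂ Ioo y₁ y₂, k w = f w.re := fun w hw =>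
    hF.eq_of_re_eq hS hQ hw (hmem _ hw.1) (by simp)
  have hQo : IsOpen (Ioo x₁ x₂ ×ℂ Ioo y₁ y₂) := isOpen_Ioo.reProdIm isOpen_Ioo
  have hderiv : ∀ w ∈ Ioo x₁ x₂ ×ℂ Ioo y₁ y₂, DifferentiableAt ℝ k w →
      HasDerivAt f (fderiv ℝ k w 1) w.re := by
    intro w hw hd
    have hl : HasDerivAt (fun x : ℝ => (x : ℂ) + w.im * Complex.I) 1 w.re := by
      simpa using (Complex.ofRealCLM.hasDerivAt (x := w.re)).add_const ((w.im : ℂ) * Complex.I)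
    have hd' : HasFDerivAt k (fderiv ℝ k w) ((w.re : ℂ) + w.im * Complex.I) := by
      rw [Complex.re_add_im]; exact hd.hasFDerivAt
    refine (hd'.comp_hasDerivAt w.re hl).congr_of_eventuallyEq ?_
    filter_upwards [isOpen_Ioo.mem_nhds hw.1] with x hx
    have hxw : (x : ℂ) + w.im * Complex.I ∈ Ioo x₁ x₂ ×ℂ Ioo y₁ y₂ := by
      simpa [Complex.mem_reProdIm] using ⟨hx, hw.2⟩
    rw [Function.comp_apply, hkf _ hxw]
    simp
  have hgrad := hF.ae_gradient hS
  have hfd : ∀ᵐ x, x ∈ Ioo x₁ x₂ → DifferentiableAt ℝ f x ∧ (deriv f x = 1 ∨ deriv f x = -1) := by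
    filter_upwards [ae_ae_of_ae_complex hgrad] with x hx hxI
    -- Since `k` depends on the real part only, a single good ordinate `y` suffices to differentiate
    -- `f` at `x`.
    have : ∃ y ∈ Ioo c d, (x : ℂ) + y * Complex.I ∈ N → DifferentiableAt ℝ k (x + y * Complex.I) ∧
        (fderiv ℝ k (x + y * Complex.I) 1 = 1 ∨ fderiv ℝ k (x + y * Complex.I) 1 = -1) := by
      by_contra hcon
      push Not at hcon
      have hz : volume (Ioo c d) = 0 := by
        refine measure_mono_null (fun y hy => ?_) (ae_iff.1 hx)
        intro hy'
        obtain ⟨hN, hn⟩ := hcon y hy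
        obtain ⟨-, h2, -, h4⟩ := hy' hN
        rcases h4 with h4 | h4
        · exact (hn h2).1 h4
        · exact (hn h2).2 h4
      rw [Real.volume_Ioo, ENNReal.ofReal_eq_zero] at hz
      linarith
    obtain ⟨y, hy, hyd⟩ := this
    have hw : (x : ℂ) + y * Complex.I ∈ Ioo x₁ x₂ ×ℂ Ioo y₁ y₂ := by
      simpa [Complex.mem_reProdIm] using ⟨hxI, hsub (Ioo_subset_Icc_self hy)⟩
    obtain ⟨hd, hs⟩ := hyd (hQ hw)
    have hd' := hderiv _ hw hd
    have hre : ((x : ℂ) + y * Complex.I).re = x := by simp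
    rw [hre] at hd'
    exact ⟨hd'.differentiableAt, by rw [hd'.deriv]; exact hs⟩
  set m := (c + d) / 2 with hm
  -- Test functions `g(x) β(y)` turn the pairing into `-(∫ f' g') ∫ β`. The plateau of `β` has
  -- length `(d - c) / 2`, so `∫ β ≥ (d - c) / 2`, and a mass below `d - c` bounds the variation of
  -- `f'` by a constant less than 2.
  let β : ContDiffBump m := ⟨(d - c) / 4, (d - c) / 2, by linarith, by linarith⟩
  have hβs : Function.support β = Ioo c d := by
    rw [β.support_eq, Real.ball_eq_Ioo]
    congr 1 <;> simp only [β, hm] <;> ring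
  set B := ∫ y, β y with hB
  have hBle : (d - c) / 2 ≤ B := by
    have := β.measure_closedBall_le_integral volume
    rw [Measure.real, Real.volume_closedBall, ENNReal.toReal_ofReal (by simp only [β]; linarith)] at this
    simp only [β] at this
    linarith
  have hBpos : 0 < B := by linarith
  set T := μ.totalVariation (F '' (Ioo x₁ x₂ ×ℂ Ioo c d)) with hT
  have hTtop : T ≠ ⊤ := hμ.ne_top
  have hTlt : T.toReal < d - c := by
    rwa [← ENNReal.lt_ofReal_iff_toReal_lt hTtop]
  obtain ⟨s, hs, hfs⟩ := ae_eq_const_of_small_variation (σ := deriv f) (a := x₁) (b := x₂)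
    (M := T.toReal / B) (by rw [div_lt_iff₀ hBpos]; linarith)
    (measurable_deriv f).aestronglyMeasurable (by filter_upwards [hfd] with x hx hxI using (hx hxI).2)
    (by
      rintro g hg ⟨K, hK, hKsub, hK0⟩ hg0 hg1
      set ψ : ℂ → ℝ := fun w => g w.re * β w.im with hψ
      have hψd : ContDiff ℝ ((⊤ : ℕ∞) : WithTop ℕ∞) ψ :=
        (hg.comp Complex.reCLM.contDiff).mul (β.contDiff.comp Complex.imCLM.contDiff)
      have hψsup : Function.support ψ ⊆ K ×ℂ Ioo c d := by
        intro w hw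
        rw [Function.mem_support, hψ] at hw
        refine ⟨?_, ?_⟩
        · by_contra hn
          exact hw (by simp [hK0 w.re hn])
        · change w.im ∈ Ioo c d
          rw [← hβs]
          intro h0
          exact hw (by simp [h0])
      have hcomp : IsCompact (K ×ℂ Icc c d) := hK.reProdIm isCompact_Icc
      have hψt : tsupport ψ ⊆ K ×ℂ Icc c d := by
        refine closure_minimal (hψsup.trans ?_) hcomp.isClosed
        exact fun w hw => ⟨hw.1, Ioo_subset_Icc_self hw.2⟩
      have hψQ : tsupport ψ ⊆ Ioo x₁ x₂ ×ℂ Ioo y₁ y₂ := fun w hw =>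
        ⟨hKsub (hψt hw).1, hsub (hψt hw).2⟩
      obtain ⟨φ, hφs, hφ, hφ0⟩ := (hF.mono hQo hQ).exists_test hψd
        (hcomp.of_isClosed_subset (isClosed_tsupport _) hψt) hψQ
      have hpair := (hF.mono hQo hQ).pairing_eq hS φ hφs
      have hle : |μ.pairing φ| ≤ T.toReal := by
        refine μ.abs_pairing_le φ (fun z hz => hφ0 z fun hz' => hz ?_) (fun z => ?_) hTtop
        · exact image_mono (show Function.support ψ ⊆ Ioo x₁ x₂ ×ℂ Ioo c d from
            fun w hw => ⟨hKsub (hψsup hw).1, (hψsup hw).2⟩) hz'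
        · by_cases hz : z ∈ F '' Function.support ψ
          · obtain ⟨w, hw, rfl⟩ := hz
            rw [hφ w (hψQ (subset_tsupport _ hw)), hψ, abs_of_nonneg (mul_nonneg (hg0 _) β.nonneg)]
            exact mul_le_one₀ (hg1 _) β.nonneg β.le_one
          · simp [hφ0 z hz]
      have hint : ∫ w in Ioo x₁ x₂ ×ℂ Ioo y₁ y₂, fderiv ℝ (h ∘ F) w 1 * fderiv ℝ (φ ∘ F) w 1 =
          (∫ x in Ioo x₁ x₂, deriv f x * deriv g x) * B := by
        have e1 : ∫ w in Ioo x₁ x₂ ×ℂ Ioo y₁ y₂, fderiv ℝ (h ∘ F) w 1 * fderiv ℝ (φ ∘ F) w 1 =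
            ∫ w in Ioo x₁ x₂ ×ℂ Ioo y₁ y₂, (Ioo x₁ x₂).indicator (fun x => deriv f x * deriv g x) w.re
              * β w.im := by
          refine setIntegral_congr_ae hQo.measurableSet ?_
          filter_upwards [hgrad] with w hw hwQ
          obtain ⟨-, hd, -, -⟩ := hw (hQ hwQ)
          have hev : (φ ∘ F) =ᶠ[𝓝 w] ψ := by
            filter_upwards [hQo.mem_nhds hwQ] with y hy using hφ y hy
          have hψ1 : fderiv ℝ ψ w 1 = deriv g w.re * β w.im := by
            have hl : HasDerivAt (fun t : ℝ => w + t) 1 0 := by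
              simpa using (Complex.ofRealCLM.hasDerivAt (x := 0)).const_add w
            have hd1 : HasFDerivAt ψ (fderiv ℝ ψ w) (w + (0 : ℝ)) := by
              simpa using (hψd.differentiable (by simp) w).hasFDerivAt
            have h1 := hd1.comp_hasDerivAt 0 hl
            have hg' : HasDerivAt g (deriv g w.re) (w.re + 0) := by
              simpa using (hg.differentiable (by simp) w.re).hasDerivAt
            have h2 : HasDerivAt (fun t : ℝ => g (w.re + t) * β w.im) (deriv g w.re * β w.im) 0 := by
              have := (hg'.comp 0 ((hasDerivAt_id (0 : ℝ)).const_add w.re)).mul_const (β w.im)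
              rw [mul_one] at this
              exact this
            have h3 : (ψ ∘ fun t : ℝ => w + t) = fun t : ℝ => g (w.re + t) * β w.im := by
              funext t; simp [hψ]
            rw [h3] at h1
            exact h1.unique h2
          have hwx : w.re ∈ Ioo x₁ x₂ := hwQ.1
          rw [hev.fderiv_eq, hψ1, indicator_of_mem hwx, (hderiv w hwQ hd).deriv]
          ring
        rw [e1, setIntegral_eq_integral_of_forall_compl_eq_zero, integral_mul_complex,
          integral_indicator measurableSet_Ioo]
        intro w hw
        by_cases hwx : w.re ∈ Ioo x₁ x₂
        · have : w.im ∉ Function.support β := by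
            rw [hβs]
            exact fun h => hw ⟨hwx, hsub (Ioo_subset_Icc_self h)⟩
          rw [Function.notMem_support.1 this, mul_zero]
        · rw [indicator_of_notMem hwx, zero_mul]
      rw [hpair, abs_neg, hint, abs_mul, abs_of_pos hBpos] at hle
      rwa [le_div_iff₀ hBpos])
  by_cases hne : (Ioo x₁ x₂).Nonempty
  swap
  · exact ⟨1, 0, Or.inl rfl, fun w hw => absurd ⟨w.re, hw.1⟩ hne⟩
  obtain ⟨x₀, hx₀⟩ := hne
  have hfL : LocallyLipschitzOn (Ioo x₁ x₂) f := by
    have hline : LipschitzWith 1 fun x : ℝ => (x : ℂ) + c * Complex.I := by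
      refine LipschitzWith.of_dist_le_mul fun u v => ?_
      simp [dist_eq_norm, ← Complex.ofReal_sub]
    intro x hx
    obtain ⟨K, t, ht, hL⟩ := hkL (hQ (hmem x hx))
    refine ⟨K * 1, (fun x : ℝ => (x : ℂ) + c * Complex.I) ⁻¹' t ∩ Ioo x₁ x₂,
      inter_mem ?_ self_mem_nhdsWithin, hL.comp (hline.lipschitzOnWith) fun y hy => hy.1⟩
    exact (hline.continuous.continuousWithinAt.tendsto_nhdsWithin fun y hy => hQ (hmem y hy)) ht
  refine ⟨s, f x₀ - s * x₀, hs, fun w hw => ?_⟩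
  have := eq_affine_of_ae_deriv (s := s) hfL (by
    filter_upwards [hfd, hfs] with x h1 h2 hx
    rw [← h2 hx]
    exact (h1 hx).1.hasDerivAt) hw.1 hx₀
  have h2 := hkf w hw
  simp only [hk, Function.comp_apply] at h2
  rw [h2]
  linarith

end IsNaturalChart

/-! ### Normal form at a zero of odd order. -/

/-- The Euler equation `(n + 1) P + 2 (z - c) P' = q` has a holomorphic solution. -/
lemma exists_eulerEquation_solution (n : ℕ) {q : ℂ → ℂ} {c : ℂ} {R : ℝ}
    (hq : DifferentiableOn ℂ q (Metric.ball c R)) :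
    ∃ P : ℂ → ℂ, DifferentiableOn ℂ P (Metric.ball c R) ∧
      ∀ z ∈ Metric.ball c R, (n + 1) * P z + 2 * (z - c) * deriv P z = q z := by
  -- The solution is `P z = ∫₀¹ u^n q(c + u² (z - c)) du`: the left side of the equation is then the
  -- integral of the `u`-derivative of `u^(n+1) q(c + u² (z - c))`.
  set G : ℂ → ℝ → ℂ := fun z u => (u : ℂ) ^ n * q (c + (u : ℂ) ^ 2 * (z - c)) with hG
  set G' : ℂ → ℝ → ℂ := fun z u => (u : ℂ) ^ n * (deriv q (c + (u : ℂ) ^ 2 * (z - c)) * (u : ℂ) ^ 2)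
    with hG'
  have hq' : DifferentiableOn ℂ (deriv q) (Metric.ball c R) := hq.deriv Metric.isOpen_ball
  have hmem : ∀ r, ∀ z ∈ Metric.closedBall c r, ∀ u ∈ Icc (0 : ℝ) 1,
      c + (u : ℂ) ^ 2 * (z - c) ∈ Metric.closedBall c r := by
    intro r z hz u hu
    rw [mem_closedBall_iff_norm] at hz ⊢
    rw [add_sub_cancel_left, norm_mul, norm_pow, Complex.norm_real, Real.norm_of_nonneg hu.1]
    calc u ^ 2 * ‖z - c‖ ≤ 1 * ‖z - c‖ := by
          gcongr
          exact pow_le_one₀ hu.1 hu.2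
      _ ≤ r := by rw [one_mul]; exact hz
  have hmem' : ∀ z ∈ Metric.ball c R, ∀ u ∈ Icc (0 : ℝ) 1,
      c + (u : ℂ) ^ 2 * (z - c) ∈ Metric.ball c R := fun z hz u hu =>
    lt_of_le_of_lt (Metric.mem_closedBall.1 (hmem (dist z c) z (by simp) u hu)) hz
  have hcont : ∀ g : ℂ → ℂ, ContinuousOn g (Metric.ball c R) → ∀ z ∈ Metric.ball c R,
      ContinuousOn (fun u : ℝ => g (c + (u : ℂ) ^ 2 * (z - c))) (Icc 0 1) := fun g hg z hz =>
    hg.comp (by fun_prop) (hmem' z hz)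
  have hGc : ∀ z ∈ Metric.ball c R, ContinuousOn (G z) (Icc 0 1) := fun z hz =>
    ContinuousOn.mul (by fun_prop) (hcont q hq.continuousOn z hz)
  have hGc' : ∀ z ∈ Metric.ball c R, ContinuousOn (G' z) (Icc 0 1) := fun z hz =>
    ContinuousOn.mul (by fun_prop) ((hcont _ hq'.continuousOn z hz).mul (by fun_prop))
  have huIoc : uIoc (0 : ℝ) 1 = Ioc 0 1 := uIoc_of_le zero_le_one
  have huIcc : uIcc (0 : ℝ) 1 = Icc 0 1 := uIcc_of_le zero_le_one
  have hG1 : ∀ z ∈ Metric.ball c R, ∀ u ∈ Icc (0 : ℝ) 1,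
      HasDerivAt (fun z => G z u) (G' z u) z := by
    intro z hz u hu
    have h1 : HasDerivAt q (deriv q (c + (u : ℂ) ^ 2 * (z - c))) (c + (u : ℂ) ^ 2 * (z - c)) :=
      (hq.differentiableAt (Metric.isOpen_ball.mem_nhds (hmem' z hz u hu))).hasDerivAt
    have h2 : HasDerivAt (fun z => c + (u : ℂ) ^ 2 * (z - c)) ((u : ℂ) ^ 2) z := by
      simpa using (((hasDerivAt_id z).sub_const c).const_mul ((u : ℂ) ^ 2)).const_add c
    exact (h1.comp z h2).const_mul _
  have hder : ∀ z ∈ Metric.ball c R,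
      HasDerivAt (fun z => ∫ u in (0 : ℝ)..1, G z u) (∫ u in (0 : ℝ)..1, G' z u) z := by
    intro z hz
    obtain ⟨r, hr1, hr2⟩ := exists_between (Metric.mem_ball.1 hz)
    have hcb : Metric.closedBall c r ⊆ Metric.ball c R := Metric.closedBall_subset_ball hr2
    obtain ⟨M, hM⟩ := (isCompact_closedBall c r).exists_bound_of_continuousOn
      (hq'.continuousOn.mono hcb)
    refine (intervalIntegral.hasDerivAt_integral_of_dominated_loc_of_deriv_le (𝕜 := ℂ)
      (s := Metric.ball c r) (bound := fun _ => M) (F' := G') (Metric.isOpen_ball.mem_nhds hr1)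
      ?_ ?_ ?_ ?_ ?_ ?_).2
    · filter_upwards [Metric.isOpen_ball.mem_nhds hz] with y hy
      rw [huIoc]
      exact ((hGc y hy).mono Ioc_subset_Icc_self).aestronglyMeasurable measurableSet_Ioc
    · exact ContinuousOn.intervalIntegrable (by rw [huIcc]; exact hGc z hz)
    · rw [huIoc]
      exact ((hGc' z hz).mono Ioc_subset_Icc_self).aestronglyMeasurable measurableSet_Ioc
    · refine Eventually.of_forall fun u hu x hx => ?_
      rw [huIoc] at hu
      have hu' := Ioc_subset_Icc_self hu
      have hb := hM _ (hmem r x (Metric.ball_subset_closedBall hx) u hu')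
      have hn : ‖(u : ℂ)‖ ≤ 1 := by
        rw [Complex.norm_real, Real.norm_of_nonneg hu'.1]; exact hu'.2
      simp only [hG', norm_mul, norm_pow]
      calc ‖(u : ℂ)‖ ^ n * (‖deriv q (c + (u : ℂ) ^ 2 * (x - c))‖ * ‖(u : ℂ)‖ ^ 2)
          ≤ 1 * (‖deriv q (c + (u : ℂ) ^ 2 * (x - c))‖ * 1) := by
            gcongr
            · exact pow_le_one₀ (norm_nonneg _) hn
            · exact pow_le_one₀ (norm_nonneg _) hn
        _ ≤ M := by simpa using hb
    · simp
    · refine Eventually.of_forall fun u hu x hx => ?_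
      rw [huIoc] at hu
      exact hG1 x (hcb (Metric.ball_subset_closedBall hx)) u (Ioc_subset_Icc_self hu)
  refine ⟨fun z => ∫ u in (0 : ℝ)..1, G z u,
    fun z hz => (hder z hz).differentiableAt.differentiableWithinAt, fun z hz => ?_⟩
  rw [(hder z hz).deriv]
  have hi : IntervalIntegrable (G z) volume 0 1 :=
    ContinuousOn.intervalIntegrable (by rw [huIcc]; exact hGc z hz)
  have hi' : IntervalIntegrable (G' z) volume 0 1 :=
    ContinuousOn.intervalIntegrable (by rw [huIcc]; exact hGc' z hz)
  have hftc : ∀ u ∈ uIcc (0 : ℝ) 1, HasDerivAt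
      (fun u : ℝ => (u : ℂ) ^ (n + 1) * q (c + (u : ℂ) ^ 2 * (z - c)))
      ((n + 1) * G z u + 2 * (z - c) * G' z u) u := by
    intro u hu
    rw [huIcc] at hu
    have h1 : HasDerivAt q (deriv q (c + (u : ℂ) ^ 2 * (z - c))) (c + (u : ℂ) ^ 2 * (z - c)) :=
      (hq.differentiableAt (Metric.isOpen_ball.mem_nhds (hmem' z hz u hu))).hasDerivAt
    have h2 : HasDerivAt (fun v : ℂ => c + v ^ 2 * (z - c)) (2 * u * (z - c)) (u : ℂ) := by
      simpa using (((hasDerivAt_id (u : ℂ)).pow 2).mul_const (z - c)).const_add c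
    have h3 : HasDerivAt (fun v : ℂ => v ^ (n + 1)) ((n + 1) * (u : ℂ) ^ n) (u : ℂ) := by
      simpa using hasDerivAt_pow (n + 1) (u : ℂ)
    have h4 := (h3.mul (h1.comp (u : ℂ) h2)).comp_ofReal
    refine h4.congr_deriv ?_
    simp only [hG, hG', Function.comp_apply]
    ring
  have := intervalIntegral.integral_eq_sub_of_hasDerivAt hftc
    ((hi.const_mul _).add (hi'.const_mul _))
  rw [intervalIntegral.integral_add (hi.const_mul _) (hi'.const_mul _),
    intervalIntegral.integral_const_mul, intervalIntegral.integral_const_mul] at this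
  rw [this]
  simp

/-- Near a point where it does not vanish, a holomorphic function has holomorphic powers with a
rational exponent. -/
lemma exists_root_near {g : ℂ → ℂ} {c : ℂ} (hg : AnalyticAt ℂ g c) (h0 : g c ≠ 0) {m : ℕ}
    (hm : 0 < m) : ∃ q : ℂ → ℂ, AnalyticAt ℂ q c ∧ q c ≠ 0 ∧ ∀ᶠ z in 𝓝 c, q z ^ m = g z := by
  obtain ⟨e, he⟩ := IsAlgClosed.exists_pow_nat_eq (g c) hm
  have hm0 : (m : ℂ) ≠ 0 := Nat.cast_ne_zero.2 hm.ne'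
  have hslit : (g c / g c) ∈ Complex.slitPlane := by rw [div_self h0]; exact Complex.one_mem_slitPlane
  have hd : AnalyticAt ℂ (fun z => g z / g c) c := hg.div analyticAt_const h0
  refine ⟨fun z => e * Complex.exp (Complex.log (g z / g c) / m),
    analyticAt_const.mul (((hd.clog hslit).div analyticAt_const hm0).cexp), ?_, ?_⟩
  · refine mul_ne_zero (fun h => h0 ?_) (Complex.exp_ne_zero _)
    rw [← he, h, zero_pow hm.ne']
  · filter_upwards [hg.continuousAt.eventually_ne h0] with z hz
    rw [mul_pow, he, ← Complex.exp_nat_mul, mul_div_cancel₀ _ hm0, Complex.exp_log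
      (div_ne_zero hz h0), mul_div_cancel₀ _ h0]

/-- The normal form of a quadratic differential at a zero of odd order. -/
theorem exists_normalForm {ω : ℂ → ℂ} {z₀ : ℂ} {k : ℕ} (hω : AnalyticAt ℂ ω z₀)
    (hord : analyticOrderAt ω z₀ = ((2 * k + 1 : ℕ) : ℕ∞)) {U : Set ℂ} (hU : U ∈ 𝓝 z₀) :
    ∃ (R : ℝ) (Φ : ℂ → ℂ), 0 < R ∧ DifferentiableOn ℂ Φ (Metric.ball 0 R) ∧
      InjOn Φ (Metric.ball 0 R) ∧ MapsTo Φ (Metric.ball 0 R) U ∧ Φ 0 = z₀ ∧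
      ∀ ζ ∈ Metric.ball (0 : ℂ) R, deriv Φ ζ ≠ 0 ∧
        4 * ω (Φ ζ) * deriv Φ ζ ^ 2 = (2 * k + 3) ^ 2 * ζ ^ (2 * k + 1) := by
  obtain ⟨g, hg, hg0, hωg⟩ := hω.analyticOrderAt_eq_natCast.1 hord
  obtain ⟨q, hq, hq0, hqg⟩ := exists_root_near hg hg0 (m := 2) (by norm_num)
  obtain ⟨R₁, hR₁, hqd⟩ : ∃ R₁ > 0, DifferentiableOn ℂ q (Metric.ball z₀ R₁) := by
    obtain ⟨R₁, h1, h2⟩ := hq.exists_ball_analyticOnNhd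
    exact ⟨R₁, h1, h2.differentiableOn⟩
  -- With `ω = (z - z₀)^(2k+1) q²`, a primitive of `√ω` is sought as `2 (z - z₀)^(k + 3/2) P`.
  -- Differentiation leaves the Euler equation `(2k + 3) P + 2 (z - z₀) P' = q`, whence the
  -- parameter `2k + 2`. The new coordinate satisfies `Ψ^(2k+3) = (z - z₀)^(2k+3) · 4 P²`, and `E`
  -- is the root of the last factor.
  obtain ⟨P, hPd, hPq⟩ := exists_eulerEquation_solution (2 * k + 2) hqd
  have hPa : AnalyticAt ℂ P z₀ :=
    hPd.analyticAt (Metric.isOpen_ball.mem_nhds (Metric.mem_ball_self hR₁))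
  have hP0 : P z₀ ≠ 0 := by
    intro h
    have := hPq z₀ (Metric.mem_ball_self hR₁)
    rw [h] at this
    simp at this
    exact hq0 this.symm
  obtain ⟨E, hE, hE0, hEP⟩ := exists_root_near (g := fun z => 4 * P z ^ 2) (c := z₀)
    (analyticAt_const.mul (hPa.pow 2)) (mul_ne_zero (by norm_num) (pow_ne_zero 2 hP0)) (m := 2 * k + 3) (by positivity)
  set Ψ : ℂ → ℂ := fun z => (z - z₀) * E z with hΨ
  have hΨa : AnalyticAt ℂ Ψ z₀ := (analyticAt_id.sub analyticAt_const).mul hE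
  have hΨ' : HasDerivAt Ψ (E z₀) z₀ := by
    have := ((hasDerivAt_id z₀).sub_const z₀).mul hE.differentiableAt.hasDerivAt
    simp only [id, sub_self, zero_mul, add_zero, one_mul] at this
    exact this
  have hΨs : HasStrictDerivAt Ψ (E z₀) z₀ := by
    have := (hΨa.contDiffAt (n := 1)).hasStrictDerivAt (by simp)
    rwa [hΨ'.deriv] at this
  set e := (hΨs.hasStrictFDerivAt_equiv hE0).toOpenPartialHomeomorph Ψ with he
  have hsource : e.source ∈ 𝓝 z₀ := e.open_source.mem_nhds
    (hΨs.hasStrictFDerivAt_equiv hE0).mem_toOpenPartialHomeomorph_source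
  have hinj : InjOn Ψ e.source := e.injOn
  have hΨ0 : Ψ z₀ = 0 := by simp [hΨ]
  have hderivne : ∀ᶠ z in 𝓝 z₀, deriv Ψ z ≠ 0 := by
    refine hΨa.deriv.continuousAt.eventually_ne ?_
    rw [hΨ'.deriv]; exact hE0
  -- the differential equation of the inverse map
  have hode : ∀ᶠ z in 𝓝 z₀, (2 * k + 3) ^ 2 * Ψ z ^ (2 * k + 1) * deriv Ψ z ^ 2 = 4 * ω z := by
    filter_upwards [hωg, hqg, hEP.eventually_nhds, hΨa.eventually_analyticAt,
      hE.continuousAt.eventually_ne hE0, Metric.isOpen_ball.mem_nhds (Metric.mem_ball_self hR₁)] with z h1 h2 h3 h4 h6 h5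
    rcases eq_or_ne z z₀ with rfl | hz
    · rw [hΨ0, h1]; simp
    have hpow : ∀ᶠ y in 𝓝 z, Ψ y ^ (2 * k + 3) = (y - z₀) ^ (2 * k + 3) * (4 * P y ^ 2) := by
      filter_upwards [h3] with y hy
      rw [← hy, ← mul_pow]
    have hPz : HasDerivAt P (deriv P z) z :=
      (hPd.differentiableAt (Metric.isOpen_ball.mem_nhds h5)).hasDerivAt
    have d1 : HasDerivAt (fun y => Ψ y ^ (2 * k + 3)) _ z :=
      (h4.differentiableAt.hasDerivAt).pow (2 * k + 3)
    have d2 : HasDerivAt (fun y => (y - z₀) ^ (2 * k + 3) * (4 * P y ^ 2)) _ z :=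
      (((hasDerivAt_id z).sub_const z₀).pow (2 * k + 3)).mul ((hPz.pow 2).const_mul 4)
    have hd := d1.unique (d2.congr_of_eventuallyEq hpow)
    have hq2 := hPq z h5
    have hv := hpow.self_of_nhds
    simp only [id] at hd
    push_cast at hd hq2
    have hd' : (2 * k + 3) * Ψ z ^ (2 * k + 2) * deriv Ψ z =
        4 * (z - z₀) ^ (2 * k + 2) * P z * q z := by
      rw [← hq2]
      rw [hd]
      simp only [Pi.pow_apply]
      ring
    have hΨz : Ψ z ≠ 0 := mul_ne_zero (sub_ne_zero.2 hz) h6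
    have hc : Ψ z ^ (2 * k + 3) ≠ 0 := pow_ne_zero _ hΨz
    -- After multiplication by `Ψ^(2k+3)` the left side is the square of that of `hd'`, so only
    -- integral powers occur.
    refine mul_right_cancel₀ hc ?_
    calc (2 * k + 3) ^ 2 * Ψ z ^ (2 * k + 1) * deriv Ψ z ^ 2 * Ψ z ^ (2 * k + 3)
        = ((2 * k + 3) * Ψ z ^ (2 * k + 2) * deriv Ψ z) ^ 2 := by ring
      _ = 4 * ((z - z₀) ^ (2 * k + 1) * q z ^ 2) * ((z - z₀) ^ (2 * k + 3) * (4 * P z ^ 2)) := by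
          rw [hd']; ring
      _ = _ := by rw [h2, ← hv, h1, smul_eq_mul]
  obtain ⟨N, hNsub, hNo, hzN⟩ := mem_nhds_iff.1 (inter_mem (inter_mem hU hsource)
    (inter_mem hderivne (inter_mem hode hΨa.eventually_analyticAt)))
  have hΨd : DifferentiableOn ℂ Ψ N := fun z hz =>
    (hNsub hz).2.2.2.differentiableAt.differentiableWithinAt
  obtain ⟨hopen, Φ, hΦ, hl⟩ := exists_holomorphic_inverse hNo hΨd
    (hinj.mono fun z hz => (hNsub hz).1.2) fun z hz => (hNsub hz).2.1
  have h0mem : (0 : ℂ) ∈ Ψ '' N := ⟨z₀, hzN, hΨ0⟩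
  obtain ⟨R, hR, hball⟩ := Metric.isOpen_iff.1 hopen 0 h0mem
  refine ⟨R, Φ, hR, hΦ.mono hball, ?_, ?_, ?_, ?_⟩
  · intro a ha b hb hab
    obtain ⟨a', ha', rfl⟩ := hball ha
    obtain ⟨b', hb', rfl⟩ := hball hb
    rw [hl a' ha', hl b' hb'] at hab
    rw [hab]
  · intro a ha
    obtain ⟨a', ha', rfl⟩ := hball ha
    rw [hl a' ha']
    exact (hNsub ha').1.1
  · rw [← hΨ0, hl z₀ hzN]
  · intro a ha
    obtain ⟨w, hw, rfl⟩ := hball ha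
    have h1 : HasDerivAt Φ (deriv Φ (Ψ w)) (Ψ w) :=
      (hΦ.differentiableAt (hopen.mem_nhds (mem_image_of_mem Ψ hw))).hasDerivAt
    have h2 : HasDerivAt Ψ (deriv Ψ w) w := (hΨd.differentiableAt (hNo.mem_nhds hw)).hasDerivAt
    have h3 : deriv Φ (Ψ w) * deriv Ψ w = 1 := by
      refine (h1.comp w h2).unique ((hasDerivAt_id w).congr_of_eventuallyEq ?_)
      filter_upwards [hNo.mem_nhds hw] with y hy using hl y hy
    refine ⟨left_ne_zero_of_mul_eq_one h3, ?_⟩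
    have h4 : (2 * (k : ℂ) + 3) ^ 2 * Ψ w ^ (2 * k + 1) * deriv Ψ w ^ 2 = 4 * ω w := (hNsub hw).2.2.1
    rw [hl w hw, ← h4]
    linear_combination ((2 * (k : ℂ) + 3) ^ 2 * Ψ w ^ (2 * k + 1) *
      (deriv Φ (Ψ w) * deriv Ψ w + 1)) * h3

/-! ### Sectors: the branches of `w ↦ w^(2/(2k+3))`. -/

/-- The branch number `j` of `w ↦ w ^ (2 / (2 k + 3))`. -/
noncomputable def sectorMap (k : ℕ) (j : ℤ) (w : ℂ) : ℂ :=
  Complex.exp (2 / (2 * k + 3) * (Real.pi * j * Complex.I + Complex.log w))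

lemma two_mul_add_three_ne_zero (k : ℕ) : (2 * (k : ℂ) + 3) ≠ 0 := by
  have : ((2 * k + 3 : ℕ) : ℂ) ≠ 0 := Nat.cast_ne_zero.2 (by omega)
  push_cast at this
  exact this

lemma sectorMap_pow (k : ℕ) (j : ℤ) {w : ℂ} (hw : w ≠ 0) :
    sectorMap k j w ^ (2 * k + 3) = w ^ 2 := by
  have h1 : ((2 * k + 3 : ℕ) : ℂ) * (2 / (2 * k + 3) *
      (Real.pi * j * Complex.I + Complex.log w)) =
      j * (2 * Real.pi * Complex.I) + ((2 : ℕ) : ℂ) * Complex.log w := by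
    have := two_mul_add_three_ne_zero k
    push_cast
    field_simp
  rw [sectorMap, ← Complex.exp_nat_mul, h1, Complex.exp_add, Complex.exp_int_mul_two_pi_mul_I,
    one_mul, Complex.exp_nat_mul, Complex.exp_log hw]

lemma norm_sectorMap_pow (k : ℕ) (j : ℤ) {w : ℂ} (hw : w ≠ 0) :
    ‖sectorMap k j w‖ ^ (2 * k + 3) = ‖w‖ ^ 2 := by
  rw [← norm_pow, sectorMap_pow k j hw, norm_pow]

lemma sectorMap_periodic (k : ℕ) (j : ℤ) (w : ℂ) :
    sectorMap k (j + (2 * k + 3 : ℕ)) w = sectorMap k j w := by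
  have h1 : 2 / (2 * (k : ℂ) + 3) * (Real.pi * ((j + (2 * k + 3 : ℕ) : ℤ) : ℂ) * Complex.I +
      Complex.log w) = 2 / (2 * k + 3) * (Real.pi * j * Complex.I + Complex.log w) +
      2 * Real.pi * Complex.I := by
    have := two_mul_add_three_ne_zero k
    push_cast
    field_simp
    ring
  rw [sectorMap, h1, Complex.exp_periodic, sectorMap]

/-- On the upper half plane `log (-w) = log w - π i`, and the branch index adds the `π i` back.
Adjacent charts overlap through `w ↦ -w`, the source of the alternation of signs. -/
lemma sectorMap_succ_neg (k : ℕ) (j : ℤ) {w : ℂ} (hw : 0 < w.im) :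
    sectorMap k (j + 1) (-w) = sectorMap k j w := by
  have h1 : Complex.log (-w) = Complex.log w - Real.pi * Complex.I := by
    rw [Complex.log, Complex.log, norm_neg, Complex.arg_neg_eq_arg_sub_pi_of_im_pos hw]
    push_cast; ring
  rw [sectorMap, sectorMap, h1]
  congr 1
  push_cast; ring

lemma hasDerivAt_sectorMap (k : ℕ) (j : ℤ) {w : ℂ} (hw : w ∈ Complex.slitPlane) :
    HasDerivAt (sectorMap k j) (sectorMap k j w * (2 / (2 * k + 3) * w⁻¹)) w :=
  (((Complex.hasDerivAt_log hw).const_add _).const_mul _).cexp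

/-- The exponent `2/(2k+3)` is at most 1, so the scaled logarithm keeps its imaginary part in the
strip where `exp` is injective. -/
lemma injOn_sectorMap (k : ℕ) (j : ℤ) : InjOn (sectorMap k j) Complex.slitPlane := by
  intro w hw w' hw' h
  have hk := two_mul_add_three_ne_zero k
  set b : ℂ := 2 / (2 * k + 3) with hb
  have hb' : b = ((2 / (2 * k + 3) : ℝ) : ℂ) := by rw [hb]; push_cast; rfl
  have hb0 : b ≠ 0 := div_ne_zero (by norm_num) hk
  have h2 : Complex.exp (b * Complex.log w) = Complex.exp (b * Complex.log w') := by
    rw [sectorMap, sectorMap, mul_add, mul_add, Complex.exp_add, Complex.exp_add] at h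
    exact mul_left_cancel₀ (Complex.exp_ne_zero _) h
  have hpos : (0 : ℝ) < 2 / (2 * k + 3) := by positivity
  have hle : (2 : ℝ) / (2 * k + 3) ≤ 1 := by
    rw [div_le_one (by positivity)]; linarith [(Nat.cast_nonneg k : (0 : ℝ) ≤ k)]
  have him : ∀ v ∈ Complex.slitPlane, -Real.pi < (b * Complex.log v).im ∧
      (b * Complex.log v).im ≤ Real.pi := by
    intro v hv
    rw [hb', Complex.im_ofReal_mul, Complex.log_im]
    have h1 : |v.arg| < Real.pi :=
      abs_lt.2 ⟨Complex.neg_pi_lt_arg v,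
        lt_of_le_of_ne (Complex.arg_le_pi v) (Complex.mem_slitPlane_iff_arg.1 hv).1⟩
    have h2 : |2 / (2 * (k : ℝ) + 3) * v.arg| < Real.pi := by
      rw [abs_mul, abs_of_pos hpos]
      nlinarith [abs_nonneg v.arg]
    exact ⟨(abs_lt.1 h2).1, (abs_lt.1 h2).2.le⟩
  have h3 := Complex.exp_inj_of_neg_pi_lt_of_le_pi (him w hw).1 (him w hw).2 (him w' hw').1
    (him w' hw').2 h2
  have h4 := mul_left_cancel₀ hb0 h3
  rw [← Complex.exp_log (Complex.slitPlane_ne_zero hw), h4,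
    Complex.exp_log (Complex.slitPlane_ne_zero hw')]

/-- Every nonzero `ζ` is in the closure of some sector, with its boundary ray in the upper half
plane of the coordinate. -/
lemma exists_sectorMap_eq (k : ℕ) {ζ : ℂ} (hζ : ζ ≠ 0) :
    ∃ (j : ℤ) (w : ℂ), w ≠ 0 ∧ sectorMap k j w = ζ ∧ (0 < w.re ∨ (w.re = 0 ∧ 0 < w.im)) := by
  have hk := two_mul_add_three_ne_zero k
  set a : ℝ := (2 * k + 3) / 2 * ζ.arg with ha
  -- The integer with `-π/2 < a - π j ≤ π/2`. The ceiling leaves the closed end at `π/2`, which puts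
  -- the boundary rays on the positive imaginary axis of the coordinate.
  set j : ℤ := ⌈a / Real.pi - 1 / 2⌉ with hj
  have hpi := Real.pi_pos
  have h1 : a - Real.pi * j ≤ Real.pi / 2 := by
    have := Int.le_ceil (a / Real.pi - 1 / 2)
    rw [← hj, sub_le_iff_le_add, div_le_iff₀ hpi] at this
    linarith
  have h2 : -(Real.pi / 2) < a - Real.pi * j := by
    have := Int.ceil_lt_add_one (a / Real.pi - 1 / 2)
    rw [← hj] at this
    have h3 : (j : ℝ) - 1 / 2 < a / Real.pi := by linarith
    rw [lt_div_iff₀ hpi] at h3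
    linarith
  set u : ℂ := (2 * k + 3) / 2 * Complex.log ζ - Real.pi * j * Complex.I with hu
  have huim : u.im = a - Real.pi * j := by
    have e : u = (((2 * k + 3) / 2 : ℝ) : ℂ) * Complex.log ζ - ((Real.pi * j : ℝ) : ℂ) * Complex.I := by
      rw [hu]; push_cast; rfl
    rw [e, Complex.sub_im, Complex.im_ofReal_mul, Complex.log_im, Complex.im_ofReal_mul]
    simp [ha]
  have hlog : Complex.log (Complex.exp u) = u :=
    Complex.log_exp (by rw [huim]; linarith) (by rw [huim]; linarith)
  refine ⟨j, Complex.exp u, Complex.exp_ne_zero _, ?_, ?_⟩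
  · rw [sectorMap, hlog, hu]
    have : 2 / (2 * (k : ℂ) + 3) * (Real.pi * j * Complex.I +
        ((2 * k + 3) / 2 * Complex.log ζ - Real.pi * j * Complex.I)) = Complex.log ζ := by
      field_simp
      ring
    rw [this, Complex.exp_log hζ]
  · rw [Complex.exp_re, Complex.exp_im, huim]
    rcases h1.lt_or_eq with h3 | h3
    · exact Or.inl (mul_pos (Real.exp_pos _) (Real.cos_pos_of_mem_Ioo ⟨h2, h3⟩))
    · right
      rw [h3, Real.cos_pi_div_two, Real.sin_pi_div_two]
      exact ⟨by simp, by simpa using Real.exp_pos _⟩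

/-- The unit vector on the ray between the sectors `j` and `j + 1`. -/
noncomputable def rayDirection (k : ℕ) (j : ℤ) : ℂ :=
  Complex.exp (2 / (2 * k + 3) * (Real.pi * j * Complex.I + Real.pi / 2 * Complex.I))

lemma norm_rayDirection (k : ℕ) (j : ℤ) : ‖rayDirection k j‖ = 1 := by
  have : 2 / (2 * (k : ℂ) + 3) * (Real.pi * j * Complex.I + Real.pi / 2 * Complex.I) =
      ((2 / (2 * k + 3) * (Real.pi * j + Real.pi / 2) : ℝ) : ℂ) * Complex.I := by
    push_cast; ring
  rw [rayDirection, this, Complex.norm_exp_ofReal_mul_I]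

lemma sectorMap_mul_I (k : ℕ) (j : ℤ) {τ : ℝ} (hτ : 0 < τ) :
    sectorMap k j (τ * Complex.I) = ‖sectorMap k j (τ * Complex.I)‖ * rayDirection k j := by
  have h1 : Complex.log (τ * Complex.I) = Real.log τ + Real.pi / 2 * Complex.I := by
    rw [Complex.log_ofReal_mul hτ Complex.I_ne_zero, Complex.log_I]
  have h2 : sectorMap k j (τ * Complex.I) =
      ((Real.exp (2 / (2 * k + 3) * Real.log τ) : ℝ) : ℂ) * rayDirection k j := by
    rw [sectorMap, h1, rayDirection, Complex.ofReal_exp, ← Complex.exp_add]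
    congr 1
    push_cast; ring
  have h3 : ‖sectorMap k j (τ * Complex.I)‖ = Real.exp (2 / (2 * k + 3) * Real.log τ) := by
    rw [h2, norm_mul, norm_rayDirection, mul_one, Complex.norm_real,
      Real.norm_of_nonneg (Real.exp_pos _).le]
  rw [h3, ← h2]

lemma exists_sectorMap_mul_I (k : ℕ) (j : ℤ) {t : ℝ} (ht : 0 < t) :
    ∃ τ : ℝ, 0 < τ ∧ sectorMap k j (τ * Complex.I) = t * rayDirection k j := by
  refine ⟨Real.exp ((2 * k + 3) / 2 * Real.log t), Real.exp_pos _, ?_⟩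
  rw [sectorMap, Complex.log_ofReal_mul (Real.exp_pos _) Complex.I_ne_zero, Complex.log_I,
    Real.log_exp, rayDirection]
  have e : (t : ℂ) = Complex.exp (Real.log t) := by rw [← Complex.ofReal_exp, Real.exp_log ht]
  rw [e, ← Complex.exp_add]
  congr 1
  have := two_mul_add_three_ne_zero k
  push_cast
  field_simp
  ring

/-! ### The sign of `h` in each sector and the support of `μ`. -/

/-- A biholomorphism of a disc that brings the quadratic differential `ω dz²` to the form
`(d ζ ^ (k + 3 / 2))²`. -/
structure IsNormalForm (Ω : TopologicalSpace.Opens ℂ) (ω : ℂ → ℂ) (z₀ : ℂ) (k : ℕ) (R : ℝ)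
    (Φ : ℂ → ℂ) : Prop where
  pos : 0 < R
  differentiableOn : DifferentiableOn ℂ Φ (Metric.ball 0 R)
  injOn : InjOn Φ (Metric.ball 0 R)
  mapsTo : MapsTo Φ (Metric.ball 0 R) Ω
  map_zero : Φ 0 = z₀
  deriv_ne_zero : ∀ ζ ∈ Metric.ball (0 : ℂ) R, deriv Φ ζ ≠ 0
  eq : ∀ ζ ∈ Metric.ball (0 : ℂ) R,
    4 * ω (Φ ζ) * deriv Φ ζ ^ 2 = (2 * k + 3) ^ 2 * ζ ^ (2 * k + 1)

namespace IsNormalForm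

variable {Ω : TopologicalSpace.Opens ℂ} {ω Φ : ℂ → ℂ} {z₀ : ℂ} {k : ℕ} {R : ℝ}

lemma continuousAt (hΦ : IsNormalForm Ω ω z₀ k R Φ) {ζ : ℂ} (hζ : ζ ∈ Metric.ball (0 : ℂ) R) :
    ContinuousAt Φ ζ :=
  (hΦ.differentiableOn.differentiableAt (Metric.isOpen_ball.mem_nhds hζ)).continuousAt

lemma sectorMap_mem_ball {ρ : ℝ} (hρ : ρ ^ 2 ≤ R ^ (2 * k + 3)) (hR : 0 < R) (j : ℤ) {w : ℂ}
    (hw0 : w ≠ 0) (hw : ‖w‖ < ρ) : sectorMap k j w ∈ Metric.ball (0 : ℂ) R := by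
  rw [mem_ball_zero_iff]
  refine lt_of_pow_lt_pow_left₀ (2 * k + 3) hR.le ?_
  rw [norm_sectorMap_pow k j hw0]
  exact (pow_lt_pow_left₀ hw (norm_nonneg _) (by norm_num)).trans_le hρ

/-- The sectors of a normal form are natural charts. -/
lemma isNaturalChart (hΦ : IsNormalForm Ω ω z₀ k R Φ) {ρ : ℝ} (hρ : ρ ^ 2 ≤ R ^ (2 * k + 3))
    (j : ℤ) : IsNaturalChart Ω ω (Φ ∘ sectorMap k j) (Complex.slitPlane ∩ Metric.ball 0 ρ) := by
  have hmem : ∀ w ∈ Complex.slitPlane ∩ Metric.ball 0 ρ, sectorMap k j w ∈ Metric.ball (0 : ℂ) R :=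
    fun w hw => sectorMap_mem_ball hρ hΦ.pos j (Complex.slitPlane_ne_zero hw.1)
      (mem_ball_zero_iff.1 hw.2)
  have hd : ∀ w ∈ Complex.slitPlane ∩ Metric.ball 0 ρ, HasDerivAt (Φ ∘ sectorMap k j)
      (deriv Φ (sectorMap k j w) * (sectorMap k j w * (2 / (2 * k + 3) * w⁻¹))) w := fun w hw =>
    ((hΦ.differentiableOn.differentiableAt (Metric.isOpen_ball.mem_nhds (hmem w hw))).hasDerivAt).comp
      w (hasDerivAt_sectorMap k j hw.1)
  refine ⟨Complex.isOpen_slitPlane.inter Metric.isOpen_ball,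
    fun w hw => (hd w hw).differentiableAt.differentiableWithinAt,
    hΦ.injOn.comp ((injOn_sectorMap k j).mono inter_subset_left) hmem,
    fun w hw => hΦ.mapsTo (hmem w hw), fun w hw => ?_⟩
  have hw0 := Complex.slitPlane_ne_zero hw.1
  rw [(hd w hw).deriv, Function.comp_apply]
  have h1 := hΦ.eq _ (hmem w hw)
  have h2 := sectorMap_pow k j hw0
  have hk := two_mul_add_three_ne_zero k
  set G := sectorMap k j w
  calc ω (Φ G) * (deriv Φ G * (G * (2 / (2 * k + 3) * w⁻¹))) ^ 2
      = (4 * ω (Φ G) * deriv Φ G ^ 2) * G ^ 2 / ((2 * k + 3) ^ 2 * w ^ 2) := by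
        field_simp
        ring
    _ = (2 * k + 3) ^ 2 * G ^ (2 * k + 3) / ((2 * k + 3) ^ 2 * w ^ 2) := by rw [h1]; ring
    _ = 1 := by
        rw [h2]
        exact div_self (mul_ne_zero (pow_ne_zero 2 hk) (pow_ne_zero 2 hw0))

variable {μ : SignedRadonMeasure Ω} {h : ℂ → ℝ}

/-- In each sector, near the vertex, `h` is `±` the real part of the natural coordinate. -/
lemma exists_sign (hΦ : IsNormalForm Ω ω z₀ k R Φ) (hS : IsStationarySolution μ h ω)
    (h0 : h z₀ = 0) (j : ℤ) : ∃ s₀ : ℝ, 0 < s₀ ∧ ∃ ε : ℝ, (ε = 1 ∨ ε = -1) ∧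
      ∀ w : ℂ, 0 < w.re → ‖w‖ < s₀ → h (Φ (sectorMap k j w)) = ε * w.re := by
  set ρ := √(R ^ (2 * k + 3)) with hρdef
  have hRpos : 0 < R ^ (2 * k + 3) := pow_pos hΦ.pos _
  have hρ2 : ρ ^ 2 = R ^ (2 * k + 3) := Real.sq_sqrt hRpos.le
  have hρ : 0 < ρ := Real.sqrt_pos.2 hRpos
  have hF := hΦ.isNaturalChart hρ2.le j
  set F := Φ ∘ sectorMap k j with hFdef
  set D := Complex.slitPlane ∩ Metric.ball (0 : ℂ) ρ with hD
  have hball : ∀ w : ℂ, |w.re| ≤ ρ / 2 → |w.im| ≤ ρ / 2 → w ∈ Metric.ball (0 : ℂ) ρ := by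
    intro w h1 h2
    rw [mem_ball_zero_iff]
    refine lt_of_pow_lt_pow_left₀ 2 hρ.le ?_
    rw [Complex.sq_norm, Complex.normSq_apply]
    nlinarith [abs_le.1 h1, abs_le.1 h2, sq_abs w.re, sq_abs w.im, abs_nonneg w.re, abs_nonneg w.im]
  set x : ℕ → ℝ := fun i => ρ / 2 * (1 / (i + 1)) with hx
  have hxpos : ∀ i, 0 < x i := fun i => by positivity
  have hxle : ∀ i, x i ≤ ρ / 2 := fun i => by
    have : (1 : ℝ) / (i + 1) ≤ 1 := by
      rw [div_le_one (by positivity)]; linarith [(Nat.cast_nonneg i : (0 : ℝ) ≤ i)]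
    exact mul_le_of_le_one_right (by positivity) this
  have hxlim : Tendsto x atTop (𝓝 0) := by
    have := (tendsto_one_div_add_atTop_nhds_zero_nat (𝕜 := ℝ)).const_mul (ρ / 2)
    rw [mul_zero] at this
    exact this
  have hxanti : Antitone x := fun i i' hii => by
    simp only [hx]
    gcongr
  have hQ : ∀ i, Ioo 0 (x i) ×ℂ Ioo (-(ρ / 2)) (ρ / 2) ⊆ D := by
    intro i w hw
    have hw1 : w.re ∈ Ioo 0 (x i) := hw.1
    have hw2 : w.im ∈ Ioo (-(ρ / 2)) (ρ / 2) := hw.2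
    refine ⟨Or.inl hw1.1, hball w ?_ ?_⟩
    · rw [abs_of_pos hw1.1]; exact hw1.2.le.trans (hxle i)
    · exact abs_le.2 ⟨hw2.1.le, hw2.2.le⟩
  have hIsub : Icc (ρ / 8) (ρ / 4) ⊆ Ioo (-(ρ / 2)) (ρ / 2) := fun y hy =>
    ⟨by linarith [hy.1], by linarith [hy.2]⟩
  -- These strips shrink to the empty set inside one compact subset of the chart: the chart contains
  -- the positive imaginary axis, and the height stays away from the vertex. Their mass thus tends
  -- to zero and falls below `ρ/4 - ρ/8`; affinity then holds on the rectangle of full height, which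
  -- reaches the vertex.
  set A : ℕ → Set ℂ := fun i => Ioo 0 (x i) ×ℂ Ioo (ρ / 8) (ρ / 4) with hA
  have hAD : ∀ i, A i ⊆ D := fun i w hw => hQ i ⟨hw.1, hIsub (Ioo_subset_Icc_self hw.2)⟩
  have hK : Icc 0 (ρ / 2) ×ℂ Icc (ρ / 8) (ρ / 4) ⊆ D := by
    intro w hw
    have hw1 : w.re ∈ Icc 0 (ρ / 2) := hw.1
    have hw2 : w.im ∈ Icc (ρ / 8) (ρ / 4) := hw.2
    refine ⟨Or.inr (by linarith [hw2.1] : (0 : ℝ) < w.im).ne', hball w ?_ ?_⟩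
    · rw [abs_of_nonneg hw1.1]; exact hw1.2
    · rw [abs_of_nonneg (by linarith [hw2.1])]; linarith [hw2.2]
  have hfin : μ.totalVariation (F '' A 0) ≠ ⊤ := by
    have hc : IsCompact (F '' (Icc 0 (ρ / 2) ×ℂ Icc (ρ / 8) (ρ / 4))) :=
      (isCompact_Icc.reProdIm isCompact_Icc).image_of_continuousOn
        (hF.differentiableOn.continuousOn.mono hK)
    refine ne_top_of_le_ne_top
      (μ.totalVariation_lt_top hc (image_subset_iff.2 (hF.mapsTo.mono_left hK))).ne
      (measure_mono (image_mono ?_))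
    intro w hw
    have hw1 : w.re ∈ Ioo 0 (x 0) := hw.1
    exact ⟨⟨hw1.1.le, hw1.2.le.trans (hxle 0)⟩, Ioo_subset_Icc_self hw.2⟩
  have hlim : Tendsto (fun i => μ.totalVariation (F '' A i)) atTop (𝓝 0) := by
    have hempty : ⋂ i, F '' A i = ∅ := by
      refine eq_empty_iff_forall_notMem.2 fun z hz => ?_
      rw [mem_iInter] at hz
      obtain ⟨w, hw, rfl⟩ := hz 0
      have hlt : ∀ i, w.re ≤ x i := by
        intro i
        obtain ⟨w', hw', he⟩ := hz i
        rw [← hF.injOn (hAD i hw') (hAD 0 hw) he]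
        exact (hw'.1.2 : w'.re < x i).le
      exact absurd (ge_of_tendsto' hxlim hlt) (not_le.2 hw.1.1)
    have := tendsto_measure_iInter_atTop (μ := μ.totalVariation) (s := fun i => F '' A i)
      (fun i => ((hF.mono (isOpen_Ioo.reProdIm isOpen_Ioo) (hAD i)).isOpen_image).measurableSet.nullMeasurableSet)
      (fun i i' hii => image_mono fun w hw => ⟨⟨hw.1.1, hw.1.2.trans_le (hxanti hii)⟩, hw.2⟩)
      ⟨0, hfin⟩
    rwa [hempty, measure_empty] at this
  obtain ⟨i, hi⟩ := (hlim.eventually (gt_mem_nhds (ENNReal.ofReal_pos.2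
    (by linarith : 0 < ρ / 4 - ρ / 8)))).exists
  obtain ⟨ε, b, hε, hb⟩ := hF.exists_eq_affine hS (hQ i) (by linarith) hIsub hi
  -- Along the positive real axis of the chart the point tends to `z₀`, where `h` vanishes.
  have hb0 : b = 0 := by
    have hG : Tendsto (fun t : ℝ => sectorMap k j t) (𝓝[>] 0) (𝓝 0) := by
      rw [tendsto_zero_iff_norm_tendsto_zero]
      have hpow : Tendsto (fun t : ℝ => ‖sectorMap k j t‖ ^ (2 * k + 3)) (𝓝[>] 0) (𝓝 0) := by
        have : Tendsto (fun t : ℝ => t ^ 2) (𝓝[>] 0) (𝓝 0) := by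
          have := (continuous_pow 2 (M := ℝ)).tendsto 0
          simp only [ne_eq, OfNat.ofNat_ne_zero, not_false_eq_true, zero_pow] at this
          exact this.mono_left nhdsWithin_le_nhds
        refine this.congr' ?_
        filter_upwards [self_mem_nhdsWithin] with t ht
        have ht0 : (t : ℂ) ≠ 0 := Complex.ofReal_ne_zero.2 (ne_of_gt ht)
        rw [norm_sectorMap_pow k j ht0, Complex.norm_real, Real.norm_eq_abs, sq_abs]
      rw [Metric.tendsto_nhds] at hpow ⊢
      intro δ hδ
      filter_upwards [hpow (δ ^ (2 * k + 3)) (by positivity)] with t ht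
      rw [Real.dist_eq, sub_zero, abs_of_nonneg (by positivity)] at ht ⊢
      exact lt_of_pow_lt_pow_left₀ _ hδ.le ht
    have hcont : ContinuousAt h z₀ := by
      have hz : z₀ ∈ (Ω : Set ℂ) := by
        rw [← hΦ.map_zero]; exact hΦ.mapsTo (Metric.mem_ball_self hΦ.pos)
      exact hS.locallyLipschitz.continuousOn.continuousAt (Ω.isOpen.mem_nhds hz)
    have h1 : Tendsto (fun t : ℝ => h (F t)) (𝓝[>] 0) (𝓝 0) := by
      have hΦc : Tendsto Φ (𝓝 0) (𝓝 z₀) := by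
        have := hΦ.continuousAt (Metric.mem_ball_self hΦ.pos)
        rwa [ContinuousAt, hΦ.map_zero] at this
      have := hcont.tendsto.comp (hΦc.comp hG)
      rwa [h0] at this
    have h2 : Tendsto (fun t : ℝ => h (F t)) (𝓝[>] 0) (𝓝 (ε * 0 + b)) := by
      have : Tendsto (fun t : ℝ => ε * t + b) (𝓝[>] 0) (𝓝 (ε * 0 + b)) :=
        (Continuous.tendsto (by fun_prop) 0).mono_left nhdsWithin_le_nhds
      refine this.congr' ?_
      filter_upwards [Ioo_mem_nhdsGT (hxpos i)] with t ht
      rw [hb (t : ℂ) ⟨by simpa using ht, by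
        simp only [mem_preimage, Complex.ofReal_im]; exact ⟨by linarith, by linarith⟩⟩]
      simp
    have := tendsto_nhds_unique h2 h1
    simpa using this
  refine ⟨x i, hxpos i, ε, hε, fun w hw1 hw2 => ?_⟩
  have hre := (Complex.abs_re_le_norm w).trans_lt hw2
  have him := (Complex.abs_im_le_norm w).trans_lt hw2
  rw [abs_lt] at hre him
  have := hb w ⟨⟨hw1, hre.2⟩, ⟨by linarith [hxle i], by linarith [hxle i]⟩⟩
  rw [hb0, add_zero] at this
  exact this

end IsNormalForm

namespace IsNormalForm

variable {Ω : TopologicalSpace.Opens ℂ} {ω Φ : ℂ → ℂ} {z₀ : ℂ} {k : ℕ} {R : ℝ}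
  {μ : SignedRadonMeasure Ω} {h : ℂ → ℝ}

/-- Only `2k + 3` branches are distinct, so finitely many radii have a common lower bound `s`.
Choosing signs for the residues of `j` makes `ε` periodic. -/
lemma exists_signs (hΦ : IsNormalForm Ω ω z₀ k R Φ) (hS : IsStationarySolution μ h ω)
    (h0 : h z₀ = 0) : ∃ s : ℝ, 0 < s ∧ s ^ 2 ≤ R ^ (2 * k + 3) ∧ ∃ ε : ℤ → ℝ,
      (∀ j, ε j = 1 ∨ ε j = -1) ∧ (∀ j, ε (j + (2 * k + 3 : ℕ)) = ε j) ∧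
      ∀ j, ∀ w : ℂ, 0 < w.re → ‖w‖ < s → h (Φ (sectorMap k j w)) = ε j * w.re := by
  choose s₀ hs₀ ε hε heq using hΦ.exists_sign hS h0
  have hev : ∀ᶠ s in 𝓝[>] (0 : ℝ), ∀ i : Fin (2 * k + 3), s < s₀ (i : ℤ) := by
    rw [eventually_all]
    exact fun i => nhdsWithin_le_nhds (gt_mem_nhds (hs₀ _))
  have hev2 : ∀ᶠ s in 𝓝[>] (0 : ℝ), s ^ 2 < R ^ (2 * k + 3) := by
    have := (continuous_pow 2 (M := ℝ)).tendsto 0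
    rw [zero_pow (by norm_num)] at this
    exact nhdsWithin_le_nhds (this.eventually (gt_mem_nhds (pow_pos hΦ.pos _)))
  obtain ⟨s, ⟨hs1, hs2⟩, hs⟩ := ((hev.and hev2).and self_mem_nhdsWithin).exists
  have hs : 0 < s := hs
  have hmod : ∀ (j : ℤ) (w : ℂ), sectorMap k (j % (2 * k + 3 : ℕ)) w = sectorMap k j w := by
    intro j w
    have hp : Function.Periodic (fun j => sectorMap k j w) ((2 * k + 3 : ℕ) : ℤ) := fun j =>
      sectorMap_periodic k j w
    rw [Int.emod_def, mul_comm, ← smul_eq_mul]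
    exact hp.sub_zsmul_eq _
  have hpos : (0 : ℤ) < (2 * k + 3 : ℕ) := by positivity
  refine ⟨s, hs, hs2.le, fun j => ε (j % (2 * k + 3 : ℕ)), fun j => hε _, fun j => by simp,
    fun j w hw hws => ?_⟩
  rw [← hmod]
  refine heq _ w hw (hws.trans ?_)
  have hnn := Int.emod_nonneg j hpos.ne'
  have hlt := Int.emod_lt_of_pos j hpos
  have := hs1 ⟨(j % (2 * k + 3 : ℕ)).toNat, by omega⟩
  simpa only [Int.toNat_of_nonneg hnn] using this

variable {s : ℝ} {ε : ℤ → ℝ}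

/-- By continuity, as the limit of `ε j * t` at `w + t` when `t` decreases to 0. -/
lemma eq_zero_on_ray (hΦ : IsNormalForm Ω ω z₀ k R Φ) (hS : IsStationarySolution μ h ω)
    (hs : s ^ 2 ≤ R ^ (2 * k + 3))
    (hε : ∀ j, ∀ w : ℂ, 0 < w.re → ‖w‖ < s → h (Φ (sectorMap k j w)) = ε j * w.re)
    (j : ℤ) {w : ℂ} (hre : w.re = 0) (him : w.im ≠ 0) (hw : ‖w‖ < s) :
    h (Φ (sectorMap k j w)) = 0 := by
  have hF := hΦ.isNaturalChart hs j
  have hwD : w ∈ Complex.slitPlane ∩ Metric.ball 0 s := ⟨Or.inr him, mem_ball_zero_iff.2 hw⟩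
  have hline : Tendsto (fun t : ℝ => w + t) (𝓝[>] 0) (𝓝 w) := by
    have : Tendsto (fun t : ℝ => w + t) (𝓝 0) (𝓝 (w + (0 : ℝ))) :=
      Continuous.tendsto (by fun_prop) 0
    rw [Complex.ofReal_zero, add_zero] at this
    exact this.mono_left nhdsWithin_le_nhds
  have hc : ContinuousAt (h ∘ (Φ ∘ sectorMap k j)) w :=
    (hF.locallyLipschitzOn hS).continuousOn.continuousAt (hF.isOpen.mem_nhds hwD)
  have h1 := hc.tendsto.comp hline
  have h2 : Tendsto (fun t : ℝ => ε j * t) (𝓝[>] 0) (𝓝 (ε j * 0)) :=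
    (Continuous.tendsto (by fun_prop) 0).mono_left nhdsWithin_le_nhds
  have h3 : Tendsto ((h ∘ (Φ ∘ sectorMap k j)) ∘ fun t : ℝ => w + t) (𝓝[>] 0) (𝓝 (ε j * 0)) := by
    refine h2.congr' ?_
    filter_upwards [self_mem_nhdsWithin, hline.eventually (hF.isOpen.mem_nhds hwD)] with t ht htD
    have hre' : (w + t).re = t := by simp [hre]
    have := hε j (w + t) (by rw [hre']; exact ht) (mem_ball_zero_iff.1 htD.2)
    rw [hre'] at this
    exact this.symm
  simpa using tendsto_nhds_unique h1 h3

lemma exists_coordinate (hs0 : 0 < s) {ζ : ℂ} (hζ0 : ζ ≠ 0) (hζ : ‖ζ‖ ^ (2 * k + 3) < s ^ 2) :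
    ∃ (j : ℤ) (w : ℂ), sectorMap k j w = ζ ∧ ‖w‖ < s ∧
      (0 < w.re ∨ (w.re = 0 ∧ 0 < w.im)) := by
  obtain ⟨j, w, hw0, hw, hre⟩ := exists_sectorMap_eq k hζ0
  refine ⟨j, w, hw, ?_, hre⟩
  rw [← hw, norm_sectorMap_pow k j hw0] at hζ
  exact lt_of_pow_lt_pow_left₀ 2 hs0.le hζ

/-- Up to sign, `h` is the real part of `ζ ^ (k + 3 / 2)`. -/
lemma abs_re_eq (hΦ : IsNormalForm Ω ω z₀ k R Φ) (hS : IsStationarySolution μ h ω)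
    (h0 : h z₀ = 0) (hs0 : 0 < s) (hs : s ^ 2 ≤ R ^ (2 * k + 3)) (hε1 : ∀ j, ε j = 1 ∨ ε j = -1)
    (hε : ∀ j, ∀ w : ℂ, 0 < w.re → ‖w‖ < s → h (Φ (sectorMap k j w)) = ε j * w.re)
    {ζ v : ℂ} (hζ : ‖ζ‖ ^ (2 * k + 3) < s ^ 2) (hv : v ^ 2 = ζ ^ (2 * k + 3)) :
    |v.re| = |h (Φ ζ)| := by
  rcases eq_or_ne ζ 0 with rfl | hζ0
  · rw [zero_pow (by omega), sq_eq_zero_iff] at hv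
    rw [hv, hΦ.map_zero, h0, Complex.zero_re]
  · obtain ⟨j, w, rfl, hws, hre⟩ := exists_coordinate hs0 hζ0 hζ
    have hw0 : w ≠ 0 := by
      rintro rfl
      simp at hre
    have h1 : |h (Φ (sectorMap k j w))| = |w.re| := by
      rcases hre with hre | ⟨hre, him⟩
      · rw [hε j w hre hws, abs_mul]
        rcases hε1 j with h | h <;> simp [h]
      · rw [hΦ.eq_zero_on_ray hS hs hε j hre him.ne' hws, hre]
    rw [sectorMap_pow k j hw0, sq_eq_sq_iff_eq_or_eq_neg] at hv
    rw [h1]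
    rcases hv with rfl | rfl
    · rfl
    · rw [Complex.neg_re, abs_neg]

lemma notMem_support_of_re_pos (hΦ : IsNormalForm Ω ω z₀ k R Φ) (hS : IsStationarySolution μ h ω)
    (hs : s ^ 2 ≤ R ^ (2 * k + 3))
    (hε : ∀ j, ∀ w : ℂ, 0 < w.re → ‖w‖ < s → h (Φ (sectorMap k j w)) = ε j * w.re)
    (j : ℤ) {w : ℂ} (hre : 0 < w.re) (hw : ‖w‖ < s) : Φ (sectorMap k j w) ∉ μ.support := by
  have hF := (hΦ.isNaturalChart hs j).mono (N' := {w | 0 < w.re} ∩ Metric.ball 0 s)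
    ((isOpen_lt continuous_const Complex.continuous_re).inter Metric.isOpen_ball)
    (inter_subset_inter_left _ fun w hw => Or.inl hw)
  refine μ.notMem_support_of_null hF.isOpen_image (hF.totalVariation_image_eq_zero hS (s := ε j)
    fun w hw => hε j w hw.1 (mem_ball_zero_iff.1 hw.2)) ⟨w, ⟨hre, mem_ball_zero_iff.2 hw⟩, rfl⟩

/-- Beyond the ray the point is that of coordinate `-w` in the sector `j + 1`. Thus `h` is `ε j *
w.re` on one side and `-ε (j + 1) * w.re` on the other. -/
lemma eq_across_ray
    (hε : ∀ j, ∀ w : ℂ, 0 < w.re → ‖w‖ < s → h (Φ (sectorMap k j w)) = ε j * w.re)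
    (j : ℤ) {w : ℂ} (hre : w.re < 0) (him : 0 < w.im) (hw : ‖w‖ < s) :
    h (Φ (sectorMap k j w)) = -(ε (j + 1) * w.re) := by
  rw [← sectorMap_succ_neg k j him, hε (j + 1) (-w) (by simpa using hre) (by rwa [norm_neg])]
  simp

/-- Opposite signs give the same linear function on both sides of the ray, hence no mass in the
whole upper half disc of the chart. -/
lemma notMem_support_of_signs_ne (hΦ : IsNormalForm Ω ω z₀ k R Φ)
    (hS : IsStationarySolution μ h ω) (hs : s ^ 2 ≤ R ^ (2 * k + 3))
    (hε : ∀ j, ∀ w : ℂ, 0 < w.re → ‖w‖ < s → h (Φ (sectorMap k j w)) = ε j * w.re)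
    {j : ℤ} (hj : ε (j + 1) = -ε j) {w : ℂ} (him : 0 < w.im) (hw : ‖w‖ < s) :
    Φ (sectorMap k j w) ∉ μ.support := by
  have hF := (hΦ.isNaturalChart hs j).mono (N' := {w | 0 < w.im} ∩ Metric.ball 0 s)
    ((isOpen_lt continuous_const Complex.continuous_im).inter Metric.isOpen_ball)
    (inter_subset_inter_left _ fun w hw => Or.inr (ne_of_gt hw))
  refine μ.notMem_support_of_null hF.isOpen_image (hF.totalVariation_image_eq_zero hS (s := ε j)
    fun w hw => ?_) ⟨w, ⟨him, mem_ball_zero_iff.2 hw⟩, rfl⟩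
  have hws := mem_ball_zero_iff.1 hw.2
  rcases lt_trichotomy w.re 0 with h | h | h
  · rw [Function.comp_apply, eq_across_ray hε j h hw.1 hws, hj]; ring
  · rw [Function.comp_apply, hΦ.eq_zero_on_ray hS hs hε j h (ne_of_gt hw.1) hws, h, mul_zero]
  · exact hε j w h hws

/-- Equal signs make `h = ε |Re w|` across the ray. A null neighbourhood would make `h` affine on a
rectangle around the point by `exists_eq_affine`; the values at `-d/4`, `0` and `d/4` contradict
this. -/
lemma mem_support_of_signs_eq (hΦ : IsNormalForm Ω ω z₀ k R Φ)
    (hS : IsStationarySolution μ h ω) (hs : s ^ 2 ≤ R ^ (2 * k + 3))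
    (hε1 : ∀ j, ε j = 1 ∨ ε j = -1)
    (hε : ∀ j, ∀ w : ℂ, 0 < w.re → ‖w‖ < s → h (Φ (sectorMap k j w)) = ε j * w.re)
    {j : ℤ} (hj : ε (j + 1) = ε j) {w : ℂ} (hre : w.re = 0) (him : 0 < w.im) (hw : ‖w‖ < s) :
    Φ (sectorMap k j w) ∈ μ.support := by
  have hF := hΦ.isNaturalChart hs j
  have hwD : w ∈ Complex.slitPlane ∩ Metric.ball 0 s := ⟨Or.inr him.ne', mem_ball_zero_iff.2 hw⟩
  refine ⟨hF.mapsTo hwD, ?_⟩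
  by_contra hn
  obtain ⟨U, hU, hU0⟩ := Measure.notMem_support_iff_exists.1 hn
  have hpre : (Φ ∘ sectorMap k j) ⁻¹' U ∩ ((Complex.slitPlane ∩ Metric.ball 0 s) ∩ {w | 0 < w.im}) ∈
      𝓝 w := by
    refine inter_mem ?_ (inter_mem (hF.isOpen.mem_nhds hwD)
      ((isOpen_lt continuous_const Complex.continuous_im).mem_nhds him))
    exact (hF.differentiableOn.continuousOn.continuousAt (hF.isOpen.mem_nhds hwD)) hU
  obtain ⟨d, hd, hball⟩ := Metric.mem_nhds_iff.1 hpre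
  have hQ : Ioo (-(d / 2)) (d / 2) ×ℂ Ioo (w.im - d / 2) (w.im + d / 2) ⊆ Metric.ball w d := by
    rintro v ⟨⟨h1, h2⟩, h3, h4⟩
    rw [mem_ball_iff_norm]
    refine lt_of_pow_lt_pow_left₀ 2 hd.le ?_
    rw [Complex.sq_norm, Complex.normSq_apply, Complex.sub_re, Complex.sub_im, hre]
    nlinarith
  obtain ⟨e, b, he, hb⟩ := hF.exists_eq_affine hS (c := w.im - d / 4) (d := w.im + d / 4)
    (hQ.trans (hball.trans fun v hv => hv.2.1)) (by linarith)
    (fun y hy => ⟨by linarith [hy.1], by linarith [hy.2]⟩) (by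
      refine lt_of_le_of_lt (le_of_eq (measure_mono_null ?_ hU0)) (ENNReal.ofReal_pos.2 (by linarith))
      rintro _ ⟨v, ⟨hv1, hv2⟩, rfl⟩
      exact (hball (hQ ⟨hv1, ⟨by linarith [hv2.1], by linarith [hv2.2]⟩⟩)).1)
  have hmem : ∀ x ∈ Ioo (-(d / 2)) (d / 2), (x : ℂ) + w.im * Complex.I ∈
      Ioo (-(d / 2)) (d / 2) ×ℂ Ioo (w.im - d / 2) (w.im + d / 2) := by
    intro x hx
    simpa [Complex.mem_reProdIm] using ⟨hx, hd⟩
  have hval : ∀ x ∈ Ioo (-(d / 2)) (d / 2),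
      h (Φ (sectorMap k j (x + w.im * Complex.I))) = e * x + b := by
    intro x hx
    simpa using hb _ (hmem x hx)
  have hin : ∀ x ∈ Ioo (-(d / 2)) (d / 2), ‖(x : ℂ) + w.im * Complex.I‖ < s ∧
      0 < ((x : ℂ) + w.im * Complex.I).im := fun x hx =>
    ⟨mem_ball_zero_iff.1 (hball (hQ (hmem x hx))).2.1.2, (hball (hQ (hmem x hx))).2.2⟩
  have m1 : d / 4 ∈ Ioo (-(d / 2)) (d / 2) := ⟨by linarith, by linarith⟩
  have m2 : -(d / 4) ∈ Ioo (-(d / 2)) (d / 2) := ⟨by linarith, by linarith⟩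
  have m3 : (0 : ℝ) ∈ Ioo (-(d / 2)) (d / 2) := ⟨by linarith, by linarith⟩
  have v1 := hval _ m1
  have v2 := hval _ m2
  have v3 := hval _ m3
  rw [hε j _ (by simpa using by linarith) (hin _ m1).1] at v1
  rw [eq_across_ray hε j (by simpa using by linarith) (hin _ m2).2 (hin _ m2).1, hj] at v2
  rw [hΦ.eq_zero_on_ray hS hs hε j (by simp) (hin _ m3).2.ne' (hin _ m3).1] at v3
  simp at v1 v2 v3
  have : ε j * d = 0 := by linarith
  rcases hε1 j with h | h <;> rw [h] at this <;> linarith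

/-- Since the number of sectors is odd, two adjacent sectors carry the same sign. -/
lemma exists_signs_eq (hε1 : ∀ j, ε j = 1 ∨ ε j = -1) (hper : ∀ j, ε (j + (2 * k + 3 : ℕ)) = ε j) :
    ∃ i : Fin (2 * k + 3), ε ((i : ℕ) + 1 : ℤ) = ε (i : ℕ) := by
  by_contra hcon
  push Not at hcon
  have hne : ∀ i : ℕ, i < 2 * k + 3 → ε ((i : ℤ) + 1) = -ε i := by
    intro i hi
    have := hcon ⟨i, hi⟩
    simp only at this
    rcases hε1 (i + 1) with h | h <;> rcases hε1 i with h' | h' <;> simp_all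
  have hpow : ∀ i : ℕ, i ≤ 2 * k + 3 → ε (i : ℤ) = (-1) ^ i * ε 0 := by
    intro i
    induction i with
    | zero => simp
    | succ i ih =>
      intro hi
      push_cast
      rw [hne i (by omega), ih (by omega), pow_succ]
      ring
  have h1 := hpow (2 * k + 3) le_rfl
  have h2 := hper 0
  rw [zero_add] at h2
  rw [h2, Odd.neg_one_pow ⟨k + 1, by ring⟩] at h1
  rcases hε1 0 with h | h <;> rw [h] at h1 <;> norm_num at h1

end IsNormalForm

/-! ### The multivalued function `Re z^(n + 1/2)` and the uniqueness of `n`. -/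

lemma reHalfPow_nonempty (n : ℕ) (z : ℂ) : (reHalfPow n z).Nonempty := by
  obtain ⟨w, hw⟩ := IsAlgClosed.exists_pow_nat_eq (z ^ (2 * n + 1)) (n := 2) (by norm_num)
  exact ⟨w.re, w, hw, rfl⟩

lemma reHalfPow_eq_of_sq_eq {n : ℕ} {z q : ℂ} (hq : q ^ 2 = z ^ (2 * n + 1)) :
    reHalfPow n z = {q.re, -q.re} := by
  ext t
  constructor
  · rintro ⟨w, hw, rfl⟩
    rw [← hq, sq_eq_sq_iff_eq_or_eq_neg] at hw
    rcases hw with rfl | rfl <;> simp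
  · rintro (rfl | rfl)
    · exact ⟨q, hq, rfl⟩
    · exact ⟨-q, by rw [neg_sq, hq], by simp⟩

/-- Away from `z₀` the function `Ψ^(2n+1)` has no zero, so it has a local holomorphic square root
`q`; the branches are `±Re q`. -/
lemma isMultivaluedHarmonicOn_reHalfPow {V : Set ℂ} (hV : IsOpen V) {Ψ : ℂ → ℂ} {z₀ : ℂ}
    (hΨ : DifferentiableOn ℂ Ψ V) (h0 : ∀ z ∈ V \ {z₀}, Ψ z ≠ 0) (n : ℕ) :
    IsMultivaluedHarmonicOn (fun z => reHalfPow n (Ψ z)) V z₀ := by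
  refine ⟨fun z _ => reHalfPow_nonempty n _, fun p hp => ?_⟩
  have hg : AnalyticAt ℂ (fun z => Ψ z ^ (2 * n + 1)) p :=
    (hΨ.analyticAt (hV.mem_nhds hp.1)).pow _
  obtain ⟨q, hq, -, hqg⟩ := exists_root_near hg (pow_ne_zero _ (h0 p hp)) (m := 2) (by norm_num)
  have hVp : IsOpen (V \ {z₀}) := hV.sdiff isClosed_singleton
  obtain ⟨U, hU, hUo, hpU⟩ := eventually_nhds_iff.1
    ((hqg.and hq.eventually_analyticAt).and (hVp.mem_nhds hp))
  exact ⟨U, hUo, hpU, fun z hz => (hU z hz).2, fun z => (q z).re,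
    fun z hz => (hU z hz).1.2.harmonicAt_re, fun z hz => reHalfPow_eq_of_sq_eq (hU z hz).1.1⟩

/-- A change of variable which turns `Re (z ^ (n + 1 / 2))` into `Re (z ^ (n' + 1 / 2))` does not
lower the order of vanishing. -/
lemma le_of_reHalfPow_comp_eq {n n' : ℕ} {ψ : ℂ → ℂ} (hψ : DifferentiableAt ℂ ψ 0)
    (h0 : ψ 0 = 0) (heq : ∀ᶠ z in 𝓝 0, reHalfPow n (ψ z) = reHalfPow n' z) : n ≤ n' := by
  by_contra! hlt
  obtain ⟨C, hC, hCψ⟩ := hψ.isBigO_sub.exists_pos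
  rw [Asymptotics.isBigOWith_iff] at hCψ
  have hreal : Tendsto (fun x : ℝ => (x : ℂ)) (𝓝[>] 0) (𝓝 0) := by
    have := Complex.continuous_ofReal.tendsto 0
    rw [Complex.ofReal_zero] at this
    exact this.mono_left nhdsWithin_le_nhds
  -- At `x > 0` the value `√(x^(2n'+1))` is the real part of a square root of `ψ(x)^(2n+1)`, so
  -- `x^(2n'+1) ≤ (C x)^(2n+1)`. If `n' < n`, division leaves a positive power of `x` bounded below,
  -- which is absurd.
  have hev : ∀ᶠ x : ℝ in 𝓝[>] 0, 1 ≤ C ^ (2 * n + 1) * x ^ (2 * (n - n')) := by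
    filter_upwards [hreal.eventually heq, hreal.eventually hCψ, self_mem_nhdsWithin]
      with x hx1 hx2 (hx : 0 < x)
    have hroot : (((√(x ^ (2 * n' + 1)) : ℝ) : ℂ)) ^ 2 = (x : ℂ) ^ (2 * n' + 1) := by
      rw [← Complex.ofReal_pow, Real.sq_sqrt (by positivity), Complex.ofReal_pow]
    have hmem : √(x ^ (2 * n' + 1)) ∈ reHalfPow n' x := ⟨_, hroot, by simp⟩
    rw [← hx1] at hmem
    obtain ⟨w, hw, hwre⟩ := hmem
    rw [h0, sub_zero, sub_zero, Complex.norm_real, Real.norm_of_nonneg hx.le] at hx2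
    have h1 : x ^ (2 * n' + 1) ≤ ‖w‖ ^ 2 := by
      rw [← Real.sq_sqrt (by positivity : 0 ≤ x ^ (2 * n' + 1)), hwre, ← sq_abs w.re]
      exact pow_le_pow_left₀ (abs_nonneg _) (Complex.abs_re_le_norm w) 2
    rw [← norm_pow, hw, norm_pow] at h1
    have h2 : x ^ (2 * n' + 1) ≤ C ^ (2 * n + 1) * x ^ (2 * (n - n')) * x ^ (2 * n' + 1) := by
      calc x ^ (2 * n' + 1) ≤ ‖ψ x‖ ^ (2 * n + 1) := h1
        _ ≤ (C * x) ^ (2 * n + 1) := pow_le_pow_left₀ (norm_nonneg _) hx2 _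
        _ = C ^ (2 * n + 1) * x ^ (2 * (n - n')) * x ^ (2 * n' + 1) := by
            rw [mul_pow, mul_assoc, ← pow_add]
            congr 2
            omega
    exact le_of_mul_le_mul_right (by rwa [one_mul]) (by positivity)
  have hlim : Tendsto (fun x : ℝ => C ^ (2 * n + 1) * x ^ (2 * (n - n'))) (𝓝[>] 0) (𝓝 0) := by
    have : Tendsto (fun x : ℝ => C ^ (2 * n + 1) * x ^ (2 * (n - n'))) (𝓝 0)
        (𝓝 (C ^ (2 * n + 1) * 0 ^ (2 * (n - n')))) := Continuous.tendsto (by fun_prop) 0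
    rw [zero_pow (by omega), mul_zero] at this
    exact this.mono_left nhdsWithin_le_nhds
  exact absurd (ge_of_tendsto hlim hev) (by norm_num)

/-- The transition map `Φ⁻¹ ∘ Φ'` fixes 0 and turns one normal form into the other. Exchanging the
two biholomorphisms gives the opposite inequality. -/
lemma le_of_biholomorphisms {H₁ : ℂ → Set ℝ} {V : Set ℂ} (hV : IsOpen V) {z₀ : ℂ} {n n' : ℕ}
    {r r' : ℝ} (hr : 0 < r) (hr' : 0 < r') {Φ Φ' : ℂ → ℂ}
    (hΦ : IsBiholomorphism Φ (Metric.ball 0 r) V) (hΦ' : IsBiholomorphism Φ' (Metric.ball 0 r') V)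
    (h0 : Φ 0 = z₀) (h0' : Φ' 0 = z₀)
    (heq : ∀ z ∈ Metric.ball (0 : ℂ) r, H₁ (Φ z) = reHalfPow n z)
    (heq' : ∀ z ∈ Metric.ball (0 : ℂ) r', H₁ (Φ' z) = reHalfPow n' z) : n ≤ n' := by
  obtain ⟨-, hb, Ψ, hΨ, hinv⟩ := hΦ
  have hz : z₀ ∈ V := h0 ▸ hb.mapsTo (Metric.mem_ball_self hr)
  have hball := Metric.ball_mem_nhds (0 : ℂ) hr'
  have hinvOn : MapsTo Ψ V (Metric.ball 0 r) := by
    intro z hz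
    obtain ⟨w, hw, rfl⟩ := hb.surjOn hz
    rwa [hinv.1 hw]
  refine le_of_reHalfPow_comp_eq (ψ := Ψ ∘ Φ') ?_ ?_ ?_
  · refine DifferentiableAt.comp _ ?_ (hΦ'.1.differentiableAt hball)
    rw [h0']
    exact hΨ.differentiableAt (hV.mem_nhds hz)
  · rw [Function.comp_apply, h0', ← h0]
    exact hinv.1 (Metric.mem_ball_self hr)
  · filter_upwards [hball] with z hz
    have hzV := hΦ'.2.1.mapsTo hz
    rw [← heq' z hz, Function.comp_apply, ← heq _ (hinvOn hzV), hinv.2 hzV]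

/-- Here `f² = O(|z - z₀|^m)` with `m > 2`, so `f = o(|z - z₀|)`; working with squares avoids the
half-integral power `m/2`. -/
lemma hasGradientAt_zero_of_sq_le {f : ℂ → ℝ} {Ψ : ℂ → ℂ} {z₀ : ℂ} {m : ℕ} (hm : 2 < m)
    (hΨ : DifferentiableAt ℂ Ψ z₀) (h0 : Ψ z₀ = 0)
    (hf : ∀ᶠ z in 𝓝 z₀, f z ^ 2 ≤ ‖Ψ z‖ ^ m) : HasGradientAt f 0 z₀ := by
  have hf0 : f z₀ = 0 := by
    have := hf.self_of_nhds
    rw [h0, norm_zero, zero_pow (by omega)] at this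
    exact pow_eq_zero_iff (two_ne_zero) |>.1 (le_antisymm this (sq_nonneg _))
  have h1 : (fun z => f z ^ 2) =O[𝓝 z₀] fun z => ‖Ψ z‖ ^ m :=
    Asymptotics.IsBigO.of_bound 1 (hf.mono fun z hz => by
      rwa [Real.norm_of_nonneg (sq_nonneg _), Real.norm_of_nonneg (by positivity), one_mul])
  have h2 : Ψ =O[𝓝 z₀] fun z => z - z₀ := by
    have := hΨ.isBigO_sub
    simpa only [h0, sub_zero] using this
  have h3 : (fun z => f z ^ 2) =o[𝓝 z₀] fun z => ‖z - z₀‖ ^ 2 :=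
    (h1.trans (h2.norm_norm.pow m)).trans_isLittleO (Asymptotics.isLittleO_pow_sub_pow_sub z₀ hm)
  have h4 : f =o[𝓝 z₀] fun z => z - z₀ := by
    have := h3.of_pow two_ne_zero
    exact this.of_norm_right
  rw [hasGradientAt_iff_isLittleO]
  simpa [hf0] using h4

/-! ### Curves in the support and the conclusion. -/

lemma IsStationarySolution.of_representatives {Ω : TopologicalSpace.Opens ℂ}
    {μ : SignedRadonMeasure Ω} {h hx hy hc : ℂ → ℝ} {ω : ℂ → ℂ}
    (hH1 : IsH1WithGradient Ω h hx hy) (hlap : HasDistribLaplacian Ω h μ)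
    (hlip : LocallyLipschitzOn Ω hc) (hω : ω =ᵐ[volume.restrict Ω] hopfDifferential hx hy)
    (hgrad : ∀ᵐ z ∂volume.restrict (Ω : Set ℂ), DifferentiableAt ℝ hc z ∧
      fderiv ℝ hc z 1 = hx z ∧ fderiv ℝ hc z Complex.I = hy z) :
    IsStationarySolution μ hc ω := by
  refine ⟨hlip, ?_, fun φ => ?_⟩
  · filter_upwards [hω, hgrad] with z h1 ⟨h2, h3, h4⟩
    refine ⟨h2, ?_⟩
    rw [h1, h3, h4, hopfDifferential, sub_sq, mul_pow, Complex.I_sq]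
    ring
  · rw [pairing_eq_neg_integral_gradient hH1 hlap φ]
    congr 1
    refine integral_congr_ae ?_
    filter_upwards [hgrad] with z ⟨_, h3, h4⟩
    simp only [partialX, partialY, h3, h4]

/-- Both vectors are of norm 1 and lie on the image of the positive imaginary axis under the same
branch, as `sectorMap` is periodic in `j`. -/
lemma rayDirection_emod (k : ℕ) (j : ℤ) :
    rayDirection k (j % (2 * k + 3 : ℕ)) = rayDirection k j := by
  have hp : Function.Periodic (rayDirection k) ((2 * k + 3 : ℕ) : ℤ) := fun j => by
    obtain ⟨τ, hτ, h⟩ := exists_sectorMap_mul_I k j one_pos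
    obtain ⟨τ', hτ', h'⟩ := exists_sectorMap_mul_I k (j + (2 * k + 3 : ℕ)) one_pos
    rw [sectorMap_periodic, sectorMap_mul_I k j hτ'] at h'
    have hn : ‖sectorMap k j (τ' * Complex.I)‖ = 1 := by
      have := congrArg (fun z : ℂ => ‖z‖) h'
      simpa [norm_rayDirection] using this
    rw [hn] at h'
    simpa using h'.symm
  rw [Int.emod_def, mul_comm, ← smul_eq_mul]
  exact hp.sub_zsmul_eq _

namespace IsNormalForm

variable {Ω : TopologicalSpace.Opens ℂ} {ω Φ : ℂ → ℂ} {z₀ : ℂ} {k : ℕ} {R : ℝ}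
  {μ : SignedRadonMeasure Ω} {h : ℂ → ℝ} {s r : ℝ} {ε : ℤ → ℝ}

lemma isSmoothCurveEndingAt (hΦ : IsNormalForm Ω ω z₀ k R Φ) (hr : 0 < r) (hrR : r ≤ R) {d : ℂ}
    (hd : ‖d‖ = 1) : IsSmoothCurveEndingAt (fun t : ℝ => Φ ((r * t : ℝ) * d)) z₀ := by
  have hd0 : d ≠ 0 := norm_ne_zero_iff.1 (by rw [hd]; norm_num)
  have hmem : ∀ t ∈ Ico (0 : ℝ) 1, ((r * t : ℝ) : ℂ) * d ∈ Metric.ball (0 : ℂ) R := by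
    intro t ht
    rw [mem_ball_zero_iff, norm_mul, hd, mul_one, Complex.norm_real,
      Real.norm_of_nonneg (mul_nonneg hr.le ht.1)]
    nlinarith [ht.2]
  refine ⟨by simp [hΦ.map_zero], ?_, ?_, fun t ht => ?_⟩
  · have h1 : ContDiffOn ℝ ((⊤ : ℕ∞) : WithTop ℕ∞) Φ (Metric.ball 0 R) :=
      ((hΦ.differentiableOn.contDiffOn Metric.isOpen_ball).restrict_scalars ℝ)
    refine h1.comp (ContDiff.contDiffOn ?_) hmem
    exact (Complex.ofRealCLM.contDiff.comp (contDiff_const.mul contDiff_id)).mul contDiff_const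
  · intro t ht t' ht' he
    have := mul_right_cancel₀ hd0 (hΦ.injOn (hmem t ht) (hmem t' ht') he)
    exact mul_left_cancel₀ hr.ne' (Complex.ofReal_injective this)
  · have h1 := (hΦ.differentiableOn.differentiableAt
      (Metric.isOpen_ball.mem_nhds (hmem t ht))).hasDerivAt
    have h2 : HasDerivAt (fun t : ℝ => ((r * t : ℝ) : ℂ) * d) ((r * 1 : ℝ) * d) t :=
      (((hasDerivAt_id t).const_mul r).ofReal_comp).mul_const d
    have h3 := (h1.comp t h2).hasDerivWithinAt (s := Ico 0 1)
    have h4 := h3.derivWithin (uniqueDiffOn_Ico 0 1 t ht)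
    refine ne_of_eq_of_ne h4 (mul_ne_zero (hΦ.deriv_ne_zero _ (hmem t ht)) (mul_ne_zero ?_ hd0))
    simpa using hr.ne'

lemma exists_coordinate_on_ray (hr : 0 < r) (hrs : r ^ (2 * k + 3) ≤ s ^ 2) (hs0 : 0 < s) (j : ℤ)
    {t : ℝ} (ht0 : 0 < t) (ht1 : t < 1) : ∃ w : ℂ, w.re = 0 ∧ 0 < w.im ∧ ‖w‖ < s ∧
      sectorMap k j w = (r * t : ℝ) * rayDirection k j := by
  obtain ⟨τ, hτ, hτw⟩ := exists_sectorMap_mul_I k j (mul_pos hr ht0)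
  refine ⟨τ * Complex.I, by simp, by simpa using hτ, ?_, hτw⟩
  refine lt_of_pow_lt_pow_left₀ 2 hs0.le ?_
  rw [← norm_sectorMap_pow k j (mul_ne_zero (Complex.ofReal_ne_zero.2 hτ.ne') Complex.I_ne_zero),
    hτw, norm_mul, norm_rayDirection, mul_one, Complex.norm_real,
    Real.norm_of_nonneg (mul_pos hr ht0).le]
  refine lt_of_lt_of_le (pow_lt_pow_left₀ ?_ (mul_pos hr ht0).le (by omega)) hrs
  nlinarith

lemma eq_zero_on_curve (hΦ : IsNormalForm Ω ω z₀ k R Φ) (hS : IsStationarySolution μ h ω)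
    (h0 : h z₀ = 0) (hs0 : 0 < s) (hs : s ^ 2 ≤ R ^ (2 * k + 3)) (hr : 0 < r)
    (hrs : r ^ (2 * k + 3) ≤ s ^ 2)
    (hε : ∀ j, ∀ w : ℂ, 0 < w.re → ‖w‖ < s → h (Φ (sectorMap k j w)) = ε j * w.re) (j : ℤ)
    {t : ℝ} (ht : t ∈ Ico (0 : ℝ) 1) : h (Φ ((r * t : ℝ) * rayDirection k j)) = 0 := by
  rcases ht.1.eq_or_lt with rfl | ht0
  · simp [hΦ.map_zero, h0]
  · obtain ⟨w, hre, him, hw, hwt⟩ := exists_coordinate_on_ray hr hrs hs0 j ht0 ht.2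
    rw [← hwt]
    exact hΦ.eq_zero_on_ray hS hs hε j hre him.ne' hw

/-- Near `z₀` the support of the Laplacian consists of the rays between sectors of equal sign. -/
lemma support_inter_image_ball (hΦ : IsNormalForm Ω ω z₀ k R Φ) (hS : IsStationarySolution μ h ω)
    (hz₀ : z₀ ∈ μ.support) (hs0 : 0 < s) (hs : s ^ 2 ≤ R ^ (2 * k + 3)) (hr : 0 < r)
    (hrs : r ^ (2 * k + 3) ≤ s ^ 2) (hε1 : ∀ j, ε j = 1 ∨ ε j = -1)
    (hper : ∀ j, ε (j + (2 * k + 3 : ℕ)) = ε j)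
    (hε : ∀ j, ∀ w : ℂ, 0 < w.re → ‖w‖ < s → h (Φ (sectorMap k j w)) = ε j * w.re) :
    μ.support ∩ Φ '' Metric.ball 0 r =
      ⋃ i : {i : Fin (2 * k + 3) // ε ((i : ℕ) + 1 : ℤ) = ε (i : ℕ)},
        (fun t : ℝ => Φ ((r * t : ℝ) * rayDirection k (i : ℕ))) '' Ico 0 1 := by
  have hεmod : ∀ j : ℤ, ε (j % (2 * k + 3 : ℕ)) = ε j := fun j => by
    have hp : Function.Periodic ε ((2 * k + 3 : ℕ) : ℤ) := hper
    rw [Int.emod_def, mul_comm, ← smul_eq_mul]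
    exact hp.sub_zsmul_eq _
  ext z
  rw [mem_iUnion]
  constructor
  · rintro ⟨hz, ζ, hζ, rfl⟩
    rw [mem_ball_zero_iff] at hζ
    rcases eq_or_ne ζ 0 with rfl | hζ0
    -- The centre lies on every curve, but at least one curve must exist: this is where the odd
    -- number of sectors enters.
    · obtain ⟨i, hi⟩ := exists_signs_eq hε1 hper
      exact ⟨⟨i, hi⟩, 0, ⟨le_rfl, one_pos⟩, by simp⟩
    · obtain ⟨j, w, rfl, hws, hre⟩ := exists_coordinate hs0 hζ0
        ((pow_lt_pow_left₀ hζ (norm_nonneg ζ) (by omega)).trans_le hrs)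
      rcases hre with hre | ⟨hre, him⟩
      · exact absurd hz (hΦ.notMem_support_of_re_pos hS hs hε j hre hws)
      · have hj : ε (j + 1) = ε j := by
          by_contra hne
          refine hΦ.notMem_support_of_signs_ne hS hs hε (j := j) ?_ him hws hz
          rcases hε1 (j + 1) with h | h <;> rcases hε1 j with h' | h' <;> simp_all
        have hpos : (0 : ℤ) < (2 * k + 3 : ℕ) := by positivity
        have hnn := Int.emod_nonneg j hpos.ne'
        have hlt := Int.emod_lt_of_pos j hpos
        have hcast : (((j % (2 * k + 3 : ℕ)).toNat : ℕ) : ℤ) = j % (2 * k + 3 : ℕ) :=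
          Int.toNat_of_nonneg hnn
        have hw : w = (w.im : ℂ) * Complex.I := by
          apply Complex.ext <;> simp [hre]
        refine ⟨⟨⟨(j % (2 * k + 3 : ℕ)).toNat, by omega⟩, ?_⟩,
          ‖sectorMap k j w‖ / r, ⟨by positivity, (div_lt_one hr).2 hζ⟩, ?_⟩
        · simp only [hcast]
          rw [hεmod, ← hεmod, Int.emod_add_emod, hεmod, hj]
        · simp only [hcast]
          rw [rayDirection_emod, mul_div_cancel₀ _ hr.ne']
          congr 1
          rw [hw]
          exact (sectorMap_mul_I k j him).symm
  · rintro ⟨⟨i, hi⟩, t, ht, rfl⟩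
    have hball : ((r * t : ℝ) : ℂ) * rayDirection k (i : ℕ) ∈ Metric.ball (0 : ℂ) r := by
      rw [mem_ball_zero_iff, norm_mul, norm_rayDirection, mul_one, Complex.norm_real,
        Real.norm_of_nonneg (mul_nonneg hr.le ht.1)]
      nlinarith [ht.2]
    refine ⟨?_, _, hball, rfl⟩
    rcases ht.1.eq_or_lt with rfl | ht0
    · simpa [hΦ.map_zero] using hz₀
    · obtain ⟨w, hre, him, hw, hwt⟩ := exists_coordinate_on_ray hr hrs hs0 (i : ℕ) ht0 ht.2
      simp only [← hwt]
      exact hΦ.mem_support_of_signs_eq hS hs hε1 hε hi hre him hw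

end IsNormalForm

theorem theorem3 (Ω : TopologicalSpace.Opens ℂ) (hΩ : Bornology.IsBounded (Ω : Set ℂ))
    (μ : SignedRadonMeasure Ω) (h hx hy : ℂ → ℝ)
    (hH1 : IsH1WithGradient Ω h hx hy)
    (hlap : HasDistribLaplacian Ω h μ)
    (hstat : IsStationaryHarmonic Ω hx hy) :
    -- the continuous representative `hc` of `h`, the holomorphic representative `ω` of `ω_h`
    ∃ (hc : ℂ → ℝ) (ω : ℂ → ℂ),
      ContinuousOn hc Ω ∧ hc =ᵐ[volume.restrict Ω] h ∧
      DifferentiableOn ℂ ω Ω ∧ ω =ᵐ[volume.restrict Ω] hopfDifferential hx hy ∧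
      ∀ z₀ ∈ μ.support, (∃ m : ℕ, Odd m ∧ analyticOrderAt ω z₀ = m) → hc z₀ = 0 →
        ∃ (V : Set ℂ) (H₁ : ℂ → Set ℝ) (H θ : ℂ → ℝ),
          IsOpen V ∧ z₀ ∈ V ∧ V ⊆ Ω ∧
          IsMultivaluedHarmonicOn H₁ V z₀ ∧
          -- `H = |H₁|` is single valued
          (∀ z ∈ V, ∀ t ∈ H₁ z, |t| = H z) ∧
          (∀ z ∈ V, θ z = 1 ∨ θ z = -1) ∧
          (∀ z ∈ V, hc z = θ z * H z) ∧
          ContinuousOn (fun z => θ z * H z) V ∧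
          HasGradientAt H 0 z₀ ∧
          -- the support of the restriction of `μ` to `V`
          (∃ (N : ℕ) (γ : Fin N → ℝ → ℂ),
            (∀ i, IsSmoothCurveEndingAt (γ i) z₀ ∧
              γ i '' Set.Ico 0 1 ⊆ {z | z ∈ V ∧ H z = 0}) ∧
            μ.support ∩ V = ⋃ i, γ i '' Set.Ico 0 1) ∧
          -- the normal form of `H₁`
          (∃! n : ℕ, 1 ≤ n ∧ ∃ r : ℝ, 0 < r ∧ ∃ Φ : ℂ → ℂ,
            IsBiholomorphism Φ (Metric.ball 0 r) V ∧ Φ 0 = z₀ ∧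
            ∀ z ∈ Metric.ball (0 : ℂ) r, H₁ (Φ z) = reHalfPow n z) := by
  obtain ⟨hc, ω, hlip, hch, hω, hωae, hgrad⟩ := exists_regular_representatives hΩ hH1 hstat
  have hS : IsStationarySolution μ hc ω := .of_representatives hH1 hlap hlip hωae hgrad
  refine ⟨hc, ω, hlip.continuousOn, hch, hω, hωae, fun z₀ hz₀ ⟨m, ⟨k, hk⟩, hm⟩ h0 => ?_⟩
  have hΩz : (Ω : Set ℂ) ∈ 𝓝 z₀ := Ω.isOpen.mem_nhds hz₀.1
  obtain ⟨R, Φ, hR, hΦd, hΦi, hΦm, hΦ0, hΦeq⟩ :=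
    exists_normalForm (hω.analyticAt hΩz) (hk ▸ hm) hΩz
  have hΦ : IsNormalForm Ω ω z₀ k R Φ :=
    ⟨hR, hΦd, hΦi, hΦm, hΦ0, fun ζ hζ => (hΦeq ζ hζ).1, fun ζ hζ => (hΦeq ζ hζ).2⟩
  obtain ⟨s, hs0, hs, ε, hε1, hper, hε⟩ := hΦ.exists_signs hS h0
  -- Since `|ζ|^(2k+3) = |w|²`, this `r` makes `|ζ| < r` equivalent to `|w| < s`.
  obtain ⟨r, hr, hrs⟩ : ∃ r : ℝ, 0 < r ∧ r ^ (2 * k + 3) = s ^ 2 :=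
    ⟨(s ^ 2) ^ (((2 * k + 3 : ℕ) : ℝ)⁻¹), by positivity,
      Real.rpow_inv_natCast_pow (by positivity) (by omega)⟩
  have hrR : r ≤ R := le_of_pow_le_pow_left₀ (by omega) hR.le (hrs.trans_le hs)
  have hball : Metric.ball (0 : ℂ) r ⊆ Metric.ball 0 R := Metric.ball_subset_ball hrR
  obtain ⟨hV, Ψ, hΨd, hΨ⟩ := exists_holomorphic_inverse Metric.isOpen_ball (hΦd.mono hball)
    (hΦi.mono hball) fun ζ hζ => hΦ.deriv_ne_zero ζ (hball hζ)
  set V := Φ '' Metric.ball 0 r with hVdef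
  have h0r := Metric.mem_ball_self (x := (0 : ℂ)) hr
  have hz₀V : z₀ ∈ V := ⟨0, h0r, hΦ0⟩
  have hVΩ : V ⊆ Ω := image_subset_iff.2 fun ζ hζ => hΦm (hball hζ)
  have hΨ0 : Ψ z₀ = 0 := by rw [← hΦ0]; exact hΨ 0 h0r
  have hlt : ∀ ζ ∈ Metric.ball (0 : ℂ) r, ‖ζ‖ ^ (2 * k + 3) < s ^ 2 := fun ζ hζ =>
    (pow_lt_pow_left₀ (mem_ball_zero_iff.1 hζ) (norm_nonneg ζ) (by omega)).trans_eq hrs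
  -- `n = k + 1`, because `2 (k + 1) + 1 = 2k + 3` is the number of sectors.
  have habs : ∀ z ∈ V, ∀ t ∈ reHalfPow (k + 1) (Ψ z), |t| = |hc z| := by
    rintro _ ⟨ζ, hζ, rfl⟩ _ ⟨v, hv, rfl⟩
    rw [hΨ ζ hζ] at hv
    exact hΦ.abs_re_eq hS h0 hs0 hs hε1 hε (hlt ζ hζ) hv
  -- With `H = |h|`, `θ` is the sign of `h`; it takes the value 1 where `h` vanishes, which does not
  -- affect the product.
  have hsign : ∀ z, hc z = (if 0 ≤ hc z then 1 else -1) * |hc z| := by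
    intro z
    split_ifs with hz
    · rw [one_mul, abs_of_nonneg hz]
    · rw [abs_of_neg (not_le.1 hz)]; ring
  have hbi : IsBiholomorphism Φ (Metric.ball 0 r) V :=
    ⟨hΦd.mono hball, (hΦi.mono hball).bijOn_image, Ψ, hΨd, fun ζ hζ => hΨ ζ hζ, by
      rintro _ ⟨ζ, hζ, rfl⟩
      rw [hΨ ζ hζ]⟩
  have hnormal : ∀ ζ ∈ Metric.ball (0 : ℂ) r,
      reHalfPow (k + 1) (Ψ (Φ ζ)) = reHalfPow (k + 1) ζ := fun ζ hζ => by rw [hΨ ζ hζ]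
  refine ⟨V, fun z => reHalfPow (k + 1) (Ψ z), fun z => |hc z|,
    fun z => if 0 ≤ hc z then 1 else -1, hV, hz₀V, hVΩ,
    isMultivaluedHarmonicOn_reHalfPow hV hΨd ?_ _, habs, fun z _ => ?_, fun z _ => hsign z,
    ?_, ?_, ?_, k + 1, ⟨by omega, r, hr, Φ, hbi, hΦ0, hnormal⟩, ?_⟩
  · rintro _ ⟨⟨ζ, hζ, rfl⟩, hne⟩
    rw [hΨ ζ hζ]
    rintro rfl
    exact hne hΦ0
  · by_cases hz : 0 ≤ hc z <;> simp [hz]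
  · exact (hlip.continuousOn.mono hVΩ).congr fun z _ => (hsign z).symm
  · refine hasGradientAt_zero_of_sq_le (m := 2 * k + 3) (by omega)
      (hΨd.differentiableAt (hV.mem_nhds hz₀V)) hΨ0 ?_
    filter_upwards [hV.mem_nhds hz₀V] with z hz
    obtain ⟨v, hv⟩ := IsAlgClosed.exists_pow_nat_eq (Ψ z ^ (2 * k + 3)) (n := 2) (by norm_num)
    rw [← habs z hz v.re ⟨v, hv, rfl⟩, ← norm_pow, ← hv, norm_pow]
    exact pow_le_pow_left₀ (abs_nonneg _) (Complex.abs_re_le_norm v) 2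
  · set e := Fintype.equivFin {i : Fin (2 * k + 3) // ε ((i : ℕ) + 1 : ℤ) = ε (i : ℕ)}
    refine ⟨_, fun i t => Φ ((r * t : ℝ) * rayDirection k ((e.symm i).1 : ℕ)),
      fun i => ⟨hΦ.isSmoothCurveEndingAt hr hrR (norm_rayDirection k _), ?_⟩, ?_⟩
    · rintro _ ⟨t, ht, rfl⟩
      have hzero := hΦ.eq_zero_on_curve hS h0 hs0 hs hr hrs.le hε ((e.symm i).1 : ℕ) ht
      refine ⟨mem_image_of_mem Φ ?_, by simpa only [abs_eq_zero] using hzero⟩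
      rw [mem_ball_zero_iff, norm_mul, norm_rayDirection, mul_one, Complex.norm_real,
        Real.norm_of_nonneg (mul_nonneg hr.le ht.1)]
      nlinarith [ht.2]
    · rw [hVdef, hΦ.support_inter_image_ball hS hz₀ hs0 hs hr hrs.le hε1 hper hε]
      exact (e.symm.surjective.iUnion_comp fun i => (fun t : ℝ =>
        Φ ((r * t : ℝ) * rayDirection k (i.1 : ℕ))) '' Ico 0 1).symm
  · rintro n' ⟨-, r', hr', Φ', hbi', hΦ0', hnormal'⟩
    have hle {n n' : ℕ} {r r' : ℝ} {Φ Φ' : ℂ → ℂ} (hr : 0 < r) (hr' : 0 < r') :=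
      le_of_biholomorphisms (H₁ := fun z => reHalfPow (k + 1) (Ψ z)) hV (z₀ := z₀) (n := n)
        (n' := n') hr hr' (Φ := Φ) (Φ' := Φ')
    exact le_antisymm (hle hr' hr hbi' hbi hΦ0' hΦ0 hnormal' hnormal)
      (hle hr hr' hbi hbi' hΦ0 hΦ0' hnormal hnormal')
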